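/- Let $0<a<1$ and let $\boldsymbol R^3_1$ be Lorentz--Minkowski space with coordinates $(x_0,x_1,x_2)$, signature $(-,+,+)$. On the sector $\{|z|\le 1,\ 0\le\arg z\le\pi/4\}$ let $w$ be the continuous branch of $w^2=z^8+(a^4+a^{-4})z^4+1$ with $w(0)=1$, and set $$f_a(z)=\Re\int_1^z\bigl(-2z,\;1+z^2,\;i(1-z^2)\bigr)\,\frac{i\,dz}{w},\qquad \Omega_a^{\max}=\{f_a(z):0\le|z|<1,\ 0\le\arg z\le\pi/4\}$$ (the spacelike maximal piece). Let $$\gamma_a(s)=\int_0^s\xi_a(t)\,(1,-\cos t,-\sin t)\,dt,\qquad \xi_a(t)=\frac{2}{\sqrt{2\cos 4t+a^4+a^{-4}}},$$ $$\tilde f_a(u,v)=\tfrac12\bigl(\gamma_a(u+v)+\gamma_a(u-v)\bigr),\qquad \Omega_a^{\min}=\{\tilde f_a(u,v):0\le u\le\pi/4,\ 0<v\le\pi/2\}$$ (the fold curve and the timelike minimal piece), and let $\Omega_a^1=\Omega_a^{\max}\cup\{\gamma_a(s):0\le s\le\pi/4\}\cup\Omega_a^{\min}$. Its boundary $\partial\Omega_a^1$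 consists of $\mathcal L_A$, the image of $\arg z=0$ under $f_a$ and of $u=0$ under $\tilde f_a$, together with $\gamma_a(0)$; of $\mathcal L_B$, the image of $\{a\le|z|<1,\ \arg z=\pi/4\}$ under $f_a$ and of $u=\pi/4$ under $\tilde f_a$, together with $\gamma_a(\pi/4)$; of $\mathcal L_C^{\max}$, the image of $\{0\le|z|\le a,\ \arg z=\pi/4\}$ under $f_a$; and of the vertical segment $\mathcal L_C^{\min}=\{\tilde f_a(u,\pi/2):0\le u\le\pi/4\}$, whose length is denoted $|\mathcal L_C^{\min}|$. Let $\Delta$ be the convex hull of the projection of $\partial\Omega_a^1$ to the $x_1x_2$-plane. Then the following hold. 1. $\Omega_a^1$ is embedded. That is: $f_a$, $\gamma_a$ and $\tilde f_a$ are injective on the parameter domains above; the three parts of $\Omega_a^1$ are pairwise disjoint; $\tilde f_a$ is an immersion there, and so is $f_a$, with $z$ as local coordinate away from $z=ae^{i\pi/4}$ and $w$ as local coordinate at that point; and $\Omega_a^1$ is a smoothly embedded surface with piecewise smooth boundary (locally, in suitable smooth coordinates of the ambient space, an open piece of a quadrant of a plane), in particular across the fold curve. 2. The projection of $\partial\Omega_a^1$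 to the $x_1x_2$-plane is an isosceles right triangle (so $\Delta$ is this triangle with its interior), and $\Omega_a^1$ is contained in the closure of the vertical prism $\{(x_0,x_1,x_2):(x_1,x_2)\in\Delta,\ 0\le x_0\le|\mathcal L_C^{\min}|\}$. -/

import Mathlib

open scoped Real ContDiff

noncomputable section

namespace SchwarzD

/-- The underlying vector space of Lorentz-Minkowski space, with coordinates `x 0, x 1, x 2`;
the coordinate `x 0` is the vertical (timelike) one. -/
abbrev R31 : Type := EuclideanSpace ℝ (Fin 3)

/-- The horizontal `x₁x₂`-plane. -/
abbrev Plane : Type := EuclideanSpace ℝ (Fin 2)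

/-- The vertical projection to the `x₁x₂`-plane. -/
def proj (x : R31) : Plane := !₂[x 1, x 2]

/-! ### The maximal piece -/

/-- The branch of `w` with `w ^ 2 = z ^ 8 + (a ^ 4 + a ^ (-4)) * z ^ 4 + 1` and `w = 1` at `z = 0`
on the sector `0 ≤ arg z ≤ π / 4`, `|z| ≤ 1`. There `z ^ 4` lies in the closed upper half plane,
so this product of principal square roots is continuous on the closed sector. -/
def wBranch (a : ℝ) (z : ℂ) : ℂ :=
  (z ^ 4 + (a : ℂ) ^ 4) ^ (1 / 2 : ℂ) * (z ^ 4 + ((a : ℂ)⁻¹) ^ 4) ^ (1 / 2 : ℂ)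

theorem wBranch_sq {a : ℝ} (ha : a ≠ 0) (z : ℂ) :
    wBranch a z ^ 2 = z ^ 8 + ((a : ℂ) ^ 4 + ((a : ℂ)⁻¹) ^ 4) * z ^ 4 + 1 := by
  have h : ∀ x : ℂ, (x ^ (1 / 2 : ℂ)) ^ 2 = x := fun x => by
    have := Complex.cpow_nat_inv_pow x (n := 2) (by norm_num)
    simpa only [one_div, Nat.cast_ofNat] using this
  have ha' : (a : ℂ) ≠ 0 := by exact_mod_cast ha
  rw [wBranch, mul_pow, h, h]
  field_simp
  ring

/-- The coefficient of `dz` in the `ℂ³`-valued form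
`(-2 G, 1 + G ^ 2, i (1 - G ^ 2)) η` with `G = z` and `η = i dz / w`. -/
def Phi (a : ℝ) (z : ℂ) : Fin 3 → ℂ :=
  ![-2 * z * (Complex.I / wBranch a z),
    (1 + z ^ 2) * (Complex.I / wBranch a z),
    Complex.I * (1 - z ^ 2) * (Complex.I / wBranch a z)]

/-- The Schwarz D-type maximal surface on the (convex) closed sector: the real part of the
integral of `Phi a z dz` along the straight segment from `1` to `z`. -/
def fMax (a : ℝ) (z : ℂ) : R31 :=
  WithLp.toLp 2 fun k =>
    (∫ t in (0 : ℝ)..1, Phi a (1 + (t : ℂ) * (z - 1)) k * (z - 1)).re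

/-- `0 ≤ |z| < 1`, `0 ≤ arg z ≤ π / 4` (with `0` included, as `Complex.arg 0 = 0`). -/
def sector : Set ℂ := {z | ‖z‖ < 1 ∧ 0 ≤ z.arg ∧ z.arg ≤ π / 4}

def OmegaMax (a : ℝ) : Set R31 := fMax a '' sector

/-! ### The fold curve and the timelike piece -/

def xi (a t : ℝ) : ℝ := 2 / √(2 * Real.cos (4 * t) + a ^ 4 + (a⁻¹) ^ 4)

/-- The fold (singular) curve. -/
def gamma (a s : ℝ) : R31 :=
  !₂[∫ t in (0 : ℝ)..s, xi a t,
     ∫ t in (0 : ℝ)..s, xi a t * (-Real.cos t),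
     ∫ t in (0 : ℝ)..s, xi a t * (-Real.sin t)]

/-- The timelike minimal surface extending `fMax a` across the fold curve. -/
def fMin (a : ℝ) (p : ℝ × ℝ) : R31 :=
  (1 / 2 : ℝ) • (gamma a (p.1 + p.2) + gamma a (p.1 - p.2))

/-- `0 ≤ u ≤ π / 4`, `0 < v ≤ π / 2`. -/
def rectangle : Set (ℝ × ℝ) := Set.Icc 0 (π / 4) ×ˢ Set.Ioc 0 (π / 2)

def OmegaMin (a : ℝ) : Set R31 := fMin a '' rectangle

def foldCurve (a : ℝ) : Set R31 := gamma a '' Set.Icc 0 (π / 4)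

/-- The fundamental piece. -/
def Omega1 (a : ℝ) : Set R31 := OmegaMax a ∪ foldCurve a ∪ OmegaMin a

/-! ### The boundary, the triangle and the prism -/

def LAmax (a : ℝ) : Set R31 := fMax a '' {z | z ∈ sector ∧ z.arg = 0}
def LAmin (a : ℝ) : Set R31 := (fun v => fMin a (0, v)) '' Set.Ioc 0 (π / 2)
def LBmax (a : ℝ) : Set R31 := fMax a '' {z | z ∈ sector ∧ a ≤ ‖z‖ ∧ z.arg = π / 4}
def LBmin (a : ℝ) : Set R31 := (fun v => fMin a (π / 4, v)) '' Set.Ioc 0 (π / 2)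

/-- The planar curve `0 ≤ |z| ≤ a`, `arg z = π / 4`; it contains its end point `z = 0`. -/
def LCmax (a : ℝ) : Set R31 :=
  fMax a '' {z | z ∈ sector ∧ ‖z‖ ≤ a ∧ (z = 0 ∨ z.arg = π / 4)}
def LCmin (a : ℝ) : Set R31 := (fun u => fMin a (u, π / 2)) '' Set.Icc 0 (π / 4)

/-- The boundary of the fundamental piece. The end points `gamma a 0`, `gamma a (π / 4)` of the
fold curve join `LAmax` to `LAmin` and `LBmax` to `LBmin`. -/
def boundary (a : ℝ) : Set R31 :=
  (LAmax a ∪ {gamma a 0} ∪ LAmin a) ∪ (LBmax a ∪ {gamma a (π / 4)} ∪ LBmin a) ∪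
    LCmax a ∪ LCmin a

/-- The triangle with its interior: the convex hull of the projection of the boundary. -/
def Delta (a : ℝ) : Set Plane := convexHull ℝ (proj '' boundary a)

/-- The length of the (straight, vertical) segment `LCmin a`. -/
def lengthLCmin (a : ℝ) : ℝ := Metric.diam (LCmin a)

/-- The vertical prism over the triangle, based on the plane `x 0 = 0`, of height
`lengthLCmin a`. -/
def prism (a : ℝ) : Set R31 := {x | proj x ∈ Delta a ∧ 0 ≤ x 0 ∧ x 0 ≤ lengthLCmin a}

/-- `T` is an isosceles right triangle (without its interior), nondegenerate. -/
def IsIsoscelesRightTriangle (T : Set Plane) : Prop :=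
  ∃ A B C : Plane, A ≠ B ∧ dist B A = dist B C ∧ EuclideanGeometry.angle A B C = π / 2 ∧
    T = segment ℝ A B ∪ segment ℝ B C ∪ segment ℝ C A

/-! ### Embeddedness -/

/-- `S` is an embedded smooth surface with (piecewise smooth) boundary in space: around each of
its points there are smooth coordinates `φ` of the ambient space in which `S` is the quadrant
`y 0 ≥ 0`, `y 1 ≥ 0` of the plane `y 2 = 0`. The point itself may go to the interior, to an edge
or to the corner of the quadrant. -/
def IsEmbeddedSurface (S : Set R31) : Prop :=
  ∀ p ∈ S, ∃ φ : OpenPartialHomeomorph R31 R31, p ∈ φ.source ∧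
    ContDiffOn ℝ ∞ φ φ.source ∧ ContDiffOn ℝ ∞ φ.symm φ.target ∧
    ∀ x ∈ φ.source, x ∈ S ↔ 0 ≤ φ x 0 ∧ 0 ≤ φ x 1 ∧ φ x 2 = 0

/-- The branch point `z = a e ^ (iπ / 4)` of `w` on the boundary of the sector. -/
def branchPoint (a : ℝ) : ℂ := (a : ℂ) * Complex.exp ((π / 4 : ℝ) * Complex.I)

/-- `fMax a` is an immersion of the sector, regarded as a piece of the Riemann surface of `(z, w)`:
away from the branch point `z` is a local coordinate, and at the branch point `w` is one. -/
def IsImmersedMax (a : ℝ) : Prop :=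
  (∀ z ∈ sector, z ≠ branchPoint a → ∃ L : ℂ →L[ℝ] R31,
    Function.Injective L ∧ HasFDerivWithinAt (fMax a) L sector z) ∧
  ∃ L : ℂ →L[ℝ] R31, Function.Injective L ∧
    (fun z => fMax a z - fMax a (branchPoint a) - L (wBranch a z))
      =o[nhdsWithin (branchPoint a) sector] (fun z => wBranch a z)

/-- `fMin a` is an immersion on the rectangle. -/
def IsImmersedMin (a : ℝ) : Prop :=
  ∀ p ∈ rectangle, ∃ L : ℝ × ℝ →L[ℝ] R31,
    Function.Injective L ∧ HasFDerivAt (fMin a) L p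

/-- The fundamental piece, as a parametrized surface, is embedded: the parametrizations of its
three parts are injective, the parts do not meet each other, the two surface parts are immersed,
and their union with the fold curve is an embedded smooth surface with boundary in space (so also
across the fold curve). -/
structure IsEmbeddedPiece (a : ℝ) : Prop where
  injOn_max : Set.InjOn (fMax a) sector
  injOn_fold : Set.InjOn (gamma a) (Set.Icc 0 (π / 4))
  injOn_min : Set.InjOn (fMin a) rectangle
  disjoint_max_fold : Disjoint (OmegaMax a) (foldCurve a)
  disjoint_max_min : Disjoint (OmegaMax a) (OmegaMin a)
  disjoint_fold_min : Disjoint (foldCurve a) (OmegaMin a)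
  immersed_max : IsImmersedMax a
  immersed_min : IsImmersedMin a
  embedded : IsEmbeddedSurface (Omega1 a)

end SchwarzD

end

/-! Write `z = r e^{iθ}` and let `D = 2 z² / w` be the density. The derivatives of `fMax` in `θ` and
`log r` are combinations of `Re D` and `Im D` whose coefficients involve only `sin θ`, `cos θ` and
`(1/r ± r)/2` (`Phi_mul_self`). Inside the sector `D` lies in the open first quadrant
(`density_pos`). Hence the height `x₀` increases strictly in `θ` and in `r`, and the Jacobian of
`(x₀, x₂)` in `(θ, r)` is negative. At fixed height, `x₂` therefore falls strictly as `r` grows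
towards the fold `r = 1` (`polarMax_two_lt`).

On the timelike piece the height increases strictly in `u`, and the Jacobian of `(x₀, c x₁ + d x₂)`
in `(u, v)` factors as `ξ(u+v) ξ(u-v) sin v (c sin u - d cos u)` (`fMin_jacobian`). At fixed height,
`x₂` again falls strictly as `v` moves away from the fold (`fMin_two_lt`). So at each height the
fold point separates the two pieces by the value of `x₂`. This gives injectivity and disjointness
(`injOn_fMax`, `injOn_fMin`, `fMax_eq_fMin`).

On the bounding rays `D` is real or purely imaginary, and on the timelike side the symmetries of `ξ`
make the edges straight. The boundary therefore projects into the lines `x₁ = 0`, `x₁ + x₂ = d` and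
`x₂ - x₁ = c`, where `d = γ₂(π/2)` and `c` is the last coordinate of `fMax a 0`. Monotonicity of
these three linear forms, in polar coordinates or along level curves of the height, keeps the whole
piece inside the triangle (`proj_bounds`).

For smoothness, an immersed parametrization extended past the boundary of its domain is thickened to
ambient coordinates by the inverse function theorem (`exists_chart`). Compactness and injectivity
rule out other sheets nearby (`exists_open_of_preimage`). Two kinds of points need their own
parametrization. At the branch point, `√(z⁴ + a⁴)` is a regular parameter. At the fold, put `z =
e^{iτ}` and let `Γ` be the holomorphic continuation of `γ`. The even part `(Γ(u + ρ) + Γ(u - ρ))/2`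
is a smooth function of `u` and `s = ρ²`: real `ρ` gives the timelike piece, imaginary `ρ` the
maximal one (`exists_foldExtension`). -/

open scoped Real ContDiff

noncomputable section

namespace SchwarzD

/-! ### Parametric integrals and primitives -/

section Parametric

variable {E : Type} [NormedAddCommGroup E] [NormedSpace ℝ E] [ProperSpace E]

/-- On a closed ball times `[a, b]` the partial derivative is bounded by compactness, so a constant
dominates it. -/
theorem hasFDerivAt_intervalIntegral_of_contDiffOn
    {F : Type} [NormedAddCommGroup F] [NormedSpace ℝ F] {U : Set E} (hU : IsOpen U)
    {K : E × ℝ → F} (hK : ContDiffOn ℝ ∞ K (U ×ˢ Set.univ)) (a b : ℝ) {x : E} (hx : x ∈ U) :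
    HasFDerivAt (fun x => ∫ t in a..b, K (x, t))
      (∫ t in a..b, (fderiv ℝ K (x, t)).comp (ContinuousLinearMap.inl ℝ E ℝ)) x := by
  have hUo : IsOpen (U ×ˢ (Set.univ : Set ℝ)) := hU.prod isOpen_univ
  obtain ⟨ε, hε, hball⟩ := Metric.nhds_basis_closedBall.mem_iff.1 (hU.mem_nhds hx)
  have hK' : ContinuousOn (fun p => (fderiv ℝ K p).comp (ContinuousLinearMap.inl ℝ E ℝ))
      (U ×ˢ Set.univ) :=
    (hK.continuousOn_fderiv_of_isOpen hUo (by simp)).clm_comp continuousOn_const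
  have hcomp : IsCompact (Metric.closedBall x ε ×ˢ Set.uIcc a b) :=
    (isCompact_closedBall x ε).prod isCompact_uIcc
  obtain ⟨C, hC⟩ := hcomp.exists_bound_of_continuousOn
    (hK'.mono (Set.prod_mono hball (Set.subset_univ _)))
  have hslice : ∀ y ∈ U, ∀ {G : Type} [NormedAddCommGroup G] {k : E × ℝ → G},
      ContinuousOn k (U ×ˢ Set.univ) → Continuous fun t => k (y, t) := by
    intro y hy G _ k hk
    exact hk.comp_continuous (by fun_prop) fun t => ⟨hy, Set.mem_univ _⟩
  refine intervalIntegral.hasFDerivAt_integral_of_dominated_of_fderiv_le (𝕜 := ℝ)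
    (F := fun x t => K (x, t)) (bound := fun _ => C)
    (F' := fun x t => (fderiv ℝ K (x, t)).comp (ContinuousLinearMap.inl ℝ E ℝ))
    (Metric.ball_mem_nhds x hε) ?_ ?_ ?_ ?_ ?_ ?_
  · filter_upwards [hU.mem_nhds hx] with y hy
    exact (hslice y hy hK.continuousOn).aestronglyMeasurable
  · exact (hslice x hx hK.continuousOn).intervalIntegrable _ _
  · exact (hslice x hx hK').aestronglyMeasurable
  · refine Filter.Eventually.of_forall fun t ht y hy => ?_
    exact hC (y, t) ⟨Metric.ball_subset_closedBall hy, Set.uIoc_subset_uIcc ht⟩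
  · exact intervalIntegrable_const
  · refine Filter.Eventually.of_forall fun t _ y hy => ?_
    have h1 : HasFDerivAt K (fderiv ℝ K (y, t)) (y, t) :=
      ((hK.differentiableOn (by simp)).differentiableAt (hUo.mem_nhds
        ⟨hball (Metric.ball_subset_closedBall hy), Set.mem_univ _⟩)).hasFDerivAt
    exact h1.comp y (hasFDerivAt_prodMk_left y t)

/-- Induction on the order: the derivative of the integral is again an integral of a smooth kernel,
but with values in another space, hence the generalization over `F`. -/
theorem contDiffOn_intervalIntegral
    {F : Type} [NormedAddCommGroup F] [NormedSpace ℝ F] {U : Set E} (hU : IsOpen U)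
    {K : E × ℝ → F} (hK : ContDiffOn ℝ ∞ K (U ×ˢ Set.univ)) (a b : ℝ) :
    ContDiffOn ℝ ∞ (fun x => ∫ t in a..b, K (x, t)) U := by
  refine contDiffOn_infty.2 fun n => ?_
  induction n generalizing F with
  | zero =>
    refine contDiffOn_zero.2 fun x hx => ?_
    exact (hasFDerivAt_intervalIntegral_of_contDiffOn hU hK a b
      hx).continuousAt.continuousWithinAt
  | succ n ih =>
    have hUo : IsOpen (U ×ˢ (Set.univ : Set ℝ)) := hU.prod isOpen_univ
    have h1 := fun x (hx : x ∈ U) => hasFDerivAt_intervalIntegral_of_contDiffOn hU hK a b hx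
    rw [Nat.cast_succ, contDiffOn_succ_iff_fderiv_of_isOpen hU]
    refine ⟨fun x hx => (h1 x hx).differentiableAt.differentiableWithinAt, by simp, ?_⟩
    have h2 : ContDiffOn ℝ ∞ (fun p => (fderiv ℝ K p).comp (ContinuousLinearMap.inl ℝ E ℝ))
        (U ×ˢ Set.univ) :=
      (hK.fderiv_of_isOpen hUo (by simp)).clm_comp contDiffOn_const
    exact (ih h2).congr fun x hx => (h1 x hx).fderiv

end Parametric

/-- A thickening of the segment is convex and still lies in `U`, so `f` has a primitive there and
the segment integral is an increment of it. No convexity of `U` is needed. -/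
theorem hasDerivAt_segmentIntegral {f : ℂ → ℂ} {U : Set ℂ} (hU : IsOpen U)
    (hf : DifferentiableOn ℂ f U) {c z : ℂ} (hz : segment ℝ c z ⊆ U) :
    (∀ᶠ y in nhds z, segment ℝ c y ⊆ U) ∧
    HasDerivAt (fun z => ∫ t in (0 : ℝ)..1, f (c + (t : ℂ) * (z - c)) * (z - c)) (f z) z := by
  have hcpt : IsCompact (segment ℝ c z) := by
    rw [segment_eq_image_lineMap]
    exact isCompact_Icc.image (by fun_prop)
  obtain ⟨δ, hδ, hsub⟩ := hcpt.exists_thickening_subset_open hU hz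
  set V := Metric.thickening δ (segment ℝ c z)
  have hVo : IsOpen V := Metric.isOpen_thickening
  have hVc : Convex ℝ V := (convex_segment c z).thickening δ
  have hself : segment ℝ c z ⊆ V := Metric.self_subset_thickening hδ _
  have hcV : c ∈ V := hself (left_mem_segment ℝ c z)
  have hzV : z ∈ V := hself (right_mem_segment ℝ c z)
  obtain ⟨g, hg⟩ := hVc.exists_forall_hasDerivWithinAt (hf.mono hsub)
  refine ⟨by filter_upwards [hVo.mem_nhds hzV] with y hy using
    (hVc.segment_subset hcV hy).trans hsub, ?_⟩
  have hg' : ∀ y ∈ V, HasDerivAt g (f y) y := fun y hy => (hg y hy).hasDerivAt (hVo.mem_nhds hy)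
  have heq : ∀ y ∈ V, (∫ t in (0 : ℝ)..1, f (c + (t : ℂ) * (y - c)) * (y - c)) = g y - g c := by
    intro y hy
    have hmem : ∀ t ∈ Set.Icc (0 : ℝ) 1, c + (t : ℂ) * (y - c) ∈ V := by
      intro t ht
      have := hVc.add_smul_sub_mem hcV hy ht
      simpa using this
    have hderiv : ∀ t ∈ Set.uIcc (0 : ℝ) 1, HasDerivAt (fun t : ℝ => g (c + (t : ℂ) * (y - c)))
        (f (c + (t : ℂ) * (y - c)) * (y - c)) t := by
      intro t ht
      rw [Set.uIcc_of_le zero_le_one] at ht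
      have h1 : HasDerivAt (fun t : ℝ => c + (t : ℂ) * (y - c)) (y - c) t := by
        simpa using ((Complex.ofRealCLM.hasDerivAt (x := t)).mul_const (y - c)).const_add c
      exact (hg' _ (hmem t ht)).comp t h1
    have hcont : ContinuousOn (fun t : ℝ => f (c + (t : ℂ) * (y - c)) * (y - c))
        (Set.uIcc 0 1) := by
      rw [Set.uIcc_of_le zero_le_one]
      refine ContinuousOn.mul ((hf.continuousOn.mono hsub).comp (by fun_prop) hmem)
        continuousOn_const
    have := intervalIntegral.integral_eq_sub_of_hasDerivAt hderiv hcont.intervalIntegrable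
    simpa using this
  refine ((hg' z hzV).sub_const (g c)).congr_of_eventuallyEq ?_
  filter_upwards [hVo.mem_nhds hzV] with y hy using heq y hy

/-! ### Level curves -/

/-- Strict monotonicity in `x` makes the level set a graph over `t`. Continuity follows by comparing
`g` with `k` at points just to the left and right of `φ t`, without any derivative. -/
theorem exists_levelCurve {g : ℝ × ℝ → ℝ} {α β t₁ t₂ k : ℝ}
    (hg : ContinuousOn g (Set.Icc α β ×ˢ Set.Icc t₁ t₂)) (hαβ : α ≤ β)
    (hmono : ∀ t ∈ Set.Icc t₁ t₂, StrictMonoOn (fun x => g (x, t)) (Set.Icc α β))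
    (hlo : ∀ t ∈ Set.Icc t₁ t₂, g (α, t) ≤ k) (hhi : ∀ t ∈ Set.Icc t₁ t₂, k ≤ g (β, t)) :
    ∃ φ : ℝ → ℝ, ContinuousOn φ (Set.Icc t₁ t₂) ∧
      ∀ t ∈ Set.Icc t₁ t₂, φ t ∈ Set.Icc α β ∧ g (φ t, t) = k := by
  have hex : ∀ t ∈ Set.Icc t₁ t₂, ∃ x ∈ Set.Icc α β, g (x, t) = k := by
    intro t ht
    have hc : ContinuousOn (fun x => g (x, t)) (Set.Icc α β) :=
      hg.comp (by fun_prop) fun x hx => ⟨hx, ht⟩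
    exact intermediate_value_Icc hαβ hc ⟨hlo t ht, hhi t ht⟩
  choose! φ hφ using hex
  refine ⟨φ, fun t ht => ?_, hφ⟩
  have hslice : ∀ x ∈ Set.Icc α β, ContinuousWithinAt (fun s => g (x, s)) (Set.Icc t₁ t₂) t := by
    intro x hx
    exact (hg.comp (f := fun s => (x, s)) (by fun_prop) fun s hs => ⟨hx, hs⟩) t ht
  refine tendsto_order.2 ⟨fun b hb => ?_, fun b hb => ?_⟩
  · by_cases hbα : b < α
    · filter_upwards [self_mem_nhdsWithin] with s hs using hbα.trans_le (hφ s hs).1.1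
    · have hbI : b ∈ Set.Icc α β := ⟨not_lt.1 hbα, hb.le.trans (hφ t ht).1.2⟩
      have h1 : g (b, t) < k := (hφ t ht).2 ▸ hmono t ht hbI (hφ t ht).1 hb
      filter_upwards [self_mem_nhdsWithin, (hslice b hbI).eventually_lt_const h1] with s hs hlt
      rw [← (hφ s hs).2] at hlt
      exact ((hmono s hs).lt_iff_lt hbI (hφ s hs).1).1 hlt
  · by_cases hbβ : β < b
    · filter_upwards [self_mem_nhdsWithin] with s hs using (hφ s hs).1.2.trans_lt hbβ
    · have hbI : b ∈ Set.Icc α β := ⟨(hφ t ht).1.1.trans hb.le, not_lt.1 hbβ⟩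
      have h1 : k < g (b, t) := (hφ t ht).2 ▸ hmono t ht (hφ t ht).1 hbI hb
      filter_upwards [self_mem_nhdsWithin, (hslice b hbI).eventually_const_lt h1] with s hs hlt
      rw [← (hφ s hs).2] at hlt
      exact ((hmono s hs).lt_iff_lt (hφ s hs).1 hbI).1 hlt

/-- Implicit differentiation from differentiability at a single point. The expansion of `g` first
gives `φ s - φ t = O(s - t)`; fed back into the expansion, this gives the derivative. -/
theorem hasDerivAt_of_level {g : ℝ × ℝ → ℝ} {φ : ℝ → ℝ} {t k : ℝ} {L : ℝ × ℝ →L[ℝ] ℝ}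
    (hL : HasFDerivAt g L (φ t, t)) (hL0 : L (1, 0) ≠ 0) (hφ : ContinuousAt φ t)
    (hk : ∀ᶠ s in nhds t, g (φ s, s) = k) :
    HasDerivAt φ (-(L (0, 1)) / L (1, 0)) t := by
  have hkt : g (φ t, t) = k := hk.self_of_nhds
  have hten : Filter.Tendsto (fun s => (φ s, s)) (nhds t) (nhds (φ t, t)) :=
    hφ.prodMk continuousAt_id
  have h1 := hL.isLittleO.comp_tendsto hten
  have hLs : ∀ s, L ((φ s, s) - (φ t, t)) = L (1, 0) * (φ s - φ t) + L (0, 1) * (s - t) := by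
    intro s
    have : ((φ s, s) - (φ t, t) : ℝ × ℝ)
        = (φ s - φ t) • ((1, 0) : ℝ × ℝ) + (s - t) • ((0, 1) : ℝ × ℝ) := by
      ext <;> simp
    rw [this, map_add, map_smul, map_smul, smul_eq_mul, smul_eq_mul]
    ring
  have h2 : (fun s => L (1, 0) * (φ s - φ t) + L (0, 1) * (s - t))
      =o[nhds t] fun s => ((φ s, s) - (φ t, t) : ℝ × ℝ) := by
    refine (h1.neg_left).congr' ?_ (Filter.EventuallyEq.refl _ _)
    filter_upwards [hk] with s hs
    simp only [Function.comp, hs, hkt, hLs]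
    ring
  have hmax : (fun s => ((φ s, s) - (φ t, t) : ℝ × ℝ))
      =O[nhds t] fun s => |φ s - φ t| + |s - t| := by
    refine Asymptotics.IsBigO.of_bound 1 (Filter.Eventually.of_forall fun s => ?_)
    have hnn : 0 ≤ |φ s - φ t| + |s - t| := by positivity
    rw [Prod.norm_def, one_mul, Real.norm_of_nonneg hnn]
    simp only [Prod.fst_sub, Prod.snd_sub, Real.norm_eq_abs]
    exact max_le (by linarith [abs_nonneg (s - t)]) (by linarith [abs_nonneg (φ s - φ t)])
  have h3 := h2.trans_isBigO hmax
  have hc : 0 < |L (1, 0)| := abs_pos.2 hL0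
  have h4 : (fun s => φ s - φ t) =O[nhds t] fun s => s - t := by
    -- With the constant `|L (1, 0)| / 2`, the term in `|φ s - φ t|` on the right is absorbed by the
    -- left side.
    have hb := h3.def (half_pos hc)
    refine Asymptotics.IsBigO.of_bound ((|L (0, 1)| + |L (1, 0)| / 2) / (|L (1, 0)| / 2)) ?_
    filter_upwards [hb] with s hs
    have hnn : 0 ≤ |φ s - φ t| + |s - t| := by positivity
    rw [Real.norm_of_nonneg hnn, Real.norm_eq_abs] at hs
    rw [Real.norm_eq_abs, Real.norm_eq_abs, div_mul_eq_mul_div, le_div_iff₀ (half_pos hc)]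
    have h5 : |L (1, 0) * (φ s - φ t)| ≤
        |L (1, 0) * (φ s - φ t) + L (0, 1) * (s - t)| + |L (0, 1) * (s - t)| := by
      have := abs_sub (L (1, 0) * (φ s - φ t) + L (0, 1) * (s - t)) (L (0, 1) * (s - t))
      simpa using this
    rw [abs_mul, abs_mul (L (0, 1))] at h5
    nlinarith
  have h6 : (fun s => |φ s - φ t| + |s - t|) =O[nhds t] fun s => s - t :=
    (h4.norm_left).add (Asymptotics.isBigO_refl _ _).norm_left
  have h7 := (h3.trans_isBigO h6).const_mul_left (L (1, 0))⁻¹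
  rw [hasDerivAt_iff_isLittleO]
  refine h7.congr_left fun s => ?_
  simp only [smul_eq_mul]
  field_simp
  ring

/-- Strict monotonicity forces the curve through the two given points. Derivatives are asked only at
interior times, since the ends may lie on the edge of a parameter domain. -/
theorem exists_differentiable_levelCurve {g : ℝ × ℝ → ℝ} {α β t₁ t₂ k x₁ x₂ : ℝ} (ht : t₁ ≤ t₂)
    (hg : ContinuousOn g (Set.Icc α β ×ˢ Set.Icc t₁ t₂))
    (hmono : ∀ t ∈ Set.Icc t₁ t₂, StrictMonoOn (fun x => g (x, t)) (Set.Icc α β))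
    (hlo : ∀ t ∈ Set.Icc t₁ t₂, g (α, t) ≤ k) (hhi : ∀ t ∈ Set.Icc t₁ t₂, k ≤ g (β, t))
    (hx₁ : x₁ ∈ Set.Icc α β) (hx₂ : x₂ ∈ Set.Icc α β) (h₁ : g (x₁, t₁) = k)
    (h₂ : g (x₂, t₂) = k) :
    ∃ φ : ℝ → ℝ, ContinuousOn φ (Set.Icc t₁ t₂) ∧ φ t₁ = x₁ ∧ φ t₂ = x₂ ∧
      (∀ t ∈ Set.Icc t₁ t₂, φ t ∈ Set.Icc α β ∧ g (φ t, t) = k) ∧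
      ∀ t ∈ Set.Ioo t₁ t₂, ∀ L : ℝ × ℝ →L[ℝ] ℝ, HasFDerivAt g L (φ t, t) → 0 < L (1, 0) →
        HasDerivAt φ (-(L (0, 1)) / L (1, 0)) t := by
  obtain ⟨φ, hφc, hφ⟩ := exists_levelCurve hg (hx₁.1.trans hx₁.2) hmono hlo hhi
  have hl : t₁ ∈ Set.Icc t₁ t₂ := Set.left_mem_Icc.2 ht
  have hr : t₂ ∈ Set.Icc t₁ t₂ := Set.right_mem_Icc.2 ht
  refine ⟨φ, hφc, (hmono t₁ hl).injOn (hφ t₁ hl).1 hx₁ ((hφ t₁ hl).2.trans h₁.symm),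
    (hmono t₂ hr).injOn (hφ t₂ hr).1 hx₂ ((hφ t₂ hr).2.trans h₂.symm), hφ, ?_⟩
  intro t htt L hL hL0
  refine hasDerivAt_of_level hL hL0.ne' (hφc.continuousAt (Icc_mem_nhds htt.1 htt.2)) (k := k) ?_
  filter_upwards [Icc_mem_nhds htt.1 htt.2] with s hs using (hφ s hs).2

theorem hasDerivAt_comp_level {h : ℝ × ℝ → ℝ} {φ : ℝ → ℝ} {t d : ℝ} {L : ℝ × ℝ →L[ℝ] ℝ}
    (hL : HasFDerivAt h L (φ t, t)) (hφ : HasDerivAt φ d t) :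
    HasDerivAt (fun s => h (φ s, s)) (d * L (1, 0) + L (0, 1)) t := by
  have h1 : HasDerivAt (fun s => (φ s, s)) (d, 1) t := hφ.prodMk (hasDerivAt_id t)
  have h2 := HasFDerivAt.comp_hasDerivAt (f := fun s => (φ s, s)) t hL h1
  have h3 : ((d, 1) : ℝ × ℝ) = d • ((1, 0) : ℝ × ℝ) + ((0, 1) : ℝ × ℝ) := by ext <;> simp
  rw [h3, map_add, map_smul, smul_eq_mul] at h2
  exact h2

/-- If the Jacobian of `(g, h)` is negative along a level curve of `g`, then `h` decreases
strictly along it. -/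
theorem lt_of_level {g h : ℝ × ℝ → ℝ} {α β t₁ t₂ k x₁ x₂ : ℝ} (ht : t₁ < t₂)
    (hg : ContinuousOn g (Set.Icc α β ×ˢ Set.Icc t₁ t₂))
    (hh : ContinuousOn h (Set.Icc α β ×ˢ Set.Icc t₁ t₂))
    (hmono : ∀ t ∈ Set.Icc t₁ t₂, StrictMonoOn (fun x => g (x, t)) (Set.Icc α β))
    (hlo : ∀ t ∈ Set.Icc t₁ t₂, g (α, t) ≤ k) (hhi : ∀ t ∈ Set.Icc t₁ t₂, k ≤ g (β, t))
    (hx₁ : x₁ ∈ Set.Icc α β) (hx₂ : x₂ ∈ Set.Icc α β) (h₁ : g (x₁, t₁) = k)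
    (h₂ : g (x₂, t₂) = k)
    (hd : ∀ t ∈ Set.Ioo t₁ t₂, ∀ x ∈ Set.Icc α β, g (x, t) = k → ∃ L M : ℝ × ℝ →L[ℝ] ℝ,
      HasFDerivAt g L (x, t) ∧ HasFDerivAt h M (x, t) ∧ 0 < L (1, 0) ∧
        L (1, 0) * M (0, 1) - L (0, 1) * M (1, 0) < 0) :
    h (x₂, t₂) < h (x₁, t₁) := by
  obtain ⟨φ, hφc, hφ₁, hφ₂, hφ, hφd⟩ :=
    exists_differentiable_levelCurve ht.le hg hmono hlo hhi hx₁ hx₂ h₁ h₂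
  have hanti : StrictAntiOn (fun s => h (φ s, s)) (Set.Icc t₁ t₂) := by
    refine strictAntiOn_of_deriv_neg (convex_Icc _ _)
      (hh.comp (hφc.prodMk continuousOn_id) fun s hs => ⟨(hφ s hs).1, hs⟩) fun t htt => ?_
    rw [interior_Icc] at htt
    have htc := Set.Ioo_subset_Icc_self htt
    obtain ⟨L, M, hL, hM, hL0, hdet⟩ := hd t htt (φ t) (hφ t htc).1 (hφ t htc).2
    rw [(hasDerivAt_comp_level hM (hφd t htt L hL hL0)).deriv]
    have : -(L (0, 1)) / L (1, 0) * M (1, 0) + M (0, 1) =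
        (L (1, 0) * M (0, 1) - L (0, 1) * M (1, 0)) / L (1, 0) := by
      field_simp
      ring
    rw [this]
    exact div_neg_of_neg_of_pos hdet hL0
  have := hanti (Set.left_mem_Icc.2 ht.le) (Set.right_mem_Icc.2 ht.le) ht
  simpa only [hφ₁, hφ₂] using this

/-- The strict version applies to `h - ε t` for every `ε > 0`. If `h` increased, taking `ε` to be
its mean slope would give a contradiction. -/
theorem le_of_level {g h : ℝ × ℝ → ℝ} {α β t₁ t₂ k x₁ x₂ : ℝ} (ht : t₁ < t₂)
    (hg : ContinuousOn g (Set.Icc α β ×ˢ Set.Icc t₁ t₂))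
    (hh : ContinuousOn h (Set.Icc α β ×ˢ Set.Icc t₁ t₂))
    (hmono : ∀ t ∈ Set.Icc t₁ t₂, StrictMonoOn (fun x => g (x, t)) (Set.Icc α β))
    (hlo : ∀ t ∈ Set.Icc t₁ t₂, g (α, t) ≤ k) (hhi : ∀ t ∈ Set.Icc t₁ t₂, k ≤ g (β, t))
    (hx₁ : x₁ ∈ Set.Icc α β) (hx₂ : x₂ ∈ Set.Icc α β) (h₁ : g (x₁, t₁) = k)
    (h₂ : g (x₂, t₂) = k)
    (hd : ∀ t ∈ Set.Ioo t₁ t₂, ∀ x ∈ Set.Icc α β, g (x, t) = k → ∃ L M : ℝ × ℝ →L[ℝ] ℝ,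
      HasFDerivAt g L (x, t) ∧ HasFDerivAt h M (x, t) ∧ 0 < L (1, 0) ∧
        L (1, 0) * M (0, 1) - L (0, 1) * M (1, 0) ≤ 0) :
    h (x₂, t₂) ≤ h (x₁, t₁) := by
  have key : ∀ ε > 0, h (x₂, t₂) - ε * t₂ < h (x₁, t₁) - ε * t₁ := by
    intro ε hε
    refine lt_of_level (h := fun p => h p - ε * p.2) ht hg (hh.sub (by fun_prop)) hmono hlo hhi
      hx₁ hx₂ h₁ h₂ fun t htt x hx hk => ?_
    obtain ⟨L, M, hL, hM, hL0, hdet⟩ := hd t htt x hx hk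
    refine ⟨L, M - ε • ContinuousLinearMap.snd ℝ ℝ ℝ, hL,
      hM.sub (hasFDerivAt_snd.const_mul ε), hL0, ?_⟩
    simp
    nlinarith [mul_pos hL0 hε]
  by_contra! hlt
  have h3 : 0 < t₂ - t₁ := sub_pos.2 ht
  have := key ((h (x₂, t₂) - h (x₁, t₁)) / (t₂ - t₁)) (div_pos (sub_pos.2 hlt) h3)
  have h4 : (h (x₂, t₂) - h (x₁, t₁)) / (t₂ - t₁) * (t₂ - t₁) = h (x₂, t₂) - h (x₁, t₁) :=
    div_mul_cancel₀ _ h3.ne'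
  linarith

/-! ### Charts from parametrizations -/

/-- The map `(y₀, y₁, y₂) ↦ F (y₀, y₁) + y₂ n` extending a parametrization to space. -/
def thicken (F : ℝ × ℝ → R31) (n : R31) (y : R31) : R31 := F (y 0, y 1) + y 2 • n

/-- Projection of space to the first two coordinates. -/
def firstTwo : R31 →L[ℝ] ℝ × ℝ :=
  (EuclideanSpace.proj (0 : Fin 3)).prod (EuclideanSpace.proj (1 : Fin 3))

theorem hasFDerivAt_thicken {F : ℝ × ℝ → R31} {L : ℝ × ℝ →L[ℝ] R31} (n : R31) {y : R31}
    (hF : HasFDerivAt F L (y 0, y 1)) :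
    HasFDerivAt (thicken F n)
      (L.comp firstTwo + (EuclideanSpace.proj (2 : Fin 3) : R31 →L[ℝ] ℝ).smulRight n) y := by
  have h1 : HasFDerivAt (fun y : R31 => F (firstTwo y)) (L.comp firstTwo) y :=
    HasFDerivAt.comp (g := F) y hF firstTwo.hasFDerivAt
  exact h1.add (((EuclideanSpace.proj (2 : Fin 3) : R31 →L[ℝ] ℝ).smulRight n).hasFDerivAt)

/-- The range of `L` has dimension at most two, so some `n` lies outside it. Adding this direction
keeps the map injective. -/
theorem exists_transversal (L : ℝ × ℝ →L[ℝ] R31) (hL : Function.Injective L) :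
    ∃ n : R31, Function.Injective
      (L.comp firstTwo + (EuclideanSpace.proj (2 : Fin 3) : R31 →L[ℝ] ℝ).smulRight n) := by
  have hne : LinearMap.range (L : ℝ × ℝ →ₗ[ℝ] R31) ≠ ⊤ := by
    intro h
    have h1 := LinearMap.finrank_range_le (L : ℝ × ℝ →ₗ[ℝ] R31)
    rw [h, finrank_top] at h1
    simp at h1
  obtain ⟨n, hn⟩ : ∃ n, n ∉ LinearMap.range (L : ℝ × ℝ →ₗ[ℝ] R31) := by
    by_contra! h
    exact hne (eq_top_iff.2 fun x _ => h x)
  refine ⟨n, (injective_iff_map_eq_zero _).2 fun y hy => ?_⟩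
  have hy' : L (y 0, y 1) + y 2 • n = 0 := hy
  have h2 : y 2 = 0 := by
    by_contra h2
    refine hn ⟨-(y 2)⁻¹ • (y 0, y 1), ?_⟩
    have : L (y 0, y 1) = -(y 2 • n) := eq_neg_of_add_eq_zero_left hy'
    rw [ContinuousLinearMap.coe_coe, map_smul, this, neg_smul_neg, inv_smul_smul₀ h2]
  rw [h2, zero_smul, add_zero] at hy'
  have h3 := (injective_iff_map_eq_zero L).1 hL _ hy'
  rw [Prod.mk_eq_zero] at h3
  ext i
  fin_cases i
  · exact h3.1
  · exact h3.2
  · exact h2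

/-- A smooth immersion of a neighbourhood in the quadrant whose image is a neighbourhood in `S`
gives smooth coordinates of space adapted to `S`. -/
theorem exists_chart {S : Set R31} {F : ℝ × ℝ → R31} {U : Set (ℝ × ℝ)} (hU : IsOpen U)
    (hF : ContDiffOn ℝ ∞ F U) {q : ℝ × ℝ} (hq : q ∈ U) {L : ℝ × ℝ →L[ℝ] R31}
    (hL : HasFDerivAt F L q) (hinj : Function.Injective L)
    (hsub : ∀ y ∈ U, 0 ≤ y.1 → 0 ≤ y.2 → F y ∈ S)
    (hloc : ∀ V, IsOpen V → q ∈ V → ∃ N, IsOpen N ∧ F q ∈ N ∧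
      ∀ x ∈ N, x ∈ S → ∃ y ∈ V, 0 ≤ y.1 ∧ 0 ≤ y.2 ∧ F y = x) :
    ∃ φ : OpenPartialHomeomorph R31 R31, F q ∈ φ.source ∧
      ContDiffOn ℝ ∞ φ φ.source ∧ ContDiffOn ℝ ∞ φ.symm φ.target ∧
      ∀ x ∈ φ.source, x ∈ S ↔ 0 ≤ φ x 0 ∧ 0 ≤ φ x 1 ∧ φ x 2 = 0 := by
  obtain ⟨n, hn⟩ := exists_transversal L hinj
  set Ψ := thicken F n with hΨ
  set U' : Set R31 := firstTwo ⁻¹' U with hU'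
  have hU'o : IsOpen U' := hU.preimage firstTwo.continuous
  have hΨs : ContDiffOn ℝ ∞ Ψ U' := by
    refine ContDiffOn.add ?_ (ContDiff.contDiffOn ?_)
    · exact hF.comp firstTwo.contDiff.contDiffOn fun y hy => hy
    · exact ((EuclideanSpace.proj (2 : Fin 3) : R31 →L[ℝ] ℝ).smulRight n).contDiff
  set y₀ : R31 := !₂[q.1, q.2, 0] with hy₀
  have hy₀q : (y₀ 0, y₀ 1) = q := by simp [hy₀]
  have hy₀U : y₀ ∈ U' := by
    change (y₀ 0, y₀ 1) ∈ U
    rwa [hy₀q]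
  have hΨy₀ : Ψ y₀ = F q := by
    change F (y₀ 0, y₀ 1) + y₀ 2 • n = F q
    rw [hy₀q]
    simp [hy₀]
  set A := L.comp firstTwo + (EuclideanSpace.proj (2 : Fin 3) : R31 →L[ℝ] ℝ).smulRight n
    with hA
  have hAd : HasFDerivAt Ψ A y₀ := hasFDerivAt_thicken n (by rwa [hy₀q])
  set e : R31 ≃L[ℝ] R31 :=
    (LinearEquiv.ofInjectiveEndo (A : R31 →ₗ[ℝ] R31) hn).toContinuousLinearEquiv with he
  have heA : (e : R31 →L[ℝ] R31) = A := by ext y; rfl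
  have hcd : ContDiffAt ℝ ∞ Ψ y₀ := hΨs.contDiffAt (hU'o.mem_nhds hy₀U)
  have hed : HasFDerivAt Ψ (e : R31 →L[ℝ] R31) y₀ := heA ▸ hAd
  set h := hcd.toOpenPartialHomeomorph Ψ hed (by simp) with hh
  have hcoe : (h : R31 → R31) = Ψ := hcd.toOpenPartialHomeomorph_coe hed (by simp)
  have hys : y₀ ∈ h.source := hcd.mem_toOpenPartialHomeomorph_source hed (by simp)
  -- Restricting to points with invertible derivative makes the inverse smooth on its whole domain,
  -- and not only at the image of `y₀`.
  set W : Set R31 := U' ∩ {y | fderiv ℝ Ψ y ∈ Set.range ((↑) : (R31 ≃L[ℝ] R31) → _)} with hW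
  have hWo : IsOpen W :=
    (hΨs.continuousOn_fderiv_of_isOpen hU'o (by simp)).isOpen_inter_preimage hU'o
      ContinuousLinearEquiv.isOpen
  have hyW : y₀ ∈ W := ⟨hy₀U, e, by rw [hed.fderiv]⟩
  set h' := h.restrOpen W hWo with hh'
  have hs' : h'.source = h.source ∩ W := rfl
  have hcoe' : (h' : R31 → R31) = Ψ := hcoe
  have hy' : y₀ ∈ h'.source := ⟨hys, hyW⟩
  set V : Set (ℝ × ℝ) := (fun p : ℝ × ℝ => (!₂[p.1, p.2, 0] : R31)) ⁻¹' h'.source with hV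
  have hVo : IsOpen V := h'.open_source.preimage (by fun_prop)
  -- Inside `N` every point of `S` comes from a parameter in `V`, so no other sheet of `S` enters
  -- the chart.
  obtain ⟨N, hNo, hqN, hN⟩ := hloc V hVo hy'
  refine ⟨h'.symm.restrOpen N hNo, ⟨?_, hqN⟩, ?_, ?_, ?_⟩
  · rw [OpenPartialHomeomorph.symm_source, ← hΨy₀, ← hcoe']
    exact h'.map_source hy'
  · rintro x ⟨hx, -⟩
    have hx' : x ∈ h'.target := hx
    have hmem := h'.map_target hx'
    obtain ⟨ex, hex⟩ := hmem.2.2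
    refine (h'.contDiffAt_symm (f₀' := ex) hx' ?_ ?_).contDiffWithinAt
    · rw [hcoe', hex]
      exact ((hΨs.differentiableOn (by simp)).differentiableAt
        (hU'o.mem_nhds hmem.2.1)).hasFDerivAt
    · rw [hcoe']
      exact hΨs.contDiffAt (hU'o.mem_nhds hmem.2.1)
  · have : ContDiffOn ℝ ∞ h' h'.source := by
      rw [hcoe']
      exact hΨs.mono fun y hy => hy.2.1
    exact this.mono fun y hy => (h'.symm.restrOpen N hNo).map_target hy |>.1 |> fun hm => by
      have := hy.1
      exact this
  · rintro x ⟨hx, hxN⟩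
    have hx' : x ∈ h'.target := hx
    have hmem := h'.map_target hx'
    have hright : Ψ (h'.symm x) = x := by
      rw [← hcoe']
      exact h'.right_inv hx'
    change x ∈ S ↔ 0 ≤ h'.symm x 0 ∧ 0 ≤ h'.symm x 1 ∧ h'.symm x 2 = 0
    constructor
    · intro hxS
      obtain ⟨y, hyV, h0, h1, rfl⟩ := hN x hxN hxS
      have hyΨ : Ψ !₂[y.1, y.2, 0] = F y := by
        change F _ + _ • n = F y
        simp
      have : h'.symm (F y) = !₂[y.1, y.2, 0] := by
        rw [← hyΨ, ← hcoe']
        exact h'.left_inv hyV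
      rw [this]
      exact ⟨h0, h1, rfl⟩
    · rintro ⟨h0, h1, h2⟩
      have hF' : F (h'.symm x 0, h'.symm x 1) = x := by
        conv_rhs => rw [← hright]
        change _ = F _ + _ • n
        rw [h2, zero_smul, add_zero]
      rw [← hF']
      exact hsub _ hmem.2.1 h0 h1

/-! ### The closed sector -/

/-- The closed sector `|z| ≤ 1`, `0 ≤ arg z ≤ π / 4`. -/
def closedSector : Set ℂ := {z | ‖z‖ ≤ 1 ∧ 0 ≤ z.im ∧ z.im ≤ z.re}

/-- Polar coordinates. -/
def polar (r θ : ℝ) : ℂ := (r : ℂ) * Complex.exp ((θ : ℂ) * Complex.I)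

theorem polar_re (r θ : ℝ) : (polar r θ).re = r * Real.cos θ := by
  simp [polar, Complex.exp_ofReal_mul_I_re]

theorem polar_im (r θ : ℝ) : (polar r θ).im = r * Real.sin θ := by
  simp [polar, Complex.exp_ofReal_mul_I_im]

theorem norm_polar {r : ℝ} (hr : 0 ≤ r) (θ : ℝ) : ‖polar r θ‖ = r := by
  simp [polar, Complex.norm_exp_ofReal_mul_I, abs_of_nonneg hr]

theorem polar_norm_arg (z : ℂ) : polar ‖z‖ z.arg = z := Complex.norm_mul_exp_arg_mul_I z

theorem arg_polar {r θ : ℝ} (hr : 0 < r) (h0 : 0 ≤ θ) (h1 : θ ≤ π / 4) : (polar r θ).arg = θ := by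
  rw [polar, Complex.arg_real_mul _ hr, Complex.arg_exp_mul_I,
    toIocMod_eq_self Real.two_pi_pos]
  constructor <;> linarith [Real.pi_pos]

theorem branchPoint_eq (a : ℝ) : branchPoint a = polar a (π / 4) := rfl

theorem sin_le_cos_of_le_pi_div_four {θ : ℝ} (h0 : 0 ≤ θ) (h1 : θ ≤ π / 4) :
    Real.sin θ ≤ Real.cos θ := by
  have hpi := Real.pi_pos
  calc Real.sin θ ≤ Real.sin (π / 4) :=
        Real.sin_le_sin_of_le_of_le_pi_div_two (by linarith) (by linarith) h1
    _ = Real.cos (π / 4) := by rw [Real.sin_pi_div_four, Real.cos_pi_div_four]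
    _ ≤ Real.cos θ := Real.cos_le_cos_of_nonneg_of_le_pi h0 (by linarith) h1

theorem sin_lt_cos_of_lt_pi_div_four {θ : ℝ} (h0 : 0 ≤ θ) (h1 : θ < π / 4) :
    Real.sin θ < Real.cos θ := by
  have hpi := Real.pi_pos
  calc Real.sin θ < Real.sin (π / 4) :=
        Real.sin_lt_sin_of_lt_of_le_pi_div_two (by linarith) (by linarith) h1
    _ = Real.cos (π / 4) := by rw [Real.sin_pi_div_four, Real.cos_pi_div_four]
    _ ≤ Real.cos θ := Real.cos_le_cos_of_nonneg_of_le_pi h0 (by linarith) h1.le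

theorem polar_mem_closedSector {r θ : ℝ} (hr0 : 0 ≤ r) (hr1 : r ≤ 1) (h0 : 0 ≤ θ)
    (h1 : θ ≤ π / 4) : polar r θ ∈ closedSector := by
  refine ⟨by rwa [norm_polar hr0], ?_, ?_⟩
  · rw [polar_im]
    exact mul_nonneg hr0 (Real.sin_nonneg_of_nonneg_of_le_pi h0 (by linarith [Real.pi_pos]))
  · rw [polar_im, polar_re]
    exact mul_le_mul_of_nonneg_left (sin_le_cos_of_le_pi_div_four h0 h1) hr0

theorem arg_le_pi_div_four_iff {z : ℂ} (h : 0 ≤ z.im) (hre : z = 0 ∨ z ≠ 0) :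
    z.arg ≤ π / 4 ↔ z.im ≤ z.re := by
  rcases hre with rfl | hz
  · simpa using (div_pos Real.pi_pos four_pos).le
  have h0 : 0 ≤ z.arg := Complex.arg_nonneg_iff.2 h
  have hpos : 0 < ‖z‖ := norm_pos_iff.2 hz
  have hre : z.re = ‖z‖ * Real.cos z.arg := by
    conv_lhs => rw [← polar_norm_arg z, polar_re]
  have him : z.im = ‖z‖ * Real.sin z.arg := by
    conv_lhs => rw [← polar_norm_arg z, polar_im]
  constructor
  · intro h1
    rw [hre, him]
    exact mul_le_mul_of_nonneg_left (sin_le_cos_of_le_pi_div_four h0 h1) hpos.le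
  · intro hle
    by_contra! hlt
    rw [hre, him, mul_le_mul_iff_right₀ hpos] at hle
    have hs : 0 < Real.sin (z.arg - π / 4) :=
      Real.sin_pos_of_pos_of_lt_pi (by linarith) (by linarith [z.arg_le_pi, Real.pi_pos])
    rw [Real.sin_sub, Real.sin_pi_div_four, Real.cos_pi_div_four] at hs
    have : (0 : ℝ) < √2 := by positivity
    nlinarith

theorem mem_sector_iff {z : ℂ} : z ∈ sector ↔ ‖z‖ < 1 ∧ 0 ≤ z.im ∧ z.im ≤ z.re := by
  rw [sector, Set.mem_ofPred_eq, Complex.arg_nonneg_iff]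
  refine and_congr_right fun _ => and_congr_right fun h => arg_le_pi_div_four_iff h (em _)

theorem sector_subset_closedSector : sector ⊆ closedSector := fun z hz => by
  have := mem_sector_iff.1 hz
  exact ⟨this.1.le, this.2⟩

theorem mem_sector_of_mem_closedSector {z : ℂ} (hz : z ∈ closedSector) (h1 : ‖z‖ < 1) :
    z ∈ sector := mem_sector_iff.2 ⟨h1, hz.2⟩

theorem exists_polar {z : ℂ} (hz : z ∈ closedSector) :
    ∃ r θ : ℝ, 0 ≤ r ∧ r ≤ 1 ∧ 0 ≤ θ ∧ θ ≤ π / 4 ∧ z = polar r θ :=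
  ⟨‖z‖, z.arg, norm_nonneg z, hz.1, Complex.arg_nonneg_iff.2 hz.2.1,
    (arg_le_pi_div_four_iff hz.2.1 (em _)).2 hz.2.2, (polar_norm_arg z).symm⟩

theorem convex_closedSector : Convex ℝ closedSector := by
  have h1 : Convex ℝ {z : ℂ | ‖z‖ ≤ 1} := by
    simpa [Metric.closedBall, dist_eq_norm] using convex_closedBall (0 : ℂ) 1
  have h2 : Convex ℝ {z : ℂ | 0 ≤ z.im} := convex_halfSpace_im_ge 0
  have h3 : Convex ℝ {z : ℂ | z.im ≤ z.re} := by
    have := convex_halfSpace_le (𝕜 := ℝ) (f := fun z : ℂ => z.im - z.re)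
      ⟨fun x y => by simp; ring, fun c x => by simp; ring⟩ 0
    simpa using this
  exact h1.inter (h2.inter h3)

theorem isCompact_closedSector : IsCompact closedSector := by
  refine Metric.isCompact_of_isClosed_isBounded ?_ ?_
  · exact (isClosed_le continuous_norm continuous_const).inter
      ((isClosed_le continuous_const Complex.continuous_im).inter
        (isClosed_le Complex.continuous_im Complex.continuous_re))
  · exact (Metric.isBounded_closedBall (x := (0 : ℂ)) (r := 1)).subset fun z hz => by
      simpa using hz.1

theorem one_mem_closedSector : (1 : ℂ) ∈ closedSector := by simp [closedSector]

theorem pow_four_re (z : ℂ) : (z ^ 4).re = (z.re ^ 2 - z.im ^ 2) ^ 2 - 4 * z.re ^ 2 * z.im ^ 2 := by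
  have : z ^ 4 = (z * z) * (z * z) := by ring
  rw [this]
  simp only [Complex.mul_re, Complex.mul_im]
  ring

theorem pow_four_im (z : ℂ) : (z ^ 4).im = 4 * z.re * z.im * (z.re ^ 2 - z.im ^ 2) := by
  have : z ^ 4 = (z * z) * (z * z) := by ring
  rw [this]
  simp only [Complex.mul_re, Complex.mul_im]
  ring

theorem pow_four_im_nonneg {z : ℂ} (h0 : 0 ≤ z.im) (h1 : z.im ≤ z.re) : 0 ≤ (z ^ 4).im := by
  rw [pow_four_im]
  have h2 : 0 ≤ z.re := h0.trans h1
  have : 0 ≤ z.re ^ 2 - z.im ^ 2 := by nlinarith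
  positivity

theorem pow_four_im_pos {z : ℂ} (h0 : 0 < z.im) (h1 : z.im < z.re) : 0 < (z ^ 4).im := by
  rw [pow_four_im]
  have h2 : 0 < z.re := h0.trans h1
  have : 0 < z.re ^ 2 - z.im ^ 2 := by nlinarith
  positivity

/-! ### The branch point and the holomorphic data on the closed sector -/

section Branch

variable {a : ℝ}

theorem branchPoint_re (a : ℝ) : (branchPoint a).re = a * (√2 / 2) := by
  rw [branchPoint_eq, polar_re, Real.cos_pi_div_four]

theorem branchPoint_im (a : ℝ) : (branchPoint a).im = a * (√2 / 2) := by
  rw [branchPoint_eq, polar_im, Real.sin_pi_div_four]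

theorem norm_branchPoint (ha : 0 < a) : ‖branchPoint a‖ = a := norm_polar ha.le _

theorem branchPoint_mem_closedSector (ha : 0 < a) (ha1 : a < 1) :
    branchPoint a ∈ closedSector :=
  polar_mem_closedSector ha.le ha1.le (by positivity) le_rfl

theorem branchPoint_pow_four (a : ℝ) : branchPoint a ^ 4 = -(a : ℂ) ^ 4 := by
  rw [branchPoint, mul_pow, ← Complex.exp_nat_mul]
  have : ((4 : ℕ) : ℂ) * (((π / 4 : ℝ) : ℂ) * Complex.I) = π * Complex.I := by
    push_cast
    ring
  rw [this, Complex.exp_pi_mul_I]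
  ring

/-- Neither coordinate of `z` can vanish, since `z⁴ = -a⁴ < 0`. Then `Im z⁴ = 0` forces `Re z = Im
z`, and the modulus is determined. -/
theorem eq_branchPoint (ha : 0 < a) {z : ℂ} (h0 : 0 ≤ z.im) (h1 : z.im ≤ z.re)
    (hz : z ^ 4 + (a : ℂ) ^ 4 = 0) : z = branchPoint a := by
  have hre := congrArg Complex.re hz
  have him := congrArg Complex.im hz
  rw [Complex.add_re, pow_four_re, ← Complex.ofReal_pow, Complex.ofReal_re, Complex.zero_re] at hre
  rw [Complex.add_im, pow_four_im, ← Complex.ofReal_pow, Complex.ofReal_im, Complex.zero_im,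
    add_zero] at him
  have ha4 : 0 < a ^ 4 := by positivity
  have hx : z.re ≠ 0 := by
    intro h
    have : z.im = 0 := by linarith
    rw [h, this] at hre
    norm_num at hre
    exact ha.ne' hre
  have hy : z.im ≠ 0 := by
    intro h
    rw [h] at hre
    have : (z.re ^ 2 - 0 ^ 2) ^ 2 - 4 * z.re ^ 2 * 0 ^ 2 = (z.re ^ 2) ^ 2 := by ring
    rw [this] at hre
    nlinarith [sq_nonneg (z.re ^ 2)]
  have hxy : z.re ^ 2 - z.im ^ 2 = 0 := by
    rcases mul_eq_zero.1 him with h | h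
    · exact absurd h (by simp [hx, hy])
    · exact h
  have hx0 : 0 ≤ z.re := h0.trans h1
  have hxy' : z.re = z.im := by nlinarith [sq_nonneg (z.re - z.im)]
  have h4 : a ^ 4 = (√2 * z.re) ^ 4 := by
    have h2 : (√2 : ℝ) ^ 4 = 4 := by
      have : (√2 : ℝ) ^ 2 = 2 := Real.sq_sqrt (by norm_num)
      calc (√2 : ℝ) ^ 4 = ((√2 : ℝ) ^ 2) ^ 2 := by ring
        _ = 4 := by rw [this]; norm_num
    rw [mul_pow, h2]
    rw [← hxy'] at hre
    nlinarith
  have ha' : a = √2 * z.re := by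
    exact (pow_left_inj₀ ha.le (by positivity) (by norm_num)).1 h4
  have h2 : (√2 : ℝ) * √2 = 2 := Real.mul_self_sqrt (by norm_num)
  have hre' : z.re = a * (√2 / 2) := by rw [ha']; linear_combination (-z.re / 2) * h2
  apply Complex.ext
  · rw [branchPoint_re, hre']
  · rw [branchPoint_im, ← hxy', hre']

/-! ### An analytic continuation of the branch of `w` -/

/-- A branch of `w` which is analytic near every point of the closed sector other than the branch
point. -/
def wExt (a : ℝ) (z : ℂ) : ℂ :=
  Complex.exp (((π / 4 : ℝ) : ℂ) * Complex.I) * (-Complex.I * (z ^ 4 + (a : ℂ) ^ 4)) ^ (1 / 2 : ℂ) *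
    (z ^ 4 + ((a : ℂ)⁻¹) ^ 4) ^ (1 / 2 : ℂ)

/-- Multiplication by `-i` turns the closed upper half plane into the right half plane. The cut of
the root thus moves to the negative imaginary axis, and the rotated root is analytic across the
negative reals, where `z⁴ + a⁴` lies on the diagonal beyond the branch point. -/
theorem cpow_half_eq_rotate {ζ : ℂ} (h : 0 ≤ ζ.im) :
    ζ ^ (1 / 2 : ℂ) =
      Complex.exp (((π / 4 : ℝ) : ℂ) * Complex.I) * (-Complex.I * ζ) ^ (1 / 2 : ℂ) := by
  rcases eq_or_ne ζ 0 with rfl | hζ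
  · simp
  have hne : -Complex.I * ζ ≠ 0 := by simp [hζ]
  have hmul : Complex.I * (-Complex.I * ζ) = ζ := by
    rw [← mul_assoc, mul_neg, Complex.I_mul_I]
    ring
  have harg : |(-Complex.I * ζ).arg| ≤ π / 2 := by
    rw [Complex.abs_arg_le_pi_div_two_iff]
    simpa using h
  have hlog : Complex.log (Complex.I * (-Complex.I * ζ))
      = Complex.log Complex.I + Complex.log (-Complex.I * ζ) := by
    refine Complex.log_mul (by simp) hne ?_
    rw [Complex.arg_I]
    rw [abs_le] at harg
    constructor <;> linarith [Real.pi_pos, harg.1, harg.2]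
  rw [Complex.cpow_def_of_ne_zero hζ, Complex.cpow_def_of_ne_zero hne, ← Complex.exp_add]
  conv_lhs => rw [← hmul, hlog, Complex.log_I]
  congr 1
  push_cast
  ring

theorem wExt_eq {z : ℂ} (hz : 0 ≤ (z ^ 4).im) : wExt a z = wBranch a z := by
  rw [wExt, wBranch, ← cpow_half_eq_rotate]
  rw [Complex.add_im, ← Complex.ofReal_pow, Complex.ofReal_im, add_zero]
  exact hz

/-- The domain of analyticity of `wExt`. -/
def domExt (a : ℝ) : Set ℂ :=
  {z | -Complex.I * (z ^ 4 + (a : ℂ) ^ 4) ∈ Complex.slitPlane ∧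
    z ^ 4 + ((a : ℂ)⁻¹) ^ 4 ∈ Complex.slitPlane}

theorem isOpen_domExt (a : ℝ) : IsOpen (domExt a) :=
  (Complex.isOpen_slitPlane.preimage (by fun_prop)).inter
    (Complex.isOpen_slitPlane.preimage (by fun_prop))

theorem differentiableOn_wExt (a : ℝ) : DifferentiableOn ℂ (wExt a) (domExt a) := by
  refine DifferentiableOn.mul (DifferentiableOn.mul (differentiableOn_const _) ?_) ?_
  · exact DifferentiableOn.cpow (by fun_prop) (by fun_prop) fun z hz => hz.1
  · exact DifferentiableOn.cpow (by fun_prop) (by fun_prop) fun z hz => hz.2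

theorem wExt_ne_zero {z : ℂ} (hz : z ∈ domExt a) : wExt a z ≠ 0 := by
  have h1 := Complex.slitPlane_ne_zero hz.1
  have h2 := Complex.slitPlane_ne_zero hz.2
  refine mul_ne_zero (mul_ne_zero (Complex.exp_ne_zero _) ?_) ?_
  · rw [Complex.cpow_ne_zero_iff_of_exponent_ne_zero (by norm_num)]
    exact h1
  · rw [Complex.cpow_ne_zero_iff_of_exponent_ne_zero (by norm_num)]
    exact h2

theorem norm_pow_four_le {z : ℂ} (hz : ‖z‖ ≤ 1) : -1 ≤ (z ^ 4).re := by
  have h1 : ‖z ^ 4‖ ≤ 1 := by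
    rw [norm_pow]
    exact pow_le_one₀ (norm_nonneg z) hz
  linarith [(abs_le.1 (Complex.abs_re_le_norm (z ^ 4))).1]

theorem one_lt_inv_pow_four (ha : 0 < a) (ha1 : a < 1) : 1 < a⁻¹ ^ 4 :=
  one_lt_pow₀ ((one_lt_inv₀ ha).2 ha1) (by norm_num)

theorem add_inv_pow_four_re_pos (ha : 0 < a) (ha1 : a < 1) {z : ℂ} (hz : ‖z‖ ≤ 1) :
    0 < (z ^ 4 + ((a : ℂ)⁻¹) ^ 4).re := by
  rw [Complex.add_re, ← Complex.ofReal_inv, ← Complex.ofReal_pow, Complex.ofReal_re]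
  linarith [norm_pow_four_le hz, one_lt_inv_pow_four ha ha1]

theorem mem_domExt (ha : 0 < a) (ha1 : a < 1) {z : ℂ} (hz : z ∈ closedSector)
    (hne : z ≠ branchPoint a) : z ∈ domExt a := by
  refine ⟨?_, Or.inl (add_inv_pow_four_re_pos ha ha1 hz.1)⟩
  have him := pow_four_im_nonneg hz.2.1 hz.2.2
  have h1 : z ^ 4 + (a : ℂ) ^ 4 ≠ 0 := fun h => hne (eq_branchPoint ha hz.2.1 hz.2.2 h)
  have h2 : (z ^ 4 + (a : ℂ) ^ 4).im = (z ^ 4).im := by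
    rw [Complex.add_im, ← Complex.ofReal_pow, Complex.ofReal_im, add_zero]
  rw [Complex.mem_slitPlane_iff]
  rcases him.lt_or_eq with h | h
  · left
    simpa [h2] using h
  · right
    intro h3
    apply h1
    apply Complex.ext
    · have h4 : -(z ^ 4 + (a : ℂ) ^ 4).re = 0 := by simpa using h3
      rw [neg_eq_zero] at h4
      exact h4
    · rw [h2, ← h]
      rfl

/-- The points that are joined to `1` by a segment in `domExt a`. -/
def starExt (a : ℝ) : Set ℂ := {z | segment ℝ 1 z ⊆ domExt a}

theorem isOpen_starExt (a : ℝ) : IsOpen (starExt a) :=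
  isOpen_iff_mem_nhds.2 fun _ hz =>
    (hasDerivAt_segmentIntegral (isOpen_domExt a) (differentiableOn_wExt a) hz).1

theorem starExt_subset_domExt (a : ℝ) : starExt a ⊆ domExt a := fun z hz =>
  hz (right_mem_segment ℝ 1 z)

/-- `Re - Im` is positive at `1`, nonnegative at `z` and zero at the branch point, so the segment
could meet the branch point only at its end `z`. -/
theorem segment_ne_branchPoint {z : ℂ} (hz : z ∈ closedSector) (hne : z ≠ branchPoint a)
    {p : ℂ} (hp : p ∈ segment ℝ 1 z) : p ≠ branchPoint a := by
  obtain ⟨s, t, hs, ht, hst, rfl⟩ := hp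
  intro h
  have h1 : ((s • (1 : ℂ) + t • z).re) - (s • (1 : ℂ) + t • z).im = 0 := by
    rw [h, branchPoint_re, branchPoint_im, sub_self]
  simp at h1
  have h2 : 0 ≤ t * (z.re - z.im) := mul_nonneg ht (sub_nonneg.2 hz.2.2)
  have hs0 : s = 0 := by nlinarith
  have ht1 : t = 1 := by linarith
  apply hne
  rw [← h, hs0, ht1]
  simp

theorem mem_starExt (ha : 0 < a) (ha1 : a < 1) {z : ℂ} (hz : z ∈ closedSector)
    (hne : z ≠ branchPoint a) : z ∈ starExt a := fun _ hp =>
  mem_domExt ha ha1 (convex_closedSector.segment_subset one_mem_closedSector hz hp)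
    (segment_ne_branchPoint hz hne hp)

/-! ### The holomorphic immersion -/

/-- The vector `(-2 z, 1 + z ^ 2, i (1 - z ^ 2))` of the Weierstrass representation. -/
def weierstrassVec (z : ℂ) : Fin 3 → ℂ :=
  ![-2 * z, 1 + z ^ 2, Complex.I * (1 - z ^ 2)]

theorem Phi_eq (a : ℝ) (z : ℂ) (k : Fin 3) :
    Phi a z k = weierstrassVec z k * (Complex.I / wBranch a z) := by
  fin_cases k <;> rfl

theorem differentiable_weierstrassVec (k : Fin 3) :
    Differentiable ℂ fun z => weierstrassVec z k := by
  fin_cases k <;> simp [weierstrassVec] <;> fun_prop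

/-- The coefficients of the Weierstrass data for the continued branch of `w`. -/
def PhiExt (a : ℝ) (k : Fin 3) (z : ℂ) : ℂ := weierstrassVec z k * (Complex.I / wExt a z)

theorem PhiExt_eq {z : ℂ} (hz : z ∈ closedSector) (k : Fin 3) : PhiExt a k z = Phi a z k := by
  rw [PhiExt, Phi_eq, wExt_eq (pow_four_im_nonneg hz.2.1 hz.2.2)]

theorem differentiableOn_PhiExt (a : ℝ) (k : Fin 3) :
    DifferentiableOn ℂ (PhiExt a k) (domExt a) :=
  (differentiable_weierstrassVec k).differentiableOn.mul
    ((differentiableOn_const _).div (differentiableOn_wExt a) fun _ hz => wExt_ne_zero hz)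

/-- The holomorphic curve whose real part is `fMax a`. -/
def holCurve (a : ℝ) (k : Fin 3) (z : ℂ) : ℂ :=
  ∫ t in (0 : ℝ)..1, PhiExt a k (1 + (t : ℂ) * (z - 1)) * (z - 1)

theorem hasDerivAt_holCurve {z : ℂ} (hz : z ∈ starExt a) (k : Fin 3) :
    HasDerivAt (holCurve a k) (PhiExt a k z) z :=
  (hasDerivAt_segmentIntegral (isOpen_domExt a) (differentiableOn_PhiExt a k) hz).2

theorem segment_mem_closedSector {z : ℂ} (hz : z ∈ closedSector) {t : ℝ}
    (ht : t ∈ Set.Icc (0 : ℝ) 1) : 1 + (t : ℂ) * (z - 1) ∈ closedSector := by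
  simpa using convex_closedSector.add_smul_sub_mem one_mem_closedSector hz ht

theorem fMax_apply {z : ℂ} (hz : z ∈ closedSector) (k : Fin 3) :
    fMax a z k = (holCurve a k z).re := by
  refine congrArg Complex.re (intervalIntegral.integral_congr fun t ht => ?_)
  rw [Set.uIcc_of_le zero_le_one] at ht
  simp only [PhiExt_eq (segment_mem_closedSector hz ht)]

end Branch

/-! ### The density `2 z ^ 2 / w` -/

section Density

variable {a : ℝ}

theorem cpow_half_sq (ζ : ℂ) : (ζ ^ (1 / 2 : ℂ)) ^ 2 = ζ := by
  have := Complex.cpow_nat_inv_pow ζ (n := 2) (by norm_num)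
  simpa only [one_div, Nat.cast_ofNat] using this

theorem cpow_half_re_nonneg (ζ : ℂ) : 0 ≤ (ζ ^ (1 / 2 : ℂ)).re := by
  rw [one_div, Complex.cpow_inv_two_re]
  exact Real.sqrt_nonneg _

theorem cpow_half_im_nonneg {ζ : ℂ} (h : 0 ≤ ζ.im) : 0 ≤ (ζ ^ (1 / 2 : ℂ)).im := by
  rw [one_div, Complex.cpow_inv_two_im_eq_sqrt h]
  exact Real.sqrt_nonneg _

theorem cpow_half_ofReal {x : ℝ} (hx : 0 ≤ x) : (x : ℂ) ^ (1 / 2 : ℂ) = (√x : ℝ) := by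
  rw [Real.sqrt_eq_rpow, Complex.ofReal_cpow hx]
  norm_num

theorem eq_cpow_half {p ζ : ℂ} (h : p ^ 2 = ζ) (hp : 0 < p.re) : p = ζ ^ (1 / 2 : ℂ) := by
  have h1 : p ^ 2 = (ζ ^ (1 / 2 : ℂ)) ^ 2 := by rw [h, cpow_half_sq]
  rcases sq_eq_sq_iff_eq_or_eq_neg.1 h1 with h2 | h2
  · exact h2
  · have := cpow_half_re_nonneg ζ
    rw [h2, Complex.neg_re] at hp
    linarith

/-- The density of `dw₀` with respect to `d (u + i v)`, where `z = exp (i (u + i v))`. -/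
def density (a : ℝ) (z : ℂ) : ℂ := 2 * z ^ 2 / wBranch a z

theorem wBranch_ne_zero (ha : 0 < a) (ha1 : a < 1) {z : ℂ} (hz : z ∈ closedSector)
    (hne : z ≠ branchPoint a) : wBranch a z ≠ 0 := by
  rw [← wExt_eq (pow_four_im_nonneg hz.2.1 hz.2.2)]
  exact wExt_ne_zero (mem_domExt ha ha1 hz hne)

/-- Up to a nonnegative factor, `D` is the conjugate of `W = w · conj (z²)`. The square of `W` is
explicit, and the quadrant of `D` is found from it. -/
theorem density_eq (a : ℝ) (z : ℂ) :
    density a z = ((2 / Complex.normSq (wBranch a z) : ℝ) : ℂ) *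
      (starRingEnd ℂ) (wBranch a z * (starRingEnd ℂ) (z ^ 2)) := by
  rcases eq_or_ne (wBranch a z) 0 with h | h
  · simp [density, h]
  have hn : (Complex.normSq (wBranch a z) : ℂ) ≠ 0 := by
    exact_mod_cast (Complex.normSq_pos.2 h).ne'
  rw [density, map_mul, Complex.conj_conj, div_eq_iff h]
  push_cast
  rw [div_mul_eq_mul_div, div_mul_eq_mul_div, eq_div_iff hn, ← Complex.mul_conj]
  ring

theorem sq_wBranch_mul_conj (ha : 0 < a) (z : ℂ) :
    ((wBranch a z * (starRingEnd ℂ) (z ^ 2)) ^ 2).im =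
      ((‖z‖ ^ 4) ^ 2 - 1) * (z ^ 4).im ∧
    ((wBranch a z * (starRingEnd ℂ) (z ^ 2)) ^ 2).re =
      ((‖z‖ ^ 4) ^ 2 + 1) * (z ^ 4).re + (a ^ 4 + a⁻¹ ^ 4) * (‖z‖ ^ 4) ^ 2 := by
  have hn : z ^ 4 * (starRingEnd ℂ) (z ^ 4) = (((‖z‖ ^ 4) ^ 2 : ℝ) : ℂ) := by
    rw [Complex.mul_conj, Complex.normSq_eq_norm_sq, norm_pow]
  have h : (wBranch a z * (starRingEnd ℂ) (z ^ 2)) ^ 2 =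
      (((‖z‖ ^ 4) ^ 2 : ℝ) : ℂ) * z ^ 4 + (((a ^ 4 + a⁻¹ ^ 4) * (‖z‖ ^ 4) ^ 2 : ℝ) : ℂ) +
        (starRingEnd ℂ) (z ^ 4) := by
    have h2 : ((starRingEnd ℂ) (z ^ 2)) ^ 2 = (starRingEnd ℂ) (z ^ 4) := by
      rw [← map_pow]
      ring_nf
    rw [mul_pow, wBranch_sq ha.ne', h2]
    rw [Complex.ofReal_mul (a ^ 4 + a⁻¹ ^ 4), ← hn]
    push_cast
    ring
  rw [h]
  constructor
  · rw [Complex.add_im, Complex.add_im, Complex.im_ofReal_mul, Complex.ofReal_im, Complex.conj_im]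
    ring
  · rw [Complex.add_re, Complex.add_re, Complex.re_ofReal_mul, Complex.ofReal_re, Complex.conj_re]
    ring

/-- Write the product as `P q` with `P = p · conj (z²)`. Both `p` and `z²` lie in the first
quadrant, so `Re P ≥ 0`. Moreover `P² = |z|⁸ + a⁴ conj (z⁴)` has nonpositive imaginary part, which
puts `P` in the fourth quadrant. As `q` lies in the first, `Re (P q) ≥ 0`. -/
theorem wBranch_mul_conj_re_nonneg (ha : 0 < a) (ha1 : a < 1) {z : ℂ} (hz : z ∈ closedSector) :
    0 ≤ (wBranch a z * (starRingEnd ℂ) (z ^ 2)).re := by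
  set p := (z ^ 4 + (a : ℂ) ^ 4) ^ (1 / 2 : ℂ) with hp
  set q := (z ^ 4 + ((a : ℂ)⁻¹) ^ 4) ^ (1 / 2 : ℂ) with hq
  have him := pow_four_im_nonneg hz.2.1 hz.2.2
  have hp2 : p ^ 2 = z ^ 4 + (a : ℂ) ^ 4 := cpow_half_sq _
  have h1 : (z ^ 4 + (a : ℂ) ^ 4).im = (z ^ 4).im := by
    rw [Complex.add_im, ← Complex.ofReal_pow, Complex.ofReal_im, add_zero]
  have h2 : (z ^ 4 + ((a : ℂ)⁻¹) ^ 4).im = (z ^ 4).im := by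
    rw [Complex.add_im, ← Complex.ofReal_inv, ← Complex.ofReal_pow, Complex.ofReal_im, add_zero]
  have hpr : 0 ≤ p.re := cpow_half_re_nonneg _
  have hqr : 0 ≤ q.re := cpow_half_re_nonneg _
  have hpi : 0 ≤ p.im := cpow_half_im_nonneg (by rwa [h1])
  have hqi : 0 ≤ q.im := cpow_half_im_nonneg (by rwa [h2])
  have hx0 : 0 ≤ z.re := hz.2.1.trans hz.2.2
  have hX : 0 ≤ z.re ^ 2 - z.im ^ 2 := by nlinarith [hz.2.1, hz.2.2]
  have hY : 0 ≤ 2 * z.re * z.im := by have := hz.2.1; positivity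
  have hcr : ((starRingEnd ℂ) (z ^ 2)).re = z.re ^ 2 - z.im ^ 2 := by
    rw [Complex.conj_re, sq, Complex.mul_re]; ring
  have hci : ((starRingEnd ℂ) (z ^ 2)).im = -(2 * z.re * z.im) := by
    rw [Complex.conj_im, sq, Complex.mul_im]; ring
  set P := p * (starRingEnd ℂ) (z ^ 2) with hP
  have hPr : P.re = p.re * (z.re ^ 2 - z.im ^ 2) + p.im * (2 * z.re * z.im) := by
    rw [hP, Complex.mul_re, hcr, hci]; ring
  have hPi : P.im = p.im * (z.re ^ 2 - z.im ^ 2) - p.re * (2 * z.re * z.im) := by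
    rw [hP, Complex.mul_im, hcr, hci]; ring
  have hPr0 : 0 ≤ P.re := by rw [hPr]; positivity
  -- the square of `P` lies in the closed lower half plane
  have hPsq : 2 * P.re * P.im = -(a ^ 4 * (z ^ 4).im) := by
    have h3 : P ^ 2 = (((‖z‖ ^ 4) ^ 2 : ℝ) : ℂ) + ((a ^ 4 : ℝ) : ℂ) * (starRingEnd ℂ) (z ^ 4) := by
      have hn : z ^ 4 * (starRingEnd ℂ) (z ^ 4) = (((‖z‖ ^ 4) ^ 2 : ℝ) : ℂ) := by
        rw [Complex.mul_conj, Complex.normSq_eq_norm_sq, norm_pow]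
      have h2 : ((starRingEnd ℂ) (z ^ 2)) ^ 2 = (starRingEnd ℂ) (z ^ 4) := by
        rw [← map_pow]
        ring_nf
      rw [hP, mul_pow, h2, hp2, add_mul, hn]
      push_cast
      rfl
    have h4 := congrArg Complex.im h3
    rw [sq, Complex.mul_im, Complex.add_im, Complex.im_ofReal_mul, Complex.ofReal_im,
      Complex.conj_im] at h4
    linarith
  have hPi0 : P.im ≤ 0 := by
    rcases hPr0.lt_or_eq with h | h
    · have : 0 ≤ a ^ 4 * (z ^ 4).im := by positivity
      by_contra! hc
      nlinarith [mul_pos h hc]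
    · rw [hPr] at h
      have h5 : p.re * (z.re ^ 2 - z.im ^ 2) = 0 := by
        have := mul_nonneg hpr hX
        have := mul_nonneg hpi hY
        linarith
      have h6 : p.im * (2 * z.re * z.im) = 0 := by linarith
      rw [hPi]
      rcases mul_eq_zero.1 h6 with h7 | h7
      · rw [h7]
        have := mul_nonneg hpr hY
        linarith
      · rcases mul_eq_zero.1 h5 with h8 | h8
        · -- `p` is imaginary and `z ^ 2` is real
          have h9 := congrArg Complex.re hp2
          rw [sq, Complex.mul_re, h8, Complex.add_re, pow_four_re, ← Complex.ofReal_pow,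
            Complex.ofReal_re] at h9
          have h10 : 4 * z.re ^ 2 * z.im ^ 2 = 0 := by
            have : 4 * z.re ^ 2 * z.im ^ 2 = (2 * z.re * z.im) ^ 2 := by ring
            rw [this, h7]
            norm_num
          nlinarith [sq_nonneg (z.re ^ 2 - z.im ^ 2), sq_nonneg p.im, pow_pos ha 4]
        · rw [h8, h7]
          simp
  have hw : wBranch a z * (starRingEnd ℂ) (z ^ 2) = P * q := by
    rw [wBranch, ← hp, ← hq, hP]
    ring
  rw [hw, Complex.mul_re]
  nlinarith [mul_nonneg hPr0 hqr, mul_nonneg (neg_nonneg.2 hPi0) hqi]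

theorem density_re_nonneg (ha : 0 < a) (ha1 : a < 1) {z : ℂ} (hz : z ∈ closedSector) :
    0 ≤ (density a z).re := by
  rw [density_eq, Complex.re_ofReal_mul, Complex.conj_re]
  exact mul_nonneg (div_nonneg two_pos.le (Complex.normSq_nonneg _))
    (wBranch_mul_conj_re_nonneg ha ha1 hz)

/-- `Re W ≥ 0` and `Im W² = (|z|⁸ - 1) Im z⁴ < 0` put `W` in the open fourth quadrant, hence `D` in
the open first one. The monotonicity statements on the maximal piece rest on this sign. -/
theorem density_pos (ha : 0 < a) (ha1 : a < 1) {z : ℂ} (hz : ‖z‖ < 1) (h0 : 0 < z.im)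
    (h1 : z.im < z.re) : 0 < (density a z).re ∧ 0 < (density a z).im := by
  have hmem : z ∈ closedSector := ⟨hz.le, h0.le, h1.le⟩
  have hne : z ≠ branchPoint a := by
    rintro rfl
    rw [branchPoint_re, branchPoint_im] at h1
    exact lt_irrefl _ h1
  have hn : 0 < 2 / Complex.normSq (wBranch a z) :=
    div_pos two_pos (Complex.normSq_pos.2 (wBranch_ne_zero ha ha1 hmem hne))
  have hre := wBranch_mul_conj_re_nonneg ha ha1 hmem
  have him := (sq_wBranch_mul_conj ha z).1
  set W := wBranch a z * (starRingEnd ℂ) (z ^ 2) with hW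
  have hneg : W.re * W.im < 0 := by
    have h2 : (W ^ 2).im = 2 * (W.re * W.im) := by rw [sq, Complex.mul_im]; ring
    have h3 : (‖z‖ ^ 4) ^ 2 - 1 < 0 := by
      have : ‖z‖ ^ 4 < 1 := pow_lt_one₀ (norm_nonneg z) hz (by norm_num)
      have h0 : 0 ≤ ‖z‖ ^ 4 := by positivity
      nlinarith
    have := mul_neg_of_neg_of_pos h3 (pow_four_im_pos h0 h1)
    linarith
  have hre' : 0 < W.re := by
    rcases hre.lt_or_eq with h | h
    · exact h
    · rw [← h] at hneg
      simp at hneg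
  have him' : W.im < 0 := by
    by_contra! hc
    linarith [mul_nonneg hre'.le hc]
  rw [density_eq, Complex.re_ofReal_mul, Complex.conj_re, Complex.im_ofReal_mul, Complex.conj_im,
    ← hW]
  exact ⟨mul_pos hn hre', mul_pos hn (by linarith)⟩

theorem polar_pow (r θ : ℝ) (n : ℕ) : polar r θ ^ n = polar (r ^ n) (n * θ) := by
  rw [polar, polar, mul_pow, ← Complex.exp_nat_mul]
  push_cast
  ring_nf

theorem polar_zero (r : ℝ) : polar r 0 = r := by simp [polar]

theorem polar_pow_four_re (θ : ℝ) : (polar 1 θ ^ 4).re = Real.cos (4 * θ) := by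
  rw [polar_pow, polar_re]
  norm_num

theorem xi_radicand_pos (ha : 0 < a) (ha1 : a < 1) (t : ℝ) :
    0 < 2 * Real.cos (4 * t) + a ^ 4 + a⁻¹ ^ 4 := by
  have h1 : a ^ 4 * a⁻¹ ^ 4 = 1 := by rw [← mul_pow, mul_inv_cancel₀ ha.ne', one_pow]
  have h2 := one_lt_inv_pow_four ha ha1
  have h3 : a ^ 4 < 1 := pow_lt_one₀ ha.le ha1 (by norm_num)
  nlinarith [Real.neg_one_le_cos (4 * t)]

theorem xi_pos (ha : 0 < a) (ha1 : a < 1) (t : ℝ) : 0 < xi a t :=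
  div_pos two_pos (Real.sqrt_pos.2 (xi_radicand_pos ha ha1 t))

/-- On the unit circle the density is the density of the fold curve. -/
theorem density_circle (ha : 0 < a) (ha1 : a < 1) {θ : ℝ} (h0 : 0 ≤ θ) (h1 : θ ≤ π / 4) :
    density a (polar 1 θ) = xi a θ := by
  set z := polar 1 θ with hz
  have hmem : z ∈ closedSector := polar_mem_closedSector zero_le_one le_rfl h0 h1
  have hn : ‖z‖ = 1 := norm_polar zero_le_one θ
  have hre := wBranch_mul_conj_re_nonneg ha ha1 hmem
  obtain ⟨him2, hre2⟩ := sq_wBranch_mul_conj ha z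
  set W := wBranch a z * (starRingEnd ℂ) (z ^ 2) with hW
  rw [hn, polar_pow_four_re] at hre2
  rw [hn] at him2
  set Q := 2 * Real.cos (4 * θ) + a ^ 4 + a⁻¹ ^ 4 with hQ
  have hQ0 : 0 < Q := xi_radicand_pos ha ha1 θ
  have hWQ : W ^ 2 = ((√Q : ℝ) : ℂ) ^ 2 := by
    rw [← Complex.ofReal_pow, Real.sq_sqrt hQ0.le]
    apply Complex.ext
    · rw [hre2, Complex.ofReal_re, hQ]
      ring
    · rw [him2, Complex.ofReal_im]
      ring
  have hWe : W = (√Q : ℝ) := by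
    rcases sq_eq_sq_iff_eq_or_eq_neg.1 hWQ with h | h
    · exact h
    · rw [h, Complex.neg_re, Complex.ofReal_re] at hre
      linarith [Real.sqrt_pos.2 hQ0]
  have hnw : Complex.normSq (wBranch a z) = Q := by
    have h2 : Complex.normSq W = Complex.normSq (wBranch a z) := by
      rw [hW, map_mul, Complex.normSq_conj, map_pow, Complex.normSq_eq_norm_sq z, hn]
      norm_num
    rw [← h2, hWe, Complex.normSq_ofReal, Real.mul_self_sqrt hQ0.le]
  rw [density_eq, ← hW, hnw, hWe, Complex.conj_ofReal, ← Complex.ofReal_mul, xi, ← hQ]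
  congr 1
  rw [div_mul_eq_mul_div, div_eq_div_iff hQ0.ne' (Real.sqrt_pos.2 hQ0).ne', mul_assoc,
    Real.mul_self_sqrt hQ0.le]

theorem wBranch_of_pow_four {z : ℂ} {t : ℝ} (hz : z ^ 4 = t) (h1 : 0 ≤ t + a ^ 4)
    (h2 : 0 ≤ t + a⁻¹ ^ 4) : wBranch a z = (√(t + a ^ 4) * √(t + a⁻¹ ^ 4) : ℝ) := by
  rw [wBranch, hz, Complex.ofReal_mul, ← cpow_half_ofReal h1, ← cpow_half_ofReal h2]
  push_cast
  rfl

theorem wBranch_of_pow_four_neg {z : ℂ} {t : ℝ} (hz : z ^ 4 = t) (h1 : t + a ^ 4 ≤ 0)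
    (h2 : 0 ≤ t + a⁻¹ ^ 4) :
    wBranch a z = (√(-(t + a ^ 4)) * √(t + a⁻¹ ^ 4) : ℝ) * Complex.I := by
  have h3 : ((t + a ^ 4 : ℝ) : ℂ) ^ (1 / 2 : ℂ) = (√(-(t + a ^ 4)) : ℝ) * Complex.I := by
    rw [Complex.ofReal_cpow_of_nonpos h1, ← Complex.ofReal_neg, cpow_half_ofReal (by linarith)]
    have h4 : (π : ℂ) * Complex.I * (1 / 2) = π / 2 * Complex.I := by ring
    rw [h4, Complex.exp_pi_div_two_mul_I]
  rw [wBranch, hz, Complex.ofReal_mul, ← cpow_half_ofReal h2]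
  have h4 : (t : ℂ) + (a : ℂ) ^ 4 = ((t + a ^ 4 : ℝ) : ℂ) := by push_cast; rfl
  rw [h4, h3]
  push_cast
  ring

/-- On the rays bounding the sector `z⁴` is real, so `D` is real or purely imaginary. Where it is
real the ray maps to a straight horizontal segment; where it is imaginary, to a curve in a vertical
plane. -/
theorem density_axis (ha : 0 < a) {r : ℝ} (hr : 0 < r) :
    ∃ A : ℝ, 0 < A ∧ density a (polar r 0) = A := by
  have hz : polar r 0 ^ 4 = ((r ^ 4 : ℝ) : ℂ) := by rw [polar_zero]; push_cast; rfl
  have h1 : 0 < r ^ 4 + a ^ 4 := by positivity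
  have h2 : 0 < r ^ 4 + a⁻¹ ^ 4 := by positivity
  refine ⟨2 * r ^ 2 / (√(r ^ 4 + a ^ 4) * √(r ^ 4 + a⁻¹ ^ 4)), by positivity, ?_⟩
  rw [density, wBranch_of_pow_four hz h1.le h2.le, polar_zero]
  push_cast
  rfl

theorem polar_diag_sq (r : ℝ) : polar r (π / 4) ^ 2 = ((r ^ 2 : ℝ) : ℂ) * Complex.I := by
  rw [polar_pow]
  apply Complex.ext
  · rw [polar_re]
    have : ((2 : ℕ) : ℝ) * (π / 4) = π / 2 := by push_cast; ring
    rw [this, Real.cos_pi_div_two, Complex.re_ofReal_mul, Complex.I_re]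
  · rw [polar_im]
    have : ((2 : ℕ) : ℝ) * (π / 4) = π / 2 := by push_cast; ring
    rw [this, Real.sin_pi_div_two, Complex.im_ofReal_mul, Complex.I_im]

theorem polar_diag_pow_four (r : ℝ) : polar r (π / 4) ^ 4 = ((-(r ^ 4) : ℝ) : ℂ) := by
  have : polar r (π / 4) ^ 4 = (polar r (π / 4) ^ 2) ^ 2 := by ring
  rw [this, polar_diag_sq, mul_pow, Complex.I_sq]
  push_cast
  ring

theorem density_diag_inner (ha : 0 < a) (ha1 : a < 1) {r : ℝ} (hr : 0 < r) (hra : r < a) :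
    ∃ B : ℝ, 0 < B ∧ density a (polar r (π / 4)) = B * Complex.I := by
  have h1 : 0 < -(r ^ 4) + a ^ 4 := by
    have := pow_lt_pow_left₀ hra hr.le (n := 4) (by norm_num)
    linarith
  have h2 : 0 < -(r ^ 4) + a⁻¹ ^ 4 := by
    have := one_lt_inv_pow_four ha ha1
    have := pow_lt_one₀ hr.le (hra.trans ha1) (n := 4) (by norm_num)
    linarith
  refine ⟨2 * r ^ 2 / (√(-(r ^ 4) + a ^ 4) * √(-(r ^ 4) + a⁻¹ ^ 4)), by positivity, ?_⟩
  rw [density, wBranch_of_pow_four (polar_diag_pow_four r) h1.le h2.le, polar_diag_sq]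
  push_cast
  ring

theorem density_diag_outer (ha : 0 < a) (ha1 : a < 1) {r : ℝ} (hra : a < r) (hr : r ≤ 1) :
    ∃ A : ℝ, 0 < A ∧ density a (polar r (π / 4)) = A := by
  have hr0 : 0 < r := ha.trans hra
  have h1 : -(r ^ 4) + a ^ 4 < 0 := by
    have := pow_lt_pow_left₀ hra ha.le (n := 4) (by norm_num)
    linarith
  have h2 : 0 < -(r ^ 4) + a⁻¹ ^ 4 := by
    have := one_lt_inv_pow_four ha ha1
    have := pow_le_one₀ hr0.le hr (n := 4)
    linarith
  have h3 : 0 < -(-(r ^ 4) + a ^ 4) := by linarith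
  refine ⟨2 * r ^ 2 / (√(-(-(r ^ 4) + a ^ 4)) * √(-(r ^ 4) + a⁻¹ ^ 4)), by positivity, ?_⟩
  rw [density, wBranch_of_pow_four_neg (polar_diag_pow_four r) h1.le h2.le, polar_diag_sq]
  push_cast
  rw [← mul_assoc, mul_div_mul_right _ _ Complex.I_ne_zero]

end Density

/-- Derivatives are taken within `s` because it need not be open: it will be a punctured quarter
disc or a disc cut by half planes. -/
theorem exists_eqOn_add_const {f g d : ℂ → ℂ} {s : Set ℂ} (hs : Convex ℝ s)
    (hf : ∀ x ∈ s, HasDerivWithinAt f (d x) s x) (hg : ∀ x ∈ s, HasDerivWithinAt g (d x) s x) :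
    ∃ C, ∀ x ∈ s, f x = g x + C := by
  rcases s.eq_empty_or_nonempty with rfl | ⟨y, hy⟩
  · exact ⟨0, by simp⟩
  refine ⟨f y - g y, fun x hx => ?_⟩
  have h := hs.norm_image_sub_le_of_norm_hasDerivWithin_le (f := fun x => f x - g x)
    (f' := fun _ => 0) (C := 0)
    (fun x hx => by simpa [Pi.sub_def] using (hf x hx).sub (hg x hx)) (by simp) hy hx
  rw [zero_mul, norm_le_zero_iff, sub_eq_zero] at h
  linear_combination h

/-! ### The local coordinate at the branch point -/

section BranchPoint

variable {a : ℝ}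

/-- The local coordinate `(z ^ 4 + a ^ 4) ^ (1 / 2)` at the branch point. -/
def rootCoord (a : ℝ) (z : ℂ) : ℂ := (z ^ 4 + (a : ℂ) ^ 4) ^ (1 / 2 : ℂ)

/-- The inverse of `rootCoord`. -/
def ofRootCoord (a : ℝ) (ϖ : ℂ) : ℂ := branchPoint a * (1 - ϖ ^ 2 / (a : ℂ) ^ 4) ^ (4⁻¹ : ℂ)

theorem rootCoord_sq (a : ℝ) (z : ℂ) : rootCoord a z ^ 2 = z ^ 4 + (a : ℂ) ^ 4 := cpow_half_sq _

theorem wBranch_eq_rootCoord (a : ℝ) (z : ℂ) :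
    wBranch a z = rootCoord a z * (z ^ 4 + ((a : ℂ)⁻¹) ^ 4) ^ (1 / 2 : ℂ) := rfl

theorem add_ofReal_pow_im (z : ℂ) (b : ℝ) : (z ^ 4 + (b : ℂ) ^ 4).im = (z ^ 4).im := by
  rw [Complex.add_im, ← Complex.ofReal_pow, Complex.ofReal_im, add_zero]

theorem rootCoord_re_nonneg (a : ℝ) (z : ℂ) : 0 ≤ (rootCoord a z).re := cpow_half_re_nonneg _

theorem rootCoord_im_nonneg {z : ℂ} (hz : z ∈ closedSector) : 0 ≤ (rootCoord a z).im :=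
  cpow_half_im_nonneg (by
    rw [add_ofReal_pow_im]
    exact pow_four_im_nonneg hz.2.1 hz.2.2)

theorem ofRootCoord_pow_four (ha : 0 < a) (ϖ : ℂ) :
    ofRootCoord a ϖ ^ 4 = ϖ ^ 2 - (a : ℂ) ^ 4 := by
  have h := Complex.cpow_nat_inv_pow (1 - ϖ ^ 2 / (a : ℂ) ^ 4) (n := 4) (by norm_num)
  have ha' : (a : ℂ) ≠ 0 := by exact_mod_cast ha.ne'
  rw [Nat.cast_ofNat] at h
  rw [ofRootCoord, mul_pow, h, branchPoint_pow_four]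
  field_simp
  ring

theorem ofRootCoord_zero (a : ℝ) : ofRootCoord a 0 = branchPoint a := by simp [ofRootCoord]

theorem eq_cpow_half_of_quadrant {p ζ : ℂ} (h : p ^ 2 = ζ) (h0 : 0 ≤ p.re) (h1 : 0 ≤ p.im) :
    ζ ^ (1 / 2 : ℂ) = p := by
  have him : 0 ≤ ζ.im := by
    rw [← h, sq, Complex.mul_im]
    positivity
  have h2 : (ζ ^ (1 / 2 : ℂ)) ^ 2 = p ^ 2 := by rw [h, cpow_half_sq]
  rcases sq_eq_sq_iff_eq_or_eq_neg.1 h2 with h3 | h3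
  · exact h3
  · have h4 := cpow_half_re_nonneg ζ
    have h5 := cpow_half_im_nonneg him
    rw [h3] at h4 h5 ⊢
    simp only [Complex.neg_re, Complex.neg_im] at h4 h5
    apply Complex.ext <;> simp <;> linarith

theorem rootCoord_ofRootCoord (ha : 0 < a) {ϖ : ℂ} (h0 : 0 ≤ ϖ.re) (h1 : 0 ≤ ϖ.im) :
    rootCoord a (ofRootCoord a ϖ) = ϖ := by
  refine eq_cpow_half_of_quadrant ?_ h0 h1
  rw [ofRootCoord_pow_four ha]
  ring

theorem branchPoint_mul_polar (a r θ : ℝ) :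
    branchPoint a * polar r θ = polar (a * r) (π / 4 + θ) := by
  rw [branchPoint_eq, polar, polar, polar]
  push_cast
  rw [add_mul, Complex.exp_add]
  ring

/-- The principal fourth root recovers `z / branchPoint a` when its argument `θ - π/4` lies in
`(-π/4, π/4]`. The condition `0 < Im z` excludes the value `-π/4`. -/
theorem ofRootCoord_rootCoord (ha : 0 < a) {z : ℂ} (hz : z ∈ closedSector) (him : 0 < z.im) :
    ofRootCoord a (rootCoord a z) = z := by
  obtain ⟨r, θ, hr0, -, h0, h1, rfl⟩ := exists_polar hz
  have hr : 0 < r := by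
    rcases hr0.lt_or_eq with h | h
    · exact h
    · rw [← h, polar_im] at him
      simp at him
  have hθ : 0 < θ := by
    rcases h0.lt_or_eq with h | h
    · exact h
    · rw [← h, polar_im] at him
      simp at him
  have ha' : (a : ℂ) ≠ 0 := by exact_mod_cast ha.ne'
  have hκ : branchPoint a * polar (r / a) (θ - π / 4) = polar r θ := by
    rw [branchPoint_mul_polar, mul_div_cancel₀ _ ha.ne']
    congr 1
    ring
  have h4 : 1 - rootCoord a (polar r θ) ^ 2 / (a : ℂ) ^ 4 = polar (r / a) (θ - π / 4) ^ 4 := by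
    rw [rootCoord_sq, ← hκ, mul_pow, branchPoint_pow_four]
    field_simp
    ring
  have harg : (polar (r / a) (θ - π / 4)).arg = θ - π / 4 := by
    rw [polar, Complex.arg_real_mul _ (div_pos hr ha), Complex.arg_exp_mul_I,
      toIocMod_eq_self Real.two_pi_pos]
    constructor <;> linarith [Real.pi_pos]
  have hpow := Complex.pow_cpow_nat_inv (x := polar (r / a) (θ - π / 4)) (n := 4) (by norm_num)
    (by rw [harg]; push_cast; linarith) (by rw [harg]; push_cast; linarith [Real.pi_pos])
  rw [Nat.cast_ofNat] at hpow
  rw [ofRootCoord, h4, hpow, hκ]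

/-- The coefficients of the Weierstrass data in the coordinate `rootCoord`. -/
def rootData (a : ℝ) (k : Fin 3) (ϖ : ℂ) : ℂ :=
  weierstrassVec (ofRootCoord a ϖ) k * (Complex.I / (2 * ofRootCoord a ϖ ^ 3 *
    (ofRootCoord a ϖ ^ 4 + ((a : ℂ)⁻¹) ^ 4) ^ (1 / 2 : ℂ)))

theorem eventually_rootCoord_good (ha : 0 < a) (ha1 : a < 1) :
    ∀ᶠ ϖ in nhds (0 : ℂ), 1 - ϖ ^ 2 / (a : ℂ) ^ 4 ∈ Complex.slitPlane ∧
      ϖ ^ 2 - (a : ℂ) ^ 4 + ((a : ℂ)⁻¹) ^ 4 ∈ Complex.slitPlane ∧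
      ‖ofRootCoord a ϖ‖ < 1 ∧ ofRootCoord a ϖ ≠ 0 ∧
      |((1 - ϖ ^ 2 / (a : ℂ) ^ 4) ^ (4⁻¹ : ℂ)).im| < ((1 - ϖ ^ 2 / (a : ℂ) ^ 4) ^ (4⁻¹ : ℂ)).re := by
  have hc1 : ContinuousAt (fun ϖ : ℂ => 1 - ϖ ^ 2 / (a : ℂ) ^ 4) 0 := by fun_prop
  have hm : (1 - (0 : ℂ) ^ 2 / (a : ℂ) ^ 4) ∈ Complex.slitPlane := by simp
  have hc2 : ContinuousAt (fun ϖ : ℂ => (1 - ϖ ^ 2 / (a : ℂ) ^ 4) ^ (4⁻¹ : ℂ)) 0 :=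
    hc1.cpow continuousAt_const hm
  have hc3 : ContinuousAt (ofRootCoord a) 0 := continuousAt_const.mul hc2
  have hc4 : ContinuousAt (fun ϖ : ℂ => ϖ ^ 2 - (a : ℂ) ^ 4 + ((a : ℂ)⁻¹) ^ 4) 0 := by fun_prop
  refine (hc1.eventually_mem (Complex.isOpen_slitPlane.mem_nhds hm)).and
    ((hc4.eventually_mem (Complex.isOpen_slitPlane.mem_nhds ?_)).and
    ((hc3.norm.eventually_lt_const ?_).and ((hc3.eventually_ne ?_).and
    ((Complex.continuous_im.continuousAt.comp hc2).abs.eventually_lt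
      (Complex.continuous_re.continuousAt.comp hc2) ?_))))
  · left
    have h1 : (0 : ℂ) ^ 2 - (a : ℂ) ^ 4 + ((a : ℂ)⁻¹) ^ 4 = ((a⁻¹ ^ 4 - a ^ 4 : ℝ) : ℂ) := by
      push_cast
      ring
    rw [h1, Complex.ofReal_re]
    linarith [one_lt_inv_pow_four ha ha1, pow_lt_one₀ ha.le ha1 (n := 4) (by norm_num)]
  · change ‖ofRootCoord a 0‖ < 1
    rwa [ofRootCoord_zero, norm_branchPoint ha]
  · rw [ofRootCoord_zero, ← norm_ne_zero_iff, norm_branchPoint ha]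
    exact ha.ne'
  · simp

/-- Differentiate `Z⁴ = ϖ² - a⁴`. The factor `ϖ` in the numerator cancels the one in `w`, so `dz /
w` stays finite and nonzero at the branch point. -/
theorem hasDerivAt_ofRootCoord (ha : 0 < a) {ϖ : ℂ}
    (h1 : 1 - ϖ ^ 2 / (a : ℂ) ^ 4 ∈ Complex.slitPlane) (h2 : ofRootCoord a ϖ ≠ 0) :
    HasDerivAt (ofRootCoord a) (ϖ / (2 * ofRootCoord a ϖ ^ 3)) ϖ := by
  have hd : DifferentiableAt ℂ (ofRootCoord a) ϖ := by
    refine (differentiableAt_const _).mul (DifferentiableAt.cpow (by fun_prop) (by fun_prop) h1)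
  have h3 := hd.hasDerivAt.pow 4
  have h4 : HasDerivAt (fun ϖ => ofRootCoord a ϖ ^ 4) (2 * ϖ) ϖ := by
    have h5 : (fun ϖ => ofRootCoord a ϖ ^ 4) = fun ϖ => ϖ ^ 2 - (a : ℂ) ^ 4 :=
      funext (ofRootCoord_pow_four ha)
    rw [h5]
    simpa using (hasDerivAt_pow 2 ϖ).sub_const ((a : ℂ) ^ 4)
  have h6 := h3.unique h4
  refine hd.hasDerivAt.congr_deriv ?_
  norm_num at h6
  rw [eq_div_iff (by simp [h2])]
  linear_combination (1 / 2 : ℂ) * h6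

/-- For `ϖ` in the first quadrant the fourth root `ρ` has argument in `(-π/4, 0]`: the hypothesis
`hρ` bounds it by `π/4` in size, and `Im ρ⁴ ≤ 0` gives the sign. Multiplication by `ρ` thus turns
the branch point clockwise, and by less than the opening of the sector. -/
theorem ofRootCoord_mem_sector (ha : 0 < a) {ϖ : ℂ} (h0 : 0 ≤ ϖ.re) (h1 : 0 ≤ ϖ.im)
    (hn : ‖ofRootCoord a ϖ‖ < 1)
    (hρ : |((1 - ϖ ^ 2 / (a : ℂ) ^ 4) ^ (4⁻¹ : ℂ)).im| <
      ((1 - ϖ ^ 2 / (a : ℂ) ^ 4) ^ (4⁻¹ : ℂ)).re) : ofRootCoord a ϖ ∈ sector := by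
  have h := Complex.cpow_nat_inv_pow (1 - ϖ ^ 2 / (a : ℂ) ^ 4) (n := 4) (by norm_num)
  rw [Nat.cast_ofNat] at h
  set ρ := (1 - ϖ ^ 2 / (a : ℂ) ^ 4) ^ (4⁻¹ : ℂ) with hρdef
  obtain ⟨hl, hu⟩ := abs_lt.1 hρ
  have hre : 0 < ρ.re := (abs_nonneg _).trans_lt hρ
  have him : ρ.im ≤ 0 := by
    have h2 := congrArg Complex.im h
    have h3 : (1 - ϖ ^ 2 / (a : ℂ) ^ 4).im = -(2 * ϖ.re * ϖ.im / a ^ 4) := by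
      rw [Complex.sub_im, Complex.one_im, ← Complex.ofReal_pow, Complex.div_ofReal_im, sq,
        Complex.mul_im]
      ring
    rw [pow_four_im, h3] at h2
    have h4 : 0 ≤ 2 * ϖ.re * ϖ.im / a ^ 4 := by positivity
    have h5 : 0 < ρ.re ^ 2 - ρ.im ^ 2 := by nlinarith
    by_contra! hc
    have : 0 < 4 * ρ.re * ρ.im * (ρ.re ^ 2 - ρ.im ^ 2) := by positivity
    linarith
  have hs : 0 < a * (√2 / 2) := by positivity
  rw [mem_sector_iff]
  refine ⟨hn, ?_, ?_⟩
  · rw [ofRootCoord, ← hρdef, Complex.mul_im, branchPoint_re, branchPoint_im]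
    nlinarith
  · rw [ofRootCoord, ← hρdef, Complex.mul_im, Complex.mul_re, branchPoint_re, branchPoint_im]
    nlinarith

theorem branchPoint_mem_ball_of_near (ha : 0 < a) {ε : ℝ} (hε : 0 < ε) :
    ∀ᶠ z in nhds (branchPoint a), rootCoord a z ∈ Metric.ball 0 ε ∧ 0 < z.im := by
  have h1 : ContinuousAt (fun z : ℂ => ‖z ^ 4 + (a : ℂ) ^ 4‖) (branchPoint a) := by fun_prop
  have h2 : ‖branchPoint a ^ 4 + (a : ℂ) ^ 4‖ < ε ^ 2 := by
    rw [branchPoint_pow_four, neg_add_cancel, norm_zero]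
    positivity
  have h3 : 0 < (branchPoint a).im := by rw [branchPoint_im]; positivity
  filter_upwards [h1.eventually_lt_const h2,
    Complex.continuous_im.continuousAt.eventually_const_lt h3] with z hz hz'
  refine ⟨?_, hz'⟩
  rw [mem_ball_zero_iff]
  rw [← rootCoord_sq, norm_pow] at hz
  exact lt_of_pow_lt_pow_left₀ 2 hε.le hz

theorem measurable_PhiExt (a : ℝ) (k : Fin 3) : Measurable (PhiExt a k) := by
  have hw : Measurable (wExt a) := by
    unfold wExt
    fun_prop
  exact (differentiable_weierstrassVec k).continuous.measurable.mul (measurable_const.div hw)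

theorem norm_weierstrassVec_le {z : ℂ} (hz : ‖z‖ ≤ 1) (k : Fin 3) : ‖weierstrassVec z k‖ ≤ 2 := by
  have h2 : ‖z ^ 2‖ ≤ 1 := by
    rw [norm_pow]
    exact pow_le_one₀ (norm_nonneg z) hz
  fin_cases k
  · simp [weierstrassVec]
    linarith
  · have := norm_add_le (1 : ℂ) (z ^ 2)
    simp only [norm_one] at this
    simp only [weierstrassVec]
    exact this.trans (by linarith)
  · have := norm_sub_le (1 : ℂ) (z ^ 2)
    simp only [norm_one] at this
    simp [weierstrassVec]
    linarith

/-- With `b` the branch point, `w² = (z - b)(z + b)(z² + b²)(z⁴ + a⁻⁴)`, and the last three factors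
are bounded away from zero on the sector. So `1 / w` is at worst an inverse square root of `|z -
b|`, which is integrable along the segment. -/
theorem norm_sq_wBranch_ge (ha : 0 < a) (ha1 : a < 1) {z : ℂ} (hz : z ∈ closedSector) :
    ‖z - branchPoint a‖ * (a * (√2 / 2) * a ^ 2 * (a⁻¹ ^ 4 - 1)) ≤ ‖wBranch a z‖ ^ 2 := by
  have hx : 0 ≤ z.re := hz.2.1.trans hz.2.2
  have hq : 0 < a⁻¹ ^ 4 - 1 := by linarith [one_lt_inv_pow_four ha ha1]
  have h1 : a * (√2 / 2) ≤ ‖z + branchPoint a‖ := by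
    refine le_trans ?_ ((le_abs_self _).trans (Complex.abs_re_le_norm _))
    rw [Complex.add_re, branchPoint_re]
    linarith
  have h2 : a ^ 2 ≤ ‖z ^ 2 + branchPoint a ^ 2‖ := by
    refine le_trans ?_ ((le_abs_self _).trans (Complex.abs_im_le_norm _))
    rw [branchPoint_eq, polar_diag_sq, Complex.add_im, Complex.im_ofReal_mul, Complex.I_im, sq z,
      Complex.mul_im]
    nlinarith [mul_nonneg hx hz.2.1]
  have h3 : a⁻¹ ^ 4 - 1 ≤ ‖z ^ 4 + ((a : ℂ)⁻¹) ^ 4‖ := by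
    refine le_trans ?_ ((le_abs_self _).trans (Complex.abs_re_le_norm _))
    rw [Complex.add_re, ← Complex.ofReal_inv, ← Complex.ofReal_pow, Complex.ofReal_re]
    linarith [norm_pow_four_le hz.1]
  have h4 : wBranch a z ^ 2 = (z - branchPoint a) * (z + branchPoint a) *
      (z ^ 2 + branchPoint a ^ 2) * (z ^ 4 + ((a : ℂ)⁻¹) ^ 4) := by
    rw [wBranch_eq_rootCoord, mul_pow, rootCoord_sq, cpow_half_sq]
    have := branchPoint_pow_four a
    linear_combination (z ^ 4 + ((a : ℂ)⁻¹) ^ 4) * this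
  rw [← norm_pow, h4, norm_mul, norm_mul, norm_mul]
  have h5 : 0 ≤ a * (√2 / 2) := by positivity
  calc ‖z - branchPoint a‖ * (a * (√2 / 2) * a ^ 2 * (a⁻¹ ^ 4 - 1))
      = ‖z - branchPoint a‖ * (a * (√2 / 2)) * a ^ 2 * (a⁻¹ ^ 4 - 1) := by ring
    _ ≤ _ := by gcongr

theorem intervalIntegrable_PhiExt_branchPoint (ha : 0 < a) (ha1 : a < 1) (k : Fin 3) :
    IntervalIntegrable (fun t : ℝ => PhiExt a k (1 + (t : ℂ) * (branchPoint a - 1)) *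
      (branchPoint a - 1)) MeasureTheory.volume 0 1 := by
  set b := branchPoint a with hb
  have hbmem : b ∈ closedSector := branchPoint_mem_closedSector ha ha1
  have hb1 : b ≠ 1 := by
    intro h
    have h1 := norm_branchPoint ha
    rw [← hb, h, norm_one] at h1
    linarith
  have hb1' : 0 < ‖1 - b‖ := norm_pos_iff.2 (sub_ne_zero.2 hb1.symm)
  have hq : 0 < a⁻¹ ^ 4 - 1 := by linarith [one_lt_inv_pow_four ha ha1]
  set c := ‖1 - b‖ * (a * (√2 / 2) * a ^ 2 * (a⁻¹ ^ 4 - 1)) with hc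
  have hc0 : 0 < c := by positivity
  have hg : IntervalIntegrable (fun t : ℝ => (2 * ‖b - 1‖ / √c) * (1 - t) ^ (-(1 / 2) : ℝ))
      MeasureTheory.volume 0 1 := by
    have h1 := (intervalIntegral.intervalIntegrable_rpow' (r := -(1 / 2)) (a := 1) (b := 0)
      (by norm_num)).comp_sub_left 1
    norm_num at h1
    exact h1.const_mul _
  refine hg.mono_fun' ?_ ?_
  · exact (((measurable_PhiExt a k).comp (by fun_prop)).mul_const _).aestronglyMeasurable
  · refine (MeasureTheory.ae_restrict_iff' measurableSet_uIoc).2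
      (Filter.Eventually.of_forall fun t ht => ?_)
    rw [Set.uIoc_of_le zero_le_one] at ht
    have htI : t ∈ Set.Icc (0 : ℝ) 1 := Set.Ioc_subset_Icc_self ht
    have hz := segment_mem_closedSector hbmem htI
    set z := 1 + (t : ℂ) * (b - 1) with hzdef
    have hP : PhiExt a k (1 + (t : ℂ) * (b - 1)) =
        weierstrassVec z k * (Complex.I / wBranch a z) := by rw [← hzdef, PhiExt_eq hz, Phi_eq]
    simp only [hP]
    have h1 : (1 - t) * c ≤ ‖wBranch a z‖ ^ 2 := by
      have h2 := norm_sq_wBranch_ge ha ha1 hz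
      have h3 : z - b = ((1 - t : ℝ) : ℂ) * (1 - b) := by
        rw [hzdef]
        push_cast
        ring
      rw [← hb, h3, norm_mul, Complex.norm_real, Real.norm_of_nonneg (by linarith [ht.2])] at h2
      rw [hc]
      linarith
    rcases ht.2.lt_or_eq with hlt | heq
    · have hpos : 0 < 1 - t := by linarith
      have h4 : √(1 - t) * √c ≤ ‖wBranch a z‖ := by
        rw [← Real.sqrt_mul hpos.le]
        exact Real.sqrt_le_iff.2 ⟨norm_nonneg _, h1⟩
      have hs : 0 < √(1 - t) * √c := by positivity
      rw [norm_mul, norm_mul, norm_div, Complex.norm_I, Real.rpow_neg hpos.le,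
        ← Real.sqrt_eq_rpow]
      calc ‖weierstrassVec z k‖ * (1 / ‖wBranch a z‖) * ‖b - 1‖
          ≤ 2 * (1 / (√(1 - t) * √c)) * ‖b - 1‖ := by
            gcongr
            exact norm_weierstrassVec_le hz.1 k
        _ = 2 * ‖b - 1‖ / √c * (√(1 - t))⁻¹ := by
            field_simp
    · have hzb : z = b := by
        rw [hzdef, heq]
        push_cast
        ring
      have hw : wBranch a b = 0 := by
        rw [wBranch_eq_rootCoord, rootCoord, hb, branchPoint_pow_four, neg_add_cancel]
        simp
      -- At `t = 1` the integrand is zero by the convention for division by zero.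
      rw [hzb, hw]
      simp only [div_zero, mul_zero, zero_mul, norm_zero]
      have : 0 ≤ (1 - t) ^ (-(1 / 2) : ℝ) := Real.rpow_nonneg (by linarith) _
      positivity

/-- Near the branch point `holCurve` is a holomorphic function of `rootCoord`. -/
theorem exists_rootPrimitive (ha : 0 < a) (ha1 : a < 1) (k : Fin 3) :
    ∃ ε > 0, ∃ H : ℂ → ℂ, (∀ ϖ ∈ Metric.ball (0 : ℂ) ε, HasDerivAt H (rootData a k ϖ) ϖ) ∧
      ∀ ϖ ∈ Metric.ball (0 : ℂ) ε, 0 ≤ ϖ.re → 0 ≤ ϖ.im →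
        ofRootCoord a ϖ ∈ sector ∧ holCurve a k (ofRootCoord a ϖ) = H ϖ := by
  obtain ⟨ε, hε, hgood⟩ := Metric.eventually_nhds_iff_ball.1 (eventually_rootCoord_good ha ha1)
  have hdiff : DifferentiableOn ℂ (rootData a k) (Metric.ball 0 ε) := by
    intro ϖ hϖ
    obtain ⟨h1, h2, -, h4, -⟩ := hgood ϖ hϖ
    have hZ : DifferentiableAt ℂ (ofRootCoord a) ϖ :=
      (hasDerivAt_ofRootCoord ha h1 h4).differentiableAt
    have h2' : ofRootCoord a ϖ ^ 4 + ((a : ℂ)⁻¹) ^ 4 ∈ Complex.slitPlane := by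
      rwa [ofRootCoord_pow_four ha]
    refine DifferentiableAt.differentiableWithinAt ?_
    refine ((differentiable_weierstrassVec k).differentiableAt.comp ϖ hZ).mul
      ((differentiableAt_const _).div ?_ ?_)
    · refine ((hZ.pow 3).const_mul 2).mul
        (((hZ.pow 4).add_const _).cpow (differentiableAt_const _) h2')
    · refine mul_ne_zero (mul_ne_zero two_ne_zero (pow_ne_zero _ h4)) ?_
      rw [Complex.cpow_ne_zero_iff_of_exponent_ne_zero (by norm_num)]
      exact Complex.slitPlane_ne_zero h2'
  obtain ⟨H, hH⟩ := hdiff.isExactOn_ball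
  -- The quarter disc stays convex without its corner, since `0` is an extreme point. On it
  -- `ofRootCoord` avoids the branch point, so `holCurve` can be differentiated.
  set Q : Set ℂ := {ϖ | ϖ ∈ Metric.ball (0 : ℂ) ε ∧ 0 ≤ ϖ.re ∧ 0 ≤ ϖ.im ∧ ϖ ≠ 0} with hQ
  have hQc : Convex ℝ Q := by
    intro x hx y hy s t hs ht hst
    have hre : (s • x + t • y).re = s * x.re + t * y.re := by simp
    have him : (s • x + t • y).im = s * x.im + t * y.im := by simp
    refine ⟨convex_ball (0 : ℂ) ε hx.1 hy.1 hs ht hst, ?_, ?_, ?_⟩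
    · rw [hre]
      have := hx.2.1
      have := hy.2.1
      positivity
    · rw [him]
      have := hx.2.2.1
      have := hy.2.2.1
      positivity
    · intro h0
      rw [h0, Complex.zero_re] at hre
      rw [h0, Complex.zero_im] at him
      have a1 := mul_nonneg hs hx.2.1
      have a2 := mul_nonneg ht hy.2.1
      have a3 := mul_nonneg hs hx.2.2.1
      have a4 := mul_nonneg ht hy.2.2.1
      have b1 : s * x.re = 0 := by linarith
      have b2 : s * x.im = 0 := by linarith
      have b3 : t * y.re = 0 := by linarith
      have b4 : t * y.im = 0 := by linarith
      rcases mul_eq_zero.1 b1 with hs0 | hxr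
      · have ht1 : t ≠ 0 := by rintro rfl; linarith
        exact hy.2.2.2 (Complex.ext ((mul_eq_zero.1 b3).resolve_left ht1)
          ((mul_eq_zero.1 b4).resolve_left ht1))
      · rcases mul_eq_zero.1 b2 with hs0 | hxi
        · have ht1 : t ≠ 0 := by rintro rfl; linarith
          exact hy.2.2.2 (Complex.ext ((mul_eq_zero.1 b3).resolve_left ht1)
            ((mul_eq_zero.1 b4).resolve_left ht1))
        · exact hx.2.2.2 (Complex.ext hxr hxi)
  have hsec : ∀ ϖ ∈ Metric.ball (0 : ℂ) ε, 0 ≤ ϖ.re → 0 ≤ ϖ.im → ofRootCoord a ϖ ∈ sector := by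
    intro ϖ hϖ h0 h1
    obtain ⟨-, -, hn, -, hρ⟩ := hgood ϖ hϖ
    exact ofRootCoord_mem_sector ha h0 h1 hn hρ
  have hne : ∀ ϖ ∈ Q, ofRootCoord a ϖ ≠ branchPoint a := by
    intro ϖ hϖ h
    apply hϖ.2.2.2
    have h2 := ofRootCoord_pow_four ha ϖ
    rw [h, branchPoint_pow_four] at h2
    have h3 : ϖ ^ 2 = 0 := by linear_combination -h2
    exact pow_eq_zero_iff (two_ne_zero) |>.1 h3
  have hQd : ∀ ϖ ∈ Q, HasDerivWithinAt (fun ϖ => holCurve a k (ofRootCoord a ϖ))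
      (rootData a k ϖ) Q ϖ := by
    intro ϖ hϖ
    obtain ⟨h1, h2, -, h4, -⟩ := hgood ϖ hϖ.1
    have hmem := sector_subset_closedSector (hsec ϖ hϖ.1 hϖ.2.1 hϖ.2.2.1)
    have hd := (hasDerivAt_holCurve (mem_starExt ha ha1 hmem (hne ϖ hϖ)) k).comp ϖ
      (hasDerivAt_ofRootCoord ha h1 h4)
    refine (hd.congr_deriv ?_).hasDerivWithinAt
    rw [PhiExt_eq hmem, Phi_eq, wBranch_eq_rootCoord, rootCoord_ofRootCoord ha hϖ.2.1 hϖ.2.2.1,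
      rootData]
    have := hϖ.2.2.2
    field_simp
  obtain ⟨C, hC⟩ := exists_eqOn_add_const hQc hQd fun ϖ hϖ => (hH ϖ hϖ.1).hasDerivWithinAt
  -- At the branch point `holCurve` is an improper integral. The fundamental theorem with one-sided
  -- limits, along the segment from `1`, identifies its value.
  have h0 : holCurve a k (branchPoint a) = H 0 + C := by
    set b := branchPoint a with hb
    have hbmem : b ∈ closedSector := branchPoint_mem_closedSector ha ha1
    set Z : ℝ → ℂ := fun t => 1 + (t : ℂ) * (b - 1) with hZ
    have hZc : Continuous Z := by fun_prop
    have hZd : ∀ t, HasDerivAt Z (b - 1) t := fun t => by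
      simpa [hZ] using ((Complex.ofRealCLM.hasDerivAt (x := t)).mul_const (b - 1)).const_add 1
    have hZ1 : Z 1 = b := by simp [hZ]
    have hZ0 : Z 0 = 1 := by simp [hZ]
    have hb1 : b ≠ 1 := by
      intro h
      have h1 := norm_branchPoint ha
      rw [← hb, h, norm_one] at h1
      linarith
    have hZne : ∀ t < 1, Z t ≠ b := by
      intro t ht h
      have h1 : ((1 - t : ℝ) : ℂ) * (1 - b) = 0 := by
        rw [hZ] at h
        push_cast
        linear_combination h
      rcases mul_eq_zero.1 h1 with h2 | h2
      · have : 1 - t = 0 := by exact_mod_cast h2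
        linarith
      · exact hb1 (sub_eq_zero.1 h2).symm
    have hstar : ∀ t ∈ Set.Ico (0 : ℝ) 1, Z t ∈ starExt a := fun t ht =>
      mem_starExt ha ha1 (segment_mem_closedSector hbmem (Set.Ico_subset_Icc_self ht))
        (hZne t ht.2)
    have hone : holCurve a k 1 = 0 := by simp [holCurve]
    have hlim0 : Filter.Tendsto (fun t => holCurve a k (Z t)) (nhdsWithin 0 (Set.Ioi 0))
        (nhds 0) := by
      have h1 := (hasDerivAt_holCurve (hstar 0 (by simp)) k).continuousAt.comp hZc.continuousAt
      have h2 := h1.tendsto.mono_left (nhdsWithin_le_nhds (s := Set.Ioi 0))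
      simpa only [Function.comp_def, hZ0, hone] using h2
    have hnear := (hZc.tendsto' 1 b hZ1).eventually (branchPoint_mem_ball_of_near ha hε)
    have hroot : Filter.Tendsto (fun t => rootCoord a (Z t)) (nhds 1) (nhds 0) := by
      rw [Metric.nhds_basis_ball.tendsto_right_iff]
      intro δ hδ
      filter_upwards [(hZc.tendsto' 1 b hZ1).eventually (branchPoint_mem_ball_of_near ha hδ)]
        with t ht using ht.1
    have hlim1 : Filter.Tendsto (fun t => holCurve a k (Z t)) (nhdsWithin 1 (Set.Iio 1))
        (nhds (H 0 + C)) := by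
      have h1 : Filter.Tendsto (fun t => H (rootCoord a (Z t)) + C) (nhdsWithin 1 (Set.Iio 1))
          (nhds (H 0 + C)) :=
        (((hH 0 (Metric.mem_ball_self hε)).continuousAt.tendsto.comp hroot).mono_left
          nhdsWithin_le_nhds).add_const C
      refine h1.congr' ?_
      filter_upwards [self_mem_nhdsWithin, nhdsWithin_le_nhds hnear,
        nhdsWithin_le_nhds (Ioi_mem_nhds zero_lt_one)] with t ht hball ht0
      have hmem := segment_mem_closedSector hbmem ⟨le_of_lt ht0, le_of_lt ht⟩
      have hinv : ofRootCoord a (rootCoord a (Z t)) = Z t :=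
        ofRootCoord_rootCoord ha hmem hball.2
      have hQmem : rootCoord a (Z t) ∈ Q := by
        refine ⟨hball.1, rootCoord_re_nonneg _ _, rootCoord_im_nonneg hmem, ?_⟩
        intro h
        rw [h, ofRootCoord_zero] at hinv
        exact hZne t ht hinv.symm
      rw [← hC _ hQmem, hinv]
    have hint := intervalIntegral.integral_eq_sub_of_hasDerivAt_of_tendsto zero_lt_one
      (f := fun t => holCurve a k (Z t)) (f' := fun t => PhiExt a k (Z t) * (b - 1))
      (fun t ht => (hasDerivAt_holCurve (hstar t ⟨ht.1.le, ht.2⟩) k).comp t (hZd t))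
      (intervalIntegrable_PhiExt_branchPoint ha ha1 k) hlim0 hlim1
    rw [sub_zero] at hint
    exact hint
  refine ⟨ε, hε, fun ϖ => H ϖ + C, fun ϖ hϖ => (hH ϖ hϖ).add_const C, fun ϖ hϖ h1 h2 =>
    ⟨hsec ϖ hϖ h1 h2, ?_⟩⟩
  rcases eq_or_ne ϖ 0 with rfl | hϖ0
  · rw [ofRootCoord_zero, h0]
  · exact hC ϖ ⟨hϖ, h1, h2, hϖ0⟩

theorem continuousOn_holCurve (ha : 0 < a) (ha1 : a < 1) (k : Fin 3) :
    ContinuousOn (holCurve a k) closedSector := by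
  intro z hz
  rcases eq_or_ne z (branchPoint a) with rfl | hne
  · obtain ⟨ε, hε, H, hH, hHeq⟩ := exists_rootPrimitive ha ha1 k
    have hroot : Filter.Tendsto (rootCoord a) (nhds (branchPoint a)) (nhds 0) := by
      rw [Metric.nhds_basis_ball.tendsto_right_iff]
      intro δ hδ
      filter_upwards [branchPoint_mem_ball_of_near ha hδ] with t ht using ht.1
    have h0 : holCurve a k (branchPoint a) = H 0 := by
      have := (hHeq 0 (Metric.mem_ball_self hε) le_rfl le_rfl).2
      rwa [ofRootCoord_zero] at this
    rw [ContinuousWithinAt, h0]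
    refine Filter.Tendsto.congr' ?_ (((hH 0 (Metric.mem_ball_self hε)).continuousAt.tendsto.comp
      hroot).mono_left nhdsWithin_le_nhds)
    filter_upwards [self_mem_nhdsWithin,
      nhdsWithin_le_nhds (branchPoint_mem_ball_of_near ha hε)] with y hy hball
    have h1 := (hHeq _ hball.1 (rootCoord_re_nonneg _ _) (rootCoord_im_nonneg hy)).2
    rw [ofRootCoord_rootCoord ha hy hball.2] at h1
    exact h1.symm
  · exact (hasDerivAt_holCurve (mem_starExt ha ha1 hz hne) k).continuousAt.continuousWithinAt

theorem continuousOn_fMax_apply (ha : 0 < a) (ha1 : a < 1) (k : Fin 3) :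
    ContinuousOn (fun z => fMax a z k) closedSector :=
  (Complex.continuous_re.comp_continuousOn (continuousOn_holCurve ha ha1 k)).congr
    fun _ hz => fMax_apply hz k

theorem continuousOn_fMax (ha : 0 < a) (ha1 : a < 1) : ContinuousOn (fMax a) closedSector :=
  (PiLp.continuous_toLp 2 _).comp_continuousOn
    (continuousOn_pi.2 fun k => continuousOn_fMax_apply ha ha1 k)

end BranchPoint

/-! ### The maximal piece in polar coordinates -/

theorem eq_of_hasDerivAt_zero {f : ℝ → ℝ} {α β : ℝ} (hc : ContinuousOn f (Set.Icc α β))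
    (hd : ∀ x ∈ Set.Ioo α β, HasDerivAt f 0 x) {x y : ℝ} (hx : x ∈ Set.Icc α β)
    (hy : y ∈ Set.Icc α β) : f x = f y := by
  rw [← interior_Icc] at hd
  have h1 : MonotoneOn f (Set.Icc α β) := monotoneOn_of_deriv_nonneg (convex_Icc _ _) hc
    (fun x hx => (hd x hx).differentiableAt.differentiableWithinAt)
    (fun x hx => (hd x hx).deriv.ge)
  have h2 : AntitoneOn f (Set.Icc α β) := antitoneOn_of_deriv_nonpos (convex_Icc _ _) hc
    (fun x hx => (hd x hx).differentiableAt.differentiableWithinAt)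
    (fun x hx => (hd x hx).deriv.le)
  rcases le_total x y with h | h
  · exact (h1 hx hy h).antisymm (h2 hx hy h)
  · exact (h2 hy hx h).antisymm (h1 hy hx h)

theorem strictMonoOn_of_hasDerivAt_pos {f f' : ℝ → ℝ} {α β : ℝ} (hc : ContinuousOn f (Set.Icc α β))
    (hd : ∀ x ∈ Set.Ioo α β, HasDerivAt f (f' x) x ∧ 0 < f' x) :
    StrictMonoOn f (Set.Icc α β) :=
  strictMonoOn_of_deriv_pos (convex_Icc _ _) hc fun x hx => by
    rw [interior_Icc] at hx
    rw [(hd x hx).1.deriv]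
    exact (hd x hx).2

theorem monotoneOn_of_hasDerivAt_nonneg {f f' : ℝ → ℝ} {α β : ℝ}
    (hc : ContinuousOn f (Set.Icc α β))
    (hd : ∀ x ∈ Set.Ioo α β, HasDerivAt f (f' x) x ∧ 0 ≤ f' x) :
    MonotoneOn f (Set.Icc α β) :=
  monotoneOn_of_deriv_nonneg (convex_Icc _ _) hc
    (fun x hx => by
      rw [interior_Icc] at hx
      exact (hd x hx).1.differentiableAt.differentiableWithinAt)
    fun x hx => by
      rw [interior_Icc] at hx
      rw [(hd x hx).1.deriv]
      exact (hd x hx).2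

section Polar

variable {a : ℝ}

/-- Half the sum of a number and its inverse. -/
def chr (r : ℝ) : ℝ := (r⁻¹ + r) / 2

/-- Half the difference of the inverse of a number and the number. -/
def shr (r : ℝ) : ℝ := (r⁻¹ - r) / 2

theorem chr_pos {r : ℝ} (hr : 0 < r) : 0 < chr r := by unfold chr; positivity

theorem shr_pos {r : ℝ} (hr : 0 < r) (hr1 : r < 1) : 0 < shr r := by
  have := (one_lt_inv₀ hr).2 hr1
  unfold shr
  linarith

theorem shr_one : shr 1 = 0 := by simp [shr]

theorem chr_one : chr 1 = 1 := by norm_num [chr]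

theorem shr_nonneg {r : ℝ} (hr : 0 < r) (hr1 : r ≤ 1) : 0 ≤ shr r := by
  rcases hr1.lt_or_eq with h | h
  · exact (shr_pos hr h).le
  · rw [h, shr_one]

/-- The coordinates of `r ∂f/∂r` when the density is `A + i B`. -/
def radialPart (D : ℂ) (r θ : ℝ) : Fin 3 → ℝ :=
  ![D.im, D.re * shr r * Real.sin θ - D.im * chr r * Real.cos θ,
    -(D.re * shr r * Real.cos θ + D.im * chr r * Real.sin θ)]

/-- The coordinates of `∂f/∂θ` when the density is `A + i B`. -/
def angularPart (D : ℂ) (r θ : ℝ) : Fin 3 → ℝ :=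
  ![D.re, -(D.re * chr r * Real.cos θ + D.im * shr r * Real.sin θ),
    D.im * shr r * Real.cos θ - D.re * chr r * Real.sin θ]

/-- Dividing `z Φ` by `2 z² / w` leaves `z ± 1/z` up to constants, hence the functions `shr`, `chr`,
`sin`, `cos`. The real part of `z Φ` is `r ∂f/∂r`; the negative of its imaginary part is `∂f/∂θ`. -/
theorem Phi_mul_self {r θ : ℝ} (hr : 0 < r) (k : Fin 3) :
    Phi a (polar r θ) k * polar r θ = density a (polar r θ) *
      ((![-Complex.I, ⟨shr r * Real.sin θ, chr r * Real.cos θ⟩,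
        ⟨-(shr r * Real.cos θ), chr r * Real.sin θ⟩] : Fin 3 → ℂ) k) := by
  set z := polar r θ with hz
  have hinv : z * polar r⁻¹ (-θ) = 1 := by
    rw [hz, polar, polar]
    have : Complex.exp ((θ : ℂ) * Complex.I) * Complex.exp (((-θ : ℝ) : ℂ) * Complex.I) = 1 := by
      rw [← Complex.exp_add]
      simp
    have hr' : (r : ℂ) * ((r⁻¹ : ℝ) : ℂ) = 1 := by
      rw [← Complex.ofReal_mul, mul_inv_cancel₀ hr.ne', Complex.ofReal_one]
    linear_combination (r : ℂ) * ((r⁻¹ : ℝ) : ℂ) * this + hr'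
  set y := polar r⁻¹ (-θ) with hy
  have hc1 : (⟨shr r * Real.sin θ, chr r * Real.cos θ⟩ : ℂ) = Complex.I * (y + z) / 2 := by
    rw [mul_div_assoc]
    apply Complex.ext
    · simp only [Complex.I_mul_re, Complex.div_ofNat_im, Complex.add_im, hy, hz, polar_im,
        Real.sin_neg, shr]
      ring
    · simp only [Complex.I_mul_im, Complex.div_ofNat_re, Complex.add_re, hy, hz, polar_re,
        Real.cos_neg, chr]
      ring
  have hc2 : (⟨-(shr r * Real.cos θ), chr r * Real.sin θ⟩ : ℂ) = (z - y) / 2 := by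
    apply Complex.ext
    · simp only [Complex.div_ofNat_re, Complex.sub_re, hy, hz, polar_re, Real.cos_neg, shr]
      ring
    · simp only [Complex.div_ofNat_im, Complex.sub_im, hy, hz, polar_im, Real.sin_neg, chr]
      ring
  rw [Phi_eq, density, hc1, hc2]
  fin_cases k
  · simp only [weierstrassVec]
    change -2 * z * (Complex.I / wBranch a z) * z = 2 * z ^ 2 / wBranch a z * -Complex.I
    ring
  · change (1 + z ^ 2) * (Complex.I / wBranch a z) * z =
      2 * z ^ 2 / wBranch a z * (Complex.I * (y + z) / 2)
    linear_combination (-(Complex.I / wBranch a z) * z) * hinv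
  · change Complex.I * (1 - z ^ 2) * (Complex.I / wBranch a z) * z =
      2 * z ^ 2 / wBranch a z * ((z - y) / 2)
    rw [mul_comm Complex.I, mul_assoc (1 - z ^ 2), ← mul_div_assoc, Complex.I_mul_I]
    linear_combination (z / wBranch a z) * hinv

theorem Phi_mul_self_re {r θ : ℝ} (hr : 0 < r) (k : Fin 3) :
    (Phi a (polar r θ) k * polar r θ).re = radialPart (density a (polar r θ)) r θ k := by
  rw [Phi_mul_self hr]
  fin_cases k <;> simp [radialPart, Complex.mul_re] <;> ring

theorem Phi_mul_self_im {r θ : ℝ} (hr : 0 < r) (k : Fin 3) :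
    (Phi a (polar r θ) k * polar r θ).im = -angularPart (density a (polar r θ)) r θ k := by
  rw [Phi_mul_self hr]
  fin_cases k <;> simp [angularPart, Complex.mul_im] <;> ring

/-- The coordinates of `fMax` as functions of `(θ, r)`. -/
def polarMax (a : ℝ) (k : Fin 3) (p : ℝ × ℝ) : ℝ := fMax a (polar p.2 p.1) k

theorem continuous_polar : Continuous fun p : ℝ × ℝ => polar p.2 p.1 := by
  unfold polar
  fun_prop

/-- Stated for `holCurve`, which is holomorphic on a full neighbourhood, so that it covers the
bounding rays and the circle `r = 1`. -/
theorem hasFDerivAt_holCurve_polar (ha : 0 < a) (ha1 : a < 1) {θ r : ℝ} (hr : 0 < r) (hr1 : r ≤ 1)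
    (h0 : 0 ≤ θ) (h1 : θ ≤ π / 4) (hne : polar r θ ≠ branchPoint a) (k : Fin 3) :
    ∃ L : ℝ × ℝ →L[ℝ] ℝ,
      HasFDerivAt (fun p : ℝ × ℝ => (holCurve a k (polar p.2 p.1)).re) L (θ, r) ∧
      L (1, 0) = angularPart (density a (polar r θ)) r θ k ∧
      L (0, 1) = radialPart (density a (polar r θ)) r θ k / r := by
  have hmem := polar_mem_closedSector hr.le hr1 h0 h1
  have hd := hasDerivAt_holCurve (mem_starExt ha ha1 hmem hne) k
  have hf : HasFDerivAt (fun p : ℝ × ℝ => (p.1 : ℂ)) (Complex.ofRealCLM.comp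
      (ContinuousLinearMap.fst ℝ ℝ ℝ)) (θ, r) :=
    Complex.ofRealCLM.hasFDerivAt.comp (θ, r) hasFDerivAt_fst
  have hs : HasFDerivAt (fun p : ℝ × ℝ => (p.2 : ℂ)) (Complex.ofRealCLM.comp
      (ContinuousLinearMap.snd ℝ ℝ ℝ)) (θ, r) :=
    Complex.ofRealCLM.hasFDerivAt.comp (θ, r) hasFDerivAt_snd
  have he := ((Complex.hasDerivAt_exp ((θ : ℂ) * Complex.I)).comp_hasFDerivAt_of_eq (θ, r)
    (hf.mul_const Complex.I) rfl)
  have hp := hs.mul he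
  have hcomp := hd.comp_hasFDerivAt_of_eq (θ, r) hp rfl
  have hre := Complex.reCLM.hasFDerivAt.comp (θ, r) hcomp
  refine ⟨_, hre, ?_, ?_⟩
  · have h2 := Phi_mul_self_im (a := a) (θ := θ) hr k
    rw [← neg_eq_iff_eq_neg] at h2
    rw [← h2, PhiExt_eq hmem, ← Complex.I_mul_re]
    simp [polar]
    ring
  · rw [eq_div_iff hr.ne', ← Phi_mul_self_re hr, PhiExt_eq hmem]
    simp [polar]
    ring

theorem polar_ne_branchPoint (ha : 0 < a) {r θ : ℝ} (hr : 0 < r) (h0 : 0 ≤ θ) (h1 : θ ≤ π / 4)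
    (h : θ ≠ π / 4 ∨ r ≠ a) : polar r θ ≠ branchPoint a := by
  intro heq
  have hn := congrArg norm heq
  rw [norm_polar hr.le, norm_branchPoint ha] at hn
  have harg := congrArg Complex.arg heq
  rw [branchPoint_eq, arg_polar hr h0 h1, arg_polar ha (by positivity) le_rfl] at harg
  exact h.elim (fun h => h harg) fun h => h hn

theorem polarMax_eq {r θ : ℝ} (hr0 : 0 ≤ r) (hr1 : r ≤ 1) (h0 : 0 ≤ θ) (h1 : θ ≤ π / 4)
    (k : Fin 3) : polarMax a k (θ, r) = (holCurve a k (polar r θ)).re :=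
  fMax_apply (polar_mem_closedSector hr0 hr1 h0 h1) k

theorem continuousOn_polarMax (ha : 0 < a) (ha1 : a < 1) (k : Fin 3) :
    ContinuousOn (polarMax a k) (Set.Icc 0 (π / 4) ×ˢ Set.Icc 0 1) :=
  (continuousOn_fMax_apply ha ha1 k).comp continuous_polar.continuousOn
    fun _ hp => polar_mem_closedSector hp.2.1 hp.2.2 hp.1.1 hp.1.2

theorem continuousOn_polarMax_left (ha : 0 < a) (ha1 : a < 1) (k : Fin 3) {r : ℝ}
    (hr : r ∈ Set.Icc (0 : ℝ) 1) :
    ContinuousOn (fun θ => polarMax a k (θ, r)) (Set.Icc 0 (π / 4)) :=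
  (continuousOn_polarMax ha ha1 k).comp (by fun_prop) fun _ hθ => ⟨hθ, hr⟩

theorem continuousOn_polarMax_right (ha : 0 < a) (ha1 : a < 1) (k : Fin 3) {θ : ℝ}
    (hθ : θ ∈ Set.Icc (0 : ℝ) (π / 4)) :
    ContinuousOn (fun r => polarMax a k (θ, r)) (Set.Icc 0 1) :=
  (continuousOn_polarMax ha ha1 k).comp (by fun_prop) fun _ hr => ⟨hθ, hr⟩

theorem hasFDerivAt_polarMax (ha : 0 < a) (ha1 : a < 1) {θ r : ℝ} (hr : 0 < r) (hr1 : r < 1)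
    (h0 : 0 < θ) (h1 : θ < π / 4) (k : Fin 3) :
    ∃ L : ℝ × ℝ →L[ℝ] ℝ, HasFDerivAt (polarMax a k) L (θ, r) ∧
      L (1, 0) = angularPart (density a (polar r θ)) r θ k ∧
      L (0, 1) = radialPart (density a (polar r θ)) r θ k / r := by
  obtain ⟨L, hL, h2, h3⟩ := hasFDerivAt_holCurve_polar ha ha1 hr hr1.le h0.le h1.le
    (polar_ne_branchPoint ha hr h0.le h1.le (Or.inl h1.ne)) k
  refine ⟨L, hL.congr_of_eventuallyEq ?_, h2, h3⟩
  filter_upwards [prod_mem_nhds (Icc_mem_nhds h0 h1) (Icc_mem_nhds hr hr1)] with p hp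
  exact polarMax_eq hp.2.1 hp.2.2 hp.1.1 hp.1.2 k

theorem hasDerivAt_polarMax_angular (ha : 0 < a) (ha1 : a < 1) {θ r : ℝ} (hr : 0 < r)
    (hr1 : r ≤ 1) (h0 : 0 < θ) (h1 : θ < π / 4) (k : Fin 3) :
    HasDerivAt (fun θ => polarMax a k (θ, r)) (angularPart (density a (polar r θ)) r θ k) θ := by
  obtain ⟨L, hL, h2, -⟩ := hasFDerivAt_holCurve_polar ha ha1 hr hr1 h0.le h1.le
    (polar_ne_branchPoint ha hr h0.le h1.le (Or.inl h1.ne)) k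
  have h3 : HasDerivAt (fun θ : ℝ => (θ, r)) (1, 0) θ :=
    (hasDerivAt_id θ).prodMk (hasDerivAt_const θ r)
  have h4 := HasFDerivAt.comp_hasDerivAt (f := fun θ : ℝ => (θ, r)) θ hL h3
  rw [h2] at h4
  refine h4.congr_of_eventuallyEq ?_
  filter_upwards [Icc_mem_nhds h0 h1] with x hx
  exact polarMax_eq hr.le hr1 hx.1 hx.2 k

theorem hasDerivAt_polarMax_radial (ha : 0 < a) (ha1 : a < 1) {θ r : ℝ} (hr : 0 < r)
    (hr1 : r < 1) (h0 : 0 ≤ θ) (h1 : θ ≤ π / 4) (hne : θ ≠ π / 4 ∨ r ≠ a) (k : Fin 3) :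
    HasDerivAt (fun r => polarMax a k (θ, r)) (radialPart (density a (polar r θ)) r θ k / r) r := by
  obtain ⟨L, hL, -, h2⟩ := hasFDerivAt_holCurve_polar ha ha1 hr hr1.le h0 h1
    (polar_ne_branchPoint ha hr h0 h1 hne) k
  have h3 : HasDerivAt (fun r : ℝ => (θ, r)) (0, 1) r :=
    (hasDerivAt_const r θ).prodMk (hasDerivAt_id r)
  have h4 := HasFDerivAt.comp_hasDerivAt (f := fun r : ℝ => (θ, r)) r hL h3
  rw [h2] at h4
  refine h4.congr_of_eventuallyEq ?_
  filter_upwards [Icc_mem_nhds hr hr1] with x hx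
  exact polarMax_eq hx.1 hx.2 h0 h1 k

theorem density_polar_pos (ha : 0 < a) (ha1 : a < 1) {θ r : ℝ} (hr : 0 < r) (hr1 : r < 1)
    (h0 : 0 < θ) (h1 : θ < π / 4) :
    0 < (density a (polar r θ)).re ∧ 0 < (density a (polar r θ)).im := by
  refine density_pos ha ha1 (by rwa [norm_polar hr.le]) ?_ ?_
  · rw [polar_im]
    exact mul_pos hr (Real.sin_pos_of_pos_of_lt_pi h0 (by linarith [Real.pi_pos]))
  · rw [polar_im, polar_re]
    exact mul_lt_mul_of_pos_left (sin_lt_cos_of_lt_pi_div_four h0.le h1) hr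

theorem density_polar_re_pos (ha : 0 < a) (ha1 : a < 1) {θ r : ℝ} (hr : 0 < r) (hr1 : r ≤ 1)
    (h0 : 0 < θ) (h1 : θ < π / 4) :
    0 < (density a (polar r θ)).re ∧ 0 ≤ (density a (polar r θ)).im := by
  rcases hr1.lt_or_eq with h | rfl
  · exact ⟨(density_polar_pos ha ha1 hr h h0 h1).1, (density_polar_pos ha ha1 hr h h0 h1).2.le⟩
  · rw [density_circle ha ha1 h0.le h1.le]
    exact ⟨xi_pos ha ha1 θ, le_rfl⟩

theorem polarMax_zero_right (θ : ℝ) (k : Fin 3) : polarMax a k (θ, 0) = fMax a 0 k := by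
  simp [polarMax, polar]

theorem polarMax_zero_one (k : Fin 3) : polarMax a k (0, 1) = 0 := by
  simp [polarMax, polar, fMax]

theorem sin_cos_pos {θ : ℝ} (h0 : 0 ≤ θ) (h1 : θ ≤ π / 4) : 0 ≤ Real.sin θ ∧ 0 < Real.cos θ :=
  ⟨Real.sin_nonneg_of_nonneg_of_le_pi h0 (by linarith [Real.pi_pos]),
    Real.cos_pos_of_mem_Ioo ⟨by linarith [Real.pi_pos], by linarith [Real.pi_pos]⟩⟩

theorem strictMonoOn_height (ha : 0 < a) (ha1 : a < 1) {r : ℝ} (hr : 0 < r) (hr1 : r ≤ 1) :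
    StrictMonoOn (fun θ => polarMax a 0 (θ, r)) (Set.Icc 0 (π / 4)) :=
  strictMonoOn_of_hasDerivAt_pos (continuousOn_polarMax_left ha ha1 0 ⟨hr.le, hr1⟩) fun _ hθ =>
    ⟨hasDerivAt_polarMax_angular ha ha1 hr hr1 hθ.1 hθ.2 0,
      (density_polar_re_pos ha ha1 hr hr1 hθ.1 hθ.2).1⟩

/-- A linear combination of the coordinates that is monotone on the open rays of the sector is
monotone on the boundary rays as well. -/
theorem monotoneOn_radial_of_interior (ha : 0 < a) (ha1 : a < 1) (c : Fin 3 → ℝ)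
    (h : ∀ θ ∈ Set.Ioo 0 (π / 4), ∀ r ∈ Set.Ioo (0 : ℝ) 1,
      0 ≤ ∑ k, c k * radialPart (density a (polar r θ)) r θ k)
    {θ : ℝ} (hθ : θ ∈ Set.Icc 0 (π / 4)) :
    MonotoneOn (fun r => ∑ k, c k * polarMax a k (θ, r)) (Set.Icc 0 1) := by
  intro r hr r' hr' hrr
  have hpi : (0 : ℝ) ≠ π / 4 := by positivity
  -- The inequality on open rays passes to `θ = 0` and `θ = π/4` by continuity, so the branch point
  -- causes no trouble.
  refine le_on_closure (s := Set.Ioo 0 (π / 4))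
    (f := fun θ => ∑ k, c k * polarMax a k (θ, r)) (g := fun θ => ∑ k, c k * polarMax a k (θ, r'))
    (fun θ hθ => ?_) ?_ ?_ (by rwa [closure_Ioo hpi])
  · have hθ' := Set.Ioo_subset_Icc_self hθ
    refine monotoneOn_of_hasDerivAt_nonneg (f := fun r => ∑ k, c k * polarMax a k (θ, r))
      (f' := fun r => ∑ k, c k * (radialPart (density a (polar r θ)) r θ k / r))
      ?_ (fun x hx => ⟨?_, ?_⟩) hr hr' hrr
    · exact continuousOn_finsetSum _ fun k _ =>
        continuousOn_const.mul (continuousOn_polarMax_right ha ha1 k hθ')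
    · exact HasDerivAt.fun_sum fun k _ => (hasDerivAt_polarMax_radial ha ha1 hx.1 hx.2 hθ'.1 hθ'.2
        (Or.inl hθ.2.ne) k).const_mul (c k)
    · have := div_nonneg (h θ hθ x hx) hx.1.le
      rw [Finset.sum_div] at this
      simpa only [mul_div_assoc] using this
  · rw [closure_Ioo hpi]
    exact continuousOn_finsetSum _ fun k _ =>
      continuousOn_const.mul (continuousOn_polarMax_left ha ha1 k hr)
  · rw [closure_Ioo hpi]
    exact continuousOn_finsetSum _ fun k _ =>
      continuousOn_const.mul (continuousOn_polarMax_left ha ha1 k hr')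

theorem monotoneOn_height_radial (ha : 0 < a) (ha1 : a < 1) {θ : ℝ}
    (hθ : θ ∈ Set.Icc 0 (π / 4)) : MonotoneOn (fun r => polarMax a 0 (θ, r)) (Set.Icc 0 1) := by
  have := monotoneOn_radial_of_interior ha ha1 ![1, 0, 0] (fun θ hθ r hr => by
    simpa [Fin.sum_univ_three, radialPart] using
      (density_polar_pos ha ha1 hr.1 hr.2 hθ.1 hθ.2).2.le) hθ
  simpa [Fin.sum_univ_three] using this

/-- With `D = A + iB`, the derivative of `-(x₁ + x₂)` in `log r` is `A shr (cos θ - sin θ) + B chr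
(cos θ + sin θ)`. -/
theorem antitoneOn_sum_radial (ha : 0 < a) (ha1 : a < 1) {θ : ℝ} (hθ : θ ∈ Set.Icc 0 (π / 4)) :
    AntitoneOn (fun r => polarMax a 1 (θ, r) + polarMax a 2 (θ, r)) (Set.Icc 0 1) := by
  have := monotoneOn_radial_of_interior ha ha1 ![0, -1, -1] (fun θ hθ r hr => by
    obtain ⟨hA, hB⟩ := density_polar_pos ha ha1 hr.1 hr.2 hθ.1 hθ.2
    obtain ⟨hs, hc⟩ := sin_cos_pos hθ.1.le hθ.2.le
    have hsc := sin_lt_cos_of_lt_pi_div_four hθ.1.le hθ.2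
    have hsh := shr_pos hr.1 hr.2
    have hch := chr_pos hr.1
    simp [Fin.sum_univ_three, radialPart]
    nlinarith [mul_pos (mul_pos hA hsh) (sub_pos.2 hsc), mul_pos (mul_pos hB hch) hc,
      mul_nonneg (mul_pos hB hch).le hs]) hθ
  intro r hr r' hr' h
  have h2 := this hr hr' h
  simp [Fin.sum_univ_three] at h2
  show polarMax a 1 (θ, r') + polarMax a 2 (θ, r') ≤ polarMax a 1 (θ, r) + polarMax a 2 (θ, r)
  linarith

/-! ### The boundary rays -/

theorem polarMax_axis (ha : 0 < a) (ha1 : a < 1) {r : ℝ} (hr : r ∈ Set.Icc (0 : ℝ) 1) :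
    polarMax a 0 (0, r) = 0 ∧ polarMax a 1 (0, r) = 0 := by
  have hpi := Real.pi_pos
  have hθ : (0 : ℝ) ∈ Set.Icc 0 (π / 4) := ⟨le_rfl, by positivity⟩
  have h : ∀ k : Fin 3, k ≠ 2 → polarMax a k (0, r) = 0 := by
    intro k hk
    refine (eq_of_hasDerivAt_zero (f := fun r => polarMax a k (0, r))
      (continuousOn_polarMax_right ha ha1 k hθ) (fun x hx => ?_) hr
      (Set.right_mem_Icc.2 zero_le_one)).trans (polarMax_zero_one k)
    have hd := hasDerivAt_polarMax_radial ha ha1 hx.1 hx.2 hθ.1 hθ.2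
      (Or.inl (by positivity : (0 : ℝ) ≠ π / 4)) k
    obtain ⟨A, -, hA⟩ := density_axis (a := a) ha hx.1
    refine hd.congr_deriv ?_
    rw [hA]
    fin_cases k
    · simp [radialPart]
    · simp [radialPart]
    · exact absurd rfl hk
  exact ⟨h 0 (by decide), h 1 (by decide)⟩

theorem strictAntiOn_axis (ha : 0 < a) (ha1 : a < 1) :
    StrictAntiOn (fun r => polarMax a 2 (0, r)) (Set.Icc 0 1) := by
  have hpi := Real.pi_pos
  have hθ : (0 : ℝ) ∈ Set.Icc 0 (π / 4) := ⟨le_rfl, by positivity⟩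
  refine strictAntiOn_of_deriv_neg (convex_Icc _ _) (continuousOn_polarMax_right ha ha1 2 hθ)
    fun x hx => ?_
  rw [interior_Icc] at hx
  rw [(hasDerivAt_polarMax_radial ha ha1 hx.1 hx.2 hθ.1 hθ.2
      (Or.inl (by positivity : (0 : ℝ) ≠ π / 4)) 2).deriv]
  obtain ⟨A, hA0, hA⟩ := density_axis (a := a) ha hx.1
  rw [hA]
  have : 0 < A * shr x / x := div_pos (mul_pos hA0 (shr_pos hx.1 hx.2)) hx.1
  simp [radialPart]
  rw [neg_div]
  linarith

theorem pi_div_four_mem : π / 4 ∈ Set.Icc 0 (π / 4) := ⟨by positivity, le_rfl⟩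

theorem continuousOn_polarMax_diag (ha : 0 < a) (ha1 : a < 1) (k : Fin 3) {α β : ℝ} (hα : 0 ≤ α)
    (hβ : β ≤ 1) : ContinuousOn (fun r => polarMax a k (π / 4, r)) (Set.Icc α β) :=
  (continuousOn_polarMax_right ha ha1 k pi_div_four_mem).mono (Set.Icc_subset_Icc hα hβ)

theorem hasDerivAt_polarMax_diag_inner (ha : 0 < a) (ha1 : a < 1) {r : ℝ}
    (hr : r ∈ Set.Ioo 0 a) : ∃ B : ℝ, 0 < B ∧
      HasDerivAt (fun r => polarMax a 0 (π / 4, r)) B r ∧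
      HasDerivAt (fun r => polarMax a 1 (π / 4, r)) (-(B * chr r * (√2 / 2))) r ∧
      HasDerivAt (fun r => polarMax a 2 (π / 4, r)) (-(B * chr r * (√2 / 2))) r := by
  obtain ⟨B, hB0, hB⟩ := density_diag_inner ha ha1 hr.1 hr.2
  have hd := fun k => hasDerivAt_polarMax_radial ha ha1 hr.1 (hr.2.trans ha1) pi_div_four_mem.1
    le_rfl (Or.inr hr.2.ne) k
  refine ⟨B / r, div_pos hB0 hr.1, (hd 0).congr_deriv ?_, (hd 1).congr_deriv ?_,
    (hd 2).congr_deriv ?_⟩ <;> rw [hB] <;> simp [radialPart] <;> ring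

theorem hasDerivAt_polarMax_diag_outer (ha : 0 < a) (ha1 : a < 1) {r : ℝ}
    (hr : r ∈ Set.Ioo a 1) : ∃ A : ℝ, 0 < A ∧
      HasDerivAt (fun r => polarMax a 0 (π / 4, r)) 0 r ∧
      HasDerivAt (fun r => polarMax a 1 (π / 4, r)) A r ∧
      HasDerivAt (fun r => polarMax a 2 (π / 4, r)) (-A) r := by
  have hr0 : 0 < r := ha.trans hr.1
  obtain ⟨A, hA0, hA⟩ := density_diag_outer ha ha1 hr.1 hr.2.le
  have hd := fun k => hasDerivAt_polarMax_radial ha ha1 hr0 hr.2 pi_div_four_mem.1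
    le_rfl (Or.inr hr.1.ne') k
  have hsh := shr_pos hr0 hr.2
  refine ⟨A * shr r * (√2 / 2) / r, by positivity, (hd 0).congr_deriv ?_, (hd 1).congr_deriv ?_,
    (hd 2).congr_deriv ?_⟩ <;> rw [hA] <;> simp [radialPart] <;> ring

theorem strictMonoOn_height_diag (ha : 0 < a) (ha1 : a < 1) :
    StrictMonoOn (fun r => polarMax a 0 (π / 4, r)) (Set.Icc 0 a) := by
  refine strictMonoOn_of_deriv_pos (convex_Icc _ _)
    (continuousOn_polarMax_diag ha ha1 0 le_rfl ha1.le) fun r hr => ?_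
  rw [interior_Icc] at hr
  obtain ⟨B, hB, hd, -⟩ := hasDerivAt_polarMax_diag_inner ha ha1 hr
  rwa [hd.deriv]

theorem diff_diag_inner (ha : 0 < a) (ha1 : a < 1) {r : ℝ} (hr : r ∈ Set.Icc 0 a) :
    polarMax a 2 (π / 4, r) - polarMax a 1 (π / 4, r) = fMax a 0 2 - fMax a 0 1 := by
  rw [← polarMax_zero_right (π / 4), ← polarMax_zero_right (π / 4)]
  refine eq_of_hasDerivAt_zero (f := fun r => polarMax a 2 (π / 4, r) - polarMax a 1 (π / 4, r))
    ((continuousOn_polarMax_diag ha ha1 2 le_rfl ha1.le).sub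
    (continuousOn_polarMax_diag ha ha1 1 le_rfl ha1.le)) (fun x hx => ?_) hr
    (Set.left_mem_Icc.2 ha.le)
  obtain ⟨B, -, -, h1, h2⟩ := hasDerivAt_polarMax_diag_inner ha ha1 hx
  exact (h2.sub h1).congr_deriv (sub_self _)

theorem height_diag_outer (ha : 0 < a) (ha1 : a < 1) {r : ℝ} (hr : r ∈ Set.Icc a 1) :
    polarMax a 0 (π / 4, r) = polarMax a 0 (π / 4, 1) :=
  eq_of_hasDerivAt_zero (f := fun r => polarMax a 0 (π / 4, r))
    (continuousOn_polarMax_diag ha ha1 0 ha.le le_rfl)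
    (fun _ hx => (hasDerivAt_polarMax_diag_outer ha ha1 hx).choose_spec.2.1) hr
    (Set.right_mem_Icc.2 ha1.le)

theorem sum_diag_outer (ha : 0 < a) (ha1 : a < 1) {r : ℝ} (hr : r ∈ Set.Icc a 1) :
    polarMax a 1 (π / 4, r) + polarMax a 2 (π / 4, r) =
      polarMax a 1 (π / 4, 1) + polarMax a 2 (π / 4, 1) := by
  refine eq_of_hasDerivAt_zero (f := fun r => polarMax a 1 (π / 4, r) + polarMax a 2 (π / 4, r))
    ((continuousOn_polarMax_diag ha ha1 1 ha.le le_rfl).add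
    (continuousOn_polarMax_diag ha ha1 2 ha.le le_rfl)) (fun x hx => ?_) hr
    (Set.right_mem_Icc.2 ha1.le)
  obtain ⟨A, -, -, h1, h2⟩ := hasDerivAt_polarMax_diag_outer ha ha1 hx
  exact (h1.add h2).congr_deriv (add_neg_cancel _)

theorem strictAntiOn_diag_outer (ha : 0 < a) (ha1 : a < 1) :
    StrictAntiOn (fun r => polarMax a 2 (π / 4, r)) (Set.Icc a 1) := by
  refine strictAntiOn_of_deriv_neg (convex_Icc _ _)
    (continuousOn_polarMax_diag ha ha1 2 ha.le le_rfl) fun r hr => ?_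
  rw [interior_Icc] at hr
  obtain ⟨A, hA, -, -, hd⟩ := hasDerivAt_polarMax_diag_outer ha ha1 hr
  rw [hd.deriv]
  linarith

/-! ### The fold curve as the boundary value of the maximal piece -/

theorem continuous_xi (ha : 0 < a) (ha1 : a < 1) : Continuous (xi a) := by
  unfold xi
  refine continuous_const.div (by fun_prop) fun t => ?_
  exact (Real.sqrt_pos.2 (xi_radicand_pos ha ha1 t)).ne'

/-- The derivative of the fold curve. -/
def gammaDeriv (a s : ℝ) : Fin 3 → ℝ := ![xi a s, xi a s * (-Real.cos s), xi a s * (-Real.sin s)]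

theorem hasDerivAt_gamma_apply (ha : 0 < a) (ha1 : a < 1) (s : ℝ) (k : Fin 3) :
    HasDerivAt (fun s => gamma a s k) (gammaDeriv a s k) s := by
  have hx := continuous_xi ha ha1
  have h : ∀ g : ℝ → ℝ, Continuous g → HasDerivAt (fun s => ∫ t in (0 : ℝ)..s, g t) (g s) s :=
    fun g hg => intervalIntegral.integral_hasDerivAt_right (hg.intervalIntegrable _ _)
      (hg.stronglyMeasurableAtFilter _ _) hg.continuousAt
  fin_cases k
  · exact h (xi a) hx
  · exact h (fun t => xi a t * (-Real.cos t)) (by fun_prop)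
  · exact h (fun t => xi a t * (-Real.sin t)) (by fun_prop)

theorem gamma_zero (k : Fin 3) : gamma a 0 k = 0 := by
  fin_cases k <;> simp [gamma]

/-- At `r = 1` one has `shr = 0`, `chr = 1` and `D = ξ`, so the `θ`-derivative is `γ'`; both sides
vanish at `θ = 0`. -/
theorem polarMax_circle (ha : 0 < a) (ha1 : a < 1) {θ : ℝ} (hθ : θ ∈ Set.Icc 0 (π / 4))
    (k : Fin 3) : polarMax a k (θ, 1) = gamma a θ k := by
  have h := eq_of_hasDerivAt_zero (f := fun θ => polarMax a k (θ, 1) - gamma a θ k)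
    ((continuousOn_polarMax_left ha ha1 k ⟨zero_le_one, le_rfl⟩).sub
      fun s _ => (hasDerivAt_gamma_apply ha ha1 s k).continuousAt.continuousWithinAt)
    (fun x hx => ?_) hθ (Set.left_mem_Icc.2 pi_div_four_mem.1)
  · rw [polarMax_zero_one, gamma_zero, sub_zero] at h
    linarith
  · refine ((hasDerivAt_polarMax_angular ha ha1 one_pos le_rfl hx.1 hx.2 k).sub
      (hasDerivAt_gamma_apply ha ha1 x k)).congr_deriv ?_
    rw [density_circle ha ha1 hx.1.le hx.2.le]
    fin_cases k <;> simp [angularPart, gammaDeriv, chr_one, shr_one]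

theorem fMax_circle (ha : 0 < a) (ha1 : a < 1) {θ : ℝ} (hθ : θ ∈ Set.Icc 0 (π / 4)) :
    fMax a (polar 1 θ) = gamma a θ := by
  ext k
  exact polarMax_circle ha ha1 hθ k

/-! ### Level curves of the height on the maximal piece -/

theorem height_axis_pos (ha : 0 < a) (ha1 : a < 1) {θ r : ℝ} (hr : r ∈ Set.Ioc (0 : ℝ) 1)
    (hθ : θ ∈ Set.Ioc 0 (π / 4)) : 0 < polarMax a 0 (θ, r) := by
  have := strictMonoOn_height ha ha1 hr.1 hr.2 ⟨le_rfl, pi_div_four_mem.1⟩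
    (Set.Ioc_subset_Icc_self hθ) hθ.1
  simpa only [(polarMax_axis ha ha1 (Set.Ioc_subset_Icc_self hr)).1] using this

/-- On a level curve of the height the last coordinate increases towards the centre. -/
theorem polarMax_two_lt (ha : 0 < a) (ha1 : a < 1) {θ₁ θ₂ r₁ r₂ : ℝ} (hr₂ : 0 < r₂)
    (hr : r₂ < r₁) (hr₁ : r₁ ≤ 1) (hθ₁ : θ₁ ∈ Set.Icc 0 (π / 4)) (hθ₂ : θ₂ ∈ Set.Icc 0 (π / 4))
    (heq : polarMax a 0 (θ₁, r₁) = polarMax a 0 (θ₂, r₂)) :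
    polarMax a 2 (θ₁, r₁) < polarMax a 2 (θ₂, r₂) := by
  have hr₁0 : 0 < r₁ := hr₂.trans hr
  have hr₂1 : r₂ < 1 := hr.trans_le hr₁
  have hr₁I : r₁ ∈ Set.Icc (0 : ℝ) 1 := ⟨hr₁0.le, hr₁⟩
  have hr₂I : r₂ ∈ Set.Icc (0 : ℝ) 1 := ⟨hr₂.le, hr₂1.le⟩
  have hz : (0 : ℝ) ∈ Set.Icc 0 (π / 4) := ⟨le_rfl, pi_div_four_mem.1⟩
  have hmono₂ := strictMonoOn_height ha ha1 hr₂ hr₂1.le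
  have hmono₁ := strictMonoOn_height ha ha1 hr₁0 hr₁
  -- a coincidence of heights on the diagonal forces the outer part of the diagonal
  have hdiag : ∀ r ∈ Set.Ioc r₂ 1, polarMax a 0 (π / 4, r) = polarMax a 0 (π / 4, r₂) →
      a ≤ r₂ := by
    intro r hrr h
    by_contra! hlt
    have h1 : polarMax a 0 (π / 4, r₂) < polarMax a 0 (π / 4, min r a) :=
      strictMonoOn_height_diag ha ha1 ⟨hr₂.le, hlt.le⟩
        ⟨le_min (hr₂.trans hrr.1).le ha.le, min_le_right _ _⟩ (lt_min hrr.1 hlt)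
    have h2 : polarMax a 0 (π / 4, min r a) ≤ polarMax a 0 (π / 4, r) :=
      monotoneOn_height_radial ha ha1 pi_div_four_mem
        ⟨le_min (hr₂.trans hrr.1).le ha.le, (min_le_left _ _).trans hrr.2⟩
        ⟨(hr₂.trans hrr.1).le, hrr.2⟩ (min_le_left _ _)
    linarith
  rcases hθ₁.1.eq_or_lt with rfl | hθ₁0
  · have h0 : θ₂ = 0 := by
      rcases hθ₂.1.eq_or_lt with h | h
      · exact h.symm
      · have := height_axis_pos ha ha1 ⟨hr₂, hr₂1.le⟩ ⟨h, hθ₂.2⟩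
        rw [← heq, (polarMax_axis ha ha1 hr₁I).1] at this
        exact absurd this (lt_irrefl _)
    subst h0
    exact strictAntiOn_axis ha ha1 hr₂I hr₁I hr
  have hk0 := height_axis_pos ha ha1 ⟨hr₁0, hr₁⟩ ⟨hθ₁0, hθ₁.2⟩
  have hle₂ : ∀ r ∈ Set.Icc r₂ 1, polarMax a 0 (θ₂, r₂) ≤ polarMax a 0 (π / 4, r) := by
    intro r hrr
    exact (hmono₂.monotoneOn hθ₂ pi_div_four_mem hθ₂.2).trans
      (monotoneOn_height_radial ha ha1 pi_div_four_mem hr₂I ⟨hr₂.le.trans hrr.1, hrr.2⟩ hrr.1)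
  -- if the level reaches the diagonal at a larger radius, it is the top level
  have htop : ∀ r ∈ Set.Ioc r₂ 1, polarMax a 0 (π / 4, r) = polarMax a 0 (θ₂, r₂) →
      a ≤ r₂ ∧ θ₂ = π / 4 := by
    intro r hrr h
    have h1 := hmono₂.monotoneOn hθ₂ pi_div_four_mem hθ₂.2
    have h2 := monotoneOn_height_radial ha ha1 pi_div_four_mem hr₂I
      ⟨hr₂.le.trans hrr.1.le, hrr.2⟩ hrr.1.le
    simp only at h1 h2
    exact ⟨hdiag r hrr (by linarith), hmono₂.injOn hθ₂ pi_div_four_mem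
      (show polarMax a 0 (θ₂, r₂) = polarMax a 0 (π / 4, r₂) by linarith)⟩
  rcases hθ₁.2.eq_or_lt with rfl | hθ₁1
  · obtain ⟨har, rfl⟩ := htop r₁ ⟨hr, hr₁⟩ heq
    exact strictAntiOn_diag_outer ha ha1 ⟨har, hr₂1.le⟩ ⟨har.trans hr.le, hr₁⟩ hr
  have hsub : Set.Icc 0 (π / 4) ×ˢ Set.Icc r₂ r₁ ⊆ Set.Icc 0 (π / 4) ×ˢ Set.Icc 0 1 :=
    Set.prod_mono le_rfl (Set.Icc_subset_Icc hr₂.le hr₁)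
  -- The level curve runs over radii between `r₂` and `r₁` and meets neither bounding ray there. On
  -- the axis the height is zero; on the diagonal `htop` would force `θ₁ = π/4`.
  refine lt_of_level (g := polarMax a 0) (h := polarMax a 2) (k := polarMax a 0 (θ₂, r₂)) hr
    ((continuousOn_polarMax ha ha1 0).mono hsub) ((continuousOn_polarMax ha ha1 2).mono hsub)
    (fun r hrr => strictMonoOn_height ha ha1 (hr₂.trans_le hrr.1) (hrr.2.trans hr₁))
    (fun r hrr => ?_) (fun r hrr => hle₂ r ⟨hrr.1, hrr.2.trans hr₁⟩) hθ₂ hθ₁ rfl heq ?_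
  · rw [(polarMax_axis ha ha1 ⟨hr₂.le.trans hrr.1, hrr.2.trans hr₁⟩).1, ← heq]
    exact hk0.le
  · intro r hrr x hx hxk
    have hr0 : 0 < r := hr₂.trans hrr.1
    have hr1 : r < 1 := hrr.2.trans_le hr₁
    have hx0 : 0 < x := by
      rcases hx.1.eq_or_lt with h | h
      · rw [← h, (polarMax_axis ha ha1 ⟨hr0.le, hr1.le⟩).1, ← heq] at hxk
        linarith
      · exact h
    have hx1 : x < π / 4 := by
      rcases hx.2.eq_or_lt with h | h
      · rw [h] at hxk
        obtain ⟨har, rfl⟩ := htop r ⟨hrr.1, hr1.le⟩ hxk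
        have h1 : polarMax a 0 (θ₁, r₁) = polarMax a 0 (π / 4, r₁) := by
          rw [heq, height_diag_outer ha ha1 ⟨har, hr₂1.le⟩,
            height_diag_outer ha ha1 ⟨har.trans hr.le, hr₁⟩]
        exact absurd (hmono₁.injOn hθ₁ pi_div_four_mem h1) hθ₁1.ne
      · exact h
    obtain ⟨L, hL, hL0, hL1⟩ := hasFDerivAt_polarMax ha ha1 hr0 hr1 hx0 hx1 0
    obtain ⟨M, hM, hM0, hM1⟩ := hasFDerivAt_polarMax ha ha1 hr0 hr1 hx0 hx1 2
    obtain ⟨hA, hB⟩ := density_polar_pos ha ha1 hr0 hr1 hx0 hx1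
    refine ⟨L, M, hL, hM, by rw [hL0]; exact hA, ?_⟩
    rw [hL0, hL1, hM0, hM1]
    set D := density a (polar r x)
    have h1 : angularPart D r x 0 * (radialPart D r x 2 / r) -
        radialPart D r x 0 / r * angularPart D r x 2 =
        -((D.re ^ 2 + D.im ^ 2) * shr r * Real.cos x / r) := by
      simp only [angularPart, radialPart, Matrix.cons_val]
      ring
    rw [h1, neg_lt_zero]
    have := shr_pos hr0 hr1
    have := (sin_cos_pos hx0.le hx1.le).2
    positivity

end Polar

/-! ### Injectivity, bounds, and separation of the two pieces at the fold -/

section Bounds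

variable {a : ℝ}

/-! ### Bounds and injectivity for the maximal piece -/

theorem height_mem_Icc (ha : 0 < a) (ha1 : a < 1) {z : ℂ} (hz : z ∈ closedSector) :
    fMax a z 0 ∈ Set.Icc 0 (gamma a (π / 4) 0) := by
  obtain ⟨r, θ, hr0, hr1, h0, h1, rfl⟩ := exists_polar hz
  change polarMax a 0 (θ, r) ∈ _
  rw [← polarMax_circle ha ha1 pi_div_four_mem]
  have htop := monotoneOn_height_radial ha ha1 pi_div_four_mem ⟨hr0, hr1⟩
    (Set.right_mem_Icc.2 zero_le_one) hr1
  have haxis := (polarMax_axis ha ha1 ⟨hr0, hr1⟩).1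
  rcases hr0.lt_or_eq with hr | rfl
  · have hm := (strictMonoOn_height ha ha1 hr hr1).monotoneOn
    have hl := hm ⟨le_rfl, pi_div_four_mem.1⟩ ⟨h0, h1⟩ h0
    have hu := hm ⟨h0, h1⟩ pi_div_four_mem h1
    simp only at hl hu htop
    exact ⟨by linarith, by linarith⟩
  · rw [polarMax_zero_right] at haxis ⊢
    simp only [polarMax_zero_right] at htop
    exact ⟨haxis.ge, htop⟩

/-- `x₁` vanishes on the axis and decreases in `θ`, with derivative `-(A chr cos θ + B shr sin θ)`.
-/
theorem fMax_one_nonpos (ha : 0 < a) (ha1 : a < 1) {z : ℂ} (hz : z ∈ closedSector) :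
    fMax a z 1 ≤ 0 := by
  obtain ⟨r, θ, hr0, hr1, h0, h1, rfl⟩ := exists_polar hz
  change polarMax a 1 (θ, r) ≤ 0
  have haxis := (polarMax_axis ha ha1 ⟨hr0, hr1⟩).2
  rcases hr0.lt_or_eq with hr | rfl
  · have hm := monotoneOn_of_hasDerivAt_nonneg (f := fun θ => -polarMax a 1 (θ, r))
      (f' := fun θ => -angularPart (density a (polar r θ)) r θ 1)
      (continuousOn_polarMax_left ha ha1 1 ⟨hr0, hr1⟩).neg (fun θ hθ =>
        ⟨(hasDerivAt_polarMax_angular ha ha1 hr hr1 hθ.1 hθ.2 1).neg, by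
          obtain ⟨hA, hB⟩ := density_polar_re_pos ha ha1 hr hr1 hθ.1 hθ.2
          obtain ⟨hs, hc⟩ := sin_cos_pos hθ.1.le hθ.2.le
          have hsh := shr_nonneg hr hr1
          have hch := chr_pos hr
          simp only [angularPart, Matrix.cons_val, neg_neg]
          positivity⟩)
    have := hm ⟨le_rfl, pi_div_four_mem.1⟩ ⟨h0, h1⟩ h0
    simp only [haxis] at this
    linarith
  · rw [polarMax_zero_right] at haxis ⊢
    exact haxis.le

theorem antitoneOn_gamma_sum (ha : 0 < a) (ha1 : a < 1) :
    AntitoneOn (fun s => gamma a s 1 + gamma a s 2) (Set.Icc 0 (π / 4)) := by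
  have hd : ∀ s, HasDerivAt (fun s => gamma a s 1 + gamma a s 2)
      (gammaDeriv a s 1 + gammaDeriv a s 2) s := fun s =>
    (hasDerivAt_gamma_apply ha ha1 s 1).add (hasDerivAt_gamma_apply ha ha1 s 2)
  refine antitoneOn_of_deriv_nonpos (convex_Icc _ _)
    (fun s _ => (hd s).continuousAt.continuousWithinAt)
    (fun s _ => (hd s).differentiableAt.differentiableWithinAt) fun s hs => ?_
  rw [interior_Icc] at hs
  rw [(hd s).deriv]
  obtain ⟨h1, h2⟩ := sin_cos_pos hs.1.le hs.2.le
  have := xi_pos ha ha1 s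
  simp only [gammaDeriv, Matrix.cons_val]
  nlinarith [mul_nonneg this.le h1, mul_pos this h2]

/-- `x₁ + x₂` decreases outward along rays and then along the fold, so its minimum is at the end `θ
= π/4` of the fold. -/
theorem sum_ge (ha : 0 < a) (ha1 : a < 1) {z : ℂ} (hz : z ∈ closedSector) :
    gamma a (π / 4) 1 + gamma a (π / 4) 2 ≤ fMax a z 1 + fMax a z 2 := by
  obtain ⟨r, θ, hr0, hr1, h0, h1, rfl⟩ := exists_polar hz
  have h2 := antitoneOn_sum_radial ha ha1 ⟨h0, h1⟩ ⟨hr0, hr1⟩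
    (Set.right_mem_Icc.2 zero_le_one) hr1
  have h3 := antitoneOn_gamma_sum ha ha1 ⟨h0, h1⟩ pi_div_four_mem h1
  simp only [polarMax_circle ha ha1 ⟨h0, h1⟩] at h2
  exact h3.trans h2

theorem diff_diag_le (ha : 0 < a) (ha1 : a < 1) {r : ℝ} (hr : r ∈ Set.Icc (0 : ℝ) 1) :
    polarMax a 2 (π / 4, r) - polarMax a 1 (π / 4, r) ≤ fMax a 0 2 - fMax a 0 1 := by
  rcases le_total r a with h | h
  · exact (diff_diag_inner ha ha1 ⟨hr.1, h⟩).le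
  · rw [← diff_diag_inner ha ha1 ⟨ha.le, le_rfl⟩]
    have h2 := (strictAntiOn_diag_outer ha ha1).antitoneOn ⟨le_rfl, ha1.le⟩ ⟨h, hr.2⟩ h
    have h3 := sum_diag_outer ha ha1 ⟨h, hr.2⟩
    have h4 := sum_diag_outer ha ha1 ⟨le_rfl, ha1.le⟩
    linarith

/-- `x₂ - x₁` increases in `θ`, with derivative `B shr (sin θ + cos θ) + A chr (cos θ - sin θ)`. On
the diagonal it is constant up to radius `a` and decreases beyond. -/
theorem diff_le (ha : 0 < a) (ha1 : a < 1) {z : ℂ} (hz : z ∈ closedSector) :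
    fMax a z 2 - fMax a z 1 ≤ fMax a 0 2 - fMax a 0 1 := by
  obtain ⟨r, θ, hr0, hr1, h0, h1, rfl⟩ := exists_polar hz
  refine le_trans ?_ (diff_diag_le ha ha1 ⟨hr0, hr1⟩)
  change polarMax a 2 (θ, r) - polarMax a 1 (θ, r) ≤ _
  rcases hr0.lt_or_eq with hr | rfl
  · exact monotoneOn_of_hasDerivAt_nonneg
      (f := fun θ => polarMax a 2 (θ, r) - polarMax a 1 (θ, r))
      (f' := fun θ => angularPart (density a (polar r θ)) r θ 2 -
        angularPart (density a (polar r θ)) r θ 1)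
      ((continuousOn_polarMax_left ha ha1 2 ⟨hr0, hr1⟩).sub
        (continuousOn_polarMax_left ha ha1 1 ⟨hr0, hr1⟩)) (fun θ hθ =>
        ⟨(hasDerivAt_polarMax_angular ha ha1 hr hr1 hθ.1 hθ.2 2).sub
          (hasDerivAt_polarMax_angular ha ha1 hr hr1 hθ.1 hθ.2 1), by
          obtain ⟨hA, hB⟩ := density_polar_re_pos ha ha1 hr hr1 hθ.1 hθ.2
          obtain ⟨hs, hc⟩ := sin_cos_pos hθ.1.le hθ.2.le
          have hsc := sin_lt_cos_of_lt_pi_div_four hθ.1.le hθ.2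
          have hsh := shr_nonneg hr hr1
          have hch := chr_pos hr
          simp only [angularPart, Matrix.cons_val]
          have e1 := mul_nonneg (mul_nonneg hB hsh) (add_nonneg hs hc.le)
          have e2 := mul_pos (mul_pos hA hch) (sub_pos.2 hsc)
          nlinarith⟩) ⟨h0, h1⟩ pi_div_four_mem h1
  · simp only [polarMax_zero_right, le_refl]

theorem fMax_zero (ha : 0 < a) (ha1 : a < 1) : fMax a 0 0 = 0 ∧ fMax a 0 1 = 0 := by
  rw [← polarMax_zero_right 0, ← polarMax_zero_right 0]
  exact polarMax_axis ha ha1 ⟨le_rfl, zero_le_one⟩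

theorem theta_eq_zero_of_height (ha : 0 < a) (ha1 : a < 1) {θ r : ℝ} (hr : r ∈ Set.Ioc (0 : ℝ) 1)
    (hθ : θ ∈ Set.Icc 0 (π / 4)) (h : polarMax a 0 (θ, r) = 0) : θ = 0 := by
  rcases hθ.1.eq_or_lt with h0 | h0
  · exact h0.symm
  · exact absurd h (height_axis_pos ha ha1 hr ⟨h0, hθ.2⟩).ne'

/-- At equal heights, different radii have different `x₂`; at equal radii the height determines `θ`.
Against the centre, height zero puts the other point on the axis, where `x₂` is strictly monotone.
-/
theorem injOn_fMax (ha : 0 < a) (ha1 : a < 1) : Set.InjOn (fMax a) closedSector := by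
  intro z₁ hz₁ z₂ hz₂ heq
  obtain ⟨r₁, θ₁, hr₁, hr₁', h₁, h₁', rfl⟩ := exists_polar hz₁
  obtain ⟨r₂, θ₂, hr₂, hr₂', h₂, h₂', rfl⟩ := exists_polar hz₂
  have hk : ∀ k, polarMax a k (θ₁, r₁) = polarMax a k (θ₂, r₂) := fun k =>
    congrArg (fun x : R31 => x k) heq
  wlog hle : r₂ ≤ r₁ generalizing r₁ r₂ θ₁ θ₂
  · exact (this r₂ θ₂ hr₂ hr₂' h₂ h₂' hz₂ r₁ θ₁ hr₁ hr₁' h₁ h₁' hz₁ heq.symm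
      (fun k => (hk k).symm) (le_of_not_ge hle)).symm
  rcases hle.lt_or_eq with hlt | rfl
  · rcases hr₂.lt_or_eq with hr | rfl
    · exact absurd (hk 2) (polarMax_two_lt ha ha1 hr hlt hr₁' ⟨h₁, h₁'⟩ ⟨h₂, h₂'⟩ (hk 0)).ne
    · exfalso
      have h0 := hk 0
      rw [polarMax_zero_right, (fMax_zero ha ha1).1] at h0
      have := theta_eq_zero_of_height ha ha1 ⟨hlt, hr₁'⟩ ⟨h₁, h₁'⟩ h0
      subst this
      have h2 := strictAntiOn_axis ha ha1 ⟨le_rfl, zero_le_one⟩ ⟨hr₁, hr₁'⟩ hlt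
      have h3 := hk 2
      simp only [polarMax_zero_right] at h2 h3
      linarith
  · rcases hr₁.lt_or_eq with hr | rfl
    · rw [(strictMonoOn_height ha ha1 hr hr₁').injOn ⟨h₁, h₁'⟩ ⟨h₂, h₂'⟩ (hk 0)]
    · simp [polar]

/-- The maximal piece lies above the fold curve, in the direction of the last coordinate. -/
theorem fold_le_max (ha : 0 < a) (ha1 : a < 1) {z : ℂ} (hz : z ∈ closedSector) {s : ℝ}
    (hs : s ∈ Set.Icc 0 (π / 4)) (h : fMax a z 0 = gamma a s 0) :
    z = polar 1 s ∨ gamma a s 2 < fMax a z 2 := by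
  obtain ⟨r, θ, hr0, hr1, h0, h1, rfl⟩ := exists_polar hz
  have h' : polarMax a 0 (s, 1) = polarMax a 0 (θ, r) := by
    rw [polarMax_circle ha ha1 hs]
    exact h.symm
  rw [← polarMax_circle ha ha1 hs]
  rcases hr1.lt_or_eq with hlt | rfl
  · right
    rcases hr0.lt_or_eq with hr | rfl
    · exact polarMax_two_lt ha ha1 hr hlt le_rfl hs ⟨h0, h1⟩ h'
    · rw [polarMax_zero_right, (fMax_zero ha ha1).1] at h'
      have := theta_eq_zero_of_height ha ha1 ⟨one_pos, le_rfl⟩ hs h'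
      subst this
      have h2 := strictAntiOn_axis ha ha1 ⟨le_rfl, zero_le_one⟩ ⟨zero_le_one, le_rfl⟩ one_pos
      simpa [polarMax_zero_right, polar] using h2
  · left
    rw [(strictMonoOn_height ha ha1 one_pos le_rfl).injOn hs ⟨h0, h1⟩ h']

theorem strictMono_gamma_height (ha : 0 < a) (ha1 : a < 1) : StrictMono fun s => gamma a s 0 :=
  strictMono_of_deriv_pos fun s => by
    rw [(hasDerivAt_gamma_apply ha ha1 s 0).deriv]
    exact xi_pos ha ha1 s

theorem continuous_gamma_apply (ha : 0 < a) (ha1 : a < 1) (k : Fin 3) :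
    Continuous fun s => gamma a s k :=
  continuous_iff_continuousAt.2 fun s => (hasDerivAt_gamma_apply ha ha1 s k).continuousAt

theorem exists_fold_height (ha : 0 < a) (ha1 : a < 1) {k : ℝ}
    (hk : k ∈ Set.Icc 0 (gamma a (π / 4) 0)) : ∃ s ∈ Set.Icc 0 (π / 4), gamma a s 0 = k := by
  refine intermediate_value_Icc pi_div_four_mem.1 (continuous_gamma_apply ha ha1 0).continuousOn ?_
  rwa [gamma_zero]

/-! ### The timelike piece -/

theorem fMin_apply (a : ℝ) (p : ℝ × ℝ) (k : Fin 3) :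
    fMin a p k = (gamma a (p.1 + p.2) k + gamma a (p.1 - p.2) k) / 2 := by
  simp [fMin]
  ring

theorem fMin_zero_right (a u : ℝ) : fMin a (u, 0) = gamma a u := by
  ext k
  rw [fMin_apply]
  simp

theorem hasFDerivAt_fMin_apply (ha : 0 < a) (ha1 : a < 1) (p : ℝ × ℝ) (k : Fin 3) :
    HasFDerivAt (fun p => fMin a p k)
      ((gammaDeriv a (p.1 + p.2) k / 2) • (ContinuousLinearMap.fst ℝ ℝ ℝ +
          ContinuousLinearMap.snd ℝ ℝ ℝ) +
        (gammaDeriv a (p.1 - p.2) k / 2) • (ContinuousLinearMap.fst ℝ ℝ ℝ -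
          ContinuousLinearMap.snd ℝ ℝ ℝ)) p := by
  have h1 := (hasDerivAt_gamma_apply ha ha1 (p.1 + p.2) k).comp_hasFDerivAt_of_eq p
    ((ContinuousLinearMap.fst ℝ ℝ ℝ).hasFDerivAt.add
      (ContinuousLinearMap.snd ℝ ℝ ℝ).hasFDerivAt) rfl
  have h2 := (hasDerivAt_gamma_apply ha ha1 (p.1 - p.2) k).comp_hasFDerivAt_of_eq p
    ((ContinuousLinearMap.fst ℝ ℝ ℝ).hasFDerivAt.sub
      (ContinuousLinearMap.snd ℝ ℝ ℝ).hasFDerivAt) rfl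
  have h3 := ((h1.add h2).const_mul (2⁻¹ : ℝ))
  have h4 : (fun p => fMin a p k) = fun p : ℝ × ℝ =>
      2⁻¹ * (gamma a (p.1 + p.2) k + gamma a (p.1 - p.2) k) := by
    funext p
    rw [fMin_apply]
    ring
  rw [h4]
  refine h3.congr_fderiv ?_
  ext <;> simp <;> ring

theorem continuous_fMin_apply (ha : 0 < a) (ha1 : a < 1) (k : Fin 3) :
    Continuous fun p => fMin a p k :=
  continuous_iff_continuousAt.2 fun p => (hasFDerivAt_fMin_apply ha ha1 p k).continuousAt

theorem continuous_fMin (ha : 0 < a) (ha1 : a < 1) : Continuous (fMin a) :=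
  (PiLp.continuous_toLp 2 _).comp (continuous_pi fun k => continuous_fMin_apply ha ha1 k)

theorem hasDerivAt_fMin_left (ha : 0 < a) (ha1 : a < 1) (u v : ℝ) (k : Fin 3) :
    HasDerivAt (fun u => fMin a (u, v) k)
      ((gammaDeriv a (u + v) k + gammaDeriv a (u - v) k) / 2) u := by
  have h := (hasFDerivAt_fMin_apply ha ha1 (u, v) k).comp_hasDerivAt_of_eq u
    ((hasDerivAt_id u).prodMk (hasDerivAt_const u v)) rfl
  refine h.congr_deriv ?_
  simp
  ring

theorem hasDerivAt_fMin_right (ha : 0 < a) (ha1 : a < 1) (u v : ℝ) (k : Fin 3) :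
    HasDerivAt (fun v => fMin a (u, v) k)
      ((gammaDeriv a (u + v) k - gammaDeriv a (u - v) k) / 2) v := by
  have h := (hasFDerivAt_fMin_apply ha ha1 (u, v) k).comp_hasDerivAt_of_eq v
    ((hasDerivAt_const v u).prodMk (hasDerivAt_id v)) rfl
  refine h.congr_deriv ?_
  simp
  ring

theorem eq_of_forall_hasDerivAt_zero {f : ℝ → ℝ} (h : ∀ x, HasDerivAt f 0 x) (x y : ℝ) :
    f x = f y :=
  is_const_of_deriv_eq_zero (fun x => (h x).differentiableAt) (fun x => (h x).deriv) x y

theorem xi_neg (t : ℝ) : xi a (-t) = xi a t := by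
  rw [xi, xi, mul_neg, Real.cos_neg]

theorem xi_add_pi_div_two (t : ℝ) : xi a (t + π / 2) = xi a t := by
  have : 4 * (t + π / 2) = 4 * t + 2 * π := by ring
  rw [xi, xi, this, Real.cos_add_two_pi]

theorem xi_pi_div_four_sub (t : ℝ) : xi a (π / 4 - t) = xi a (π / 4 + t) := by
  rw [← xi_neg, ← xi_add_pi_div_two]
  congr 1
  ring

/-- Each edge of the timelike piece is straight because of a symmetry of `ξ`: here evenness, on `u =
π/4` the reflection in `π/4`, on `v = π/2` the period `π/2`. -/
theorem fMin_left_edge (ha : 0 < a) (ha1 : a < 1) (v : ℝ) :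
    fMin a (0, v) 0 = 0 ∧ fMin a (0, v) 1 = 0 ∧ fMin a (0, v) 2 = gamma a v 2 := by
  have h0 : ∀ k, fMin a (0, 0) k = 0 := fun k => by rw [fMin_zero_right, gamma_zero]
  refine ⟨?_, ?_, ?_⟩
  · refine (eq_of_forall_hasDerivAt_zero (f := fun v => fMin a (0, v) 0) (fun v => ?_) v
      0).trans (h0 0)
    refine (hasDerivAt_fMin_right ha ha1 0 v 0).congr_deriv ?_
    simp [gammaDeriv, xi_neg]
  · refine (eq_of_forall_hasDerivAt_zero (f := fun v => fMin a (0, v) 1) (fun v => ?_) v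
      0).trans (h0 1)
    refine (hasDerivAt_fMin_right ha ha1 0 v 1).congr_deriv ?_
    simp [gammaDeriv, xi_neg]
  · have := eq_of_forall_hasDerivAt_zero (f := fun v => fMin a (0, v) 2 - gamma a v 2)
      (fun v => ((hasDerivAt_fMin_right ha ha1 0 v 2).sub
        (hasDerivAt_gamma_apply ha ha1 v 2)).congr_deriv (by
          simp [gammaDeriv, xi_neg]; ring)) v 0
    simp only [h0, gamma_zero] at this
    linarith

theorem fMin_right_edge (ha : 0 < a) (ha1 : a < 1) (v : ℝ) :
    fMin a (π / 4, v) 0 = gamma a (π / 4) 0 ∧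
    fMin a (π / 4, v) 1 + fMin a (π / 4, v) 2 = gamma a (π / 4) 1 + gamma a (π / 4) 2 := by
  rw [← fMin_zero_right]
  constructor
  · refine eq_of_forall_hasDerivAt_zero (f := fun v => fMin a (π / 4, v) 0) (fun v => ?_) _ _
    refine (hasDerivAt_fMin_right ha ha1 (π / 4) v 0).congr_deriv ?_
    simp [gammaDeriv, xi_pi_div_four_sub]
  · refine eq_of_forall_hasDerivAt_zero
      (f := fun v => fMin a (π / 4, v) 1 + fMin a (π / 4, v) 2) (fun v => ?_) _ _
    refine ((hasDerivAt_fMin_right ha ha1 (π / 4) v 1).add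
      (hasDerivAt_fMin_right ha ha1 (π / 4) v 2)).congr_deriv ?_
    simp [gammaDeriv, xi_pi_div_four_sub, Real.cos_add, Real.cos_sub, Real.sin_add, Real.sin_sub]
    ring

theorem fMin_bottom_edge (ha : 0 < a) (ha1 : a < 1) (u : ℝ) :
    fMin a (u, π / 2) 0 = gamma a u 0 ∧ fMin a (u, π / 2) 1 = 0 ∧
      fMin a (u, π / 2) 2 = gamma a (π / 2) 2 := by
  have hx : ∀ u, xi a (u - π / 2) = xi a u := fun u => by
    rw [← xi_add_pi_div_two (u - π / 2), sub_add_cancel]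
  obtain ⟨h0, h1, h2⟩ := fMin_left_edge ha ha1 (π / 2)
  refine ⟨?_, ?_, ?_⟩
  · have := eq_of_forall_hasDerivAt_zero (f := fun u => fMin a (u, π / 2) 0 - gamma a u 0)
      (fun u => ((hasDerivAt_fMin_left ha ha1 u (π / 2) 0).sub
        (hasDerivAt_gamma_apply ha ha1 u 0)).congr_deriv (by
          simp [gammaDeriv, hx, xi_add_pi_div_two])) u 0
    simp only [h0, gamma_zero] at this
    linarith
  · refine (eq_of_forall_hasDerivAt_zero (f := fun u => fMin a (u, π / 2) 1) (fun u => ?_) u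
      0).trans h1
    refine (hasDerivAt_fMin_left ha ha1 u (π / 2) 1).congr_deriv ?_
    simp [gammaDeriv, hx, xi_add_pi_div_two, Real.cos_add_pi_div_two, Real.cos_sub_pi_div_two]
  · refine (eq_of_forall_hasDerivAt_zero (f := fun u => fMin a (u, π / 2) 2) (fun u => ?_) u
      0).trans h2
    refine (hasDerivAt_fMin_left ha ha1 u (π / 2) 2).congr_deriv ?_
    simp [gammaDeriv, hx, xi_add_pi_div_two, Real.sin_add_pi_div_two, Real.sin_sub_pi_div_two]

/-- The edges `u = π/4` and `v = π/2` share a corner, and `x₁ + x₂` there can be read off from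
either. -/
theorem gamma_sum_corner (ha : 0 < a) (ha1 : a < 1) :
    gamma a (π / 4) 1 + gamma a (π / 4) 2 = gamma a (π / 2) 2 := by
  rw [← (fMin_right_edge ha ha1 (π / 2)).2, (fMin_bottom_edge ha ha1 _).2.1,
    (fMin_bottom_edge ha ha1 _).2.2, zero_add]

theorem strictMono_fMin_height (ha : 0 < a) (ha1 : a < 1) (v : ℝ) :
    StrictMono fun u => fMin a (u, v) 0 :=
  strictMono_of_deriv_pos fun u => by
    rw [(hasDerivAt_fMin_left ha ha1 u v 0).deriv]
    have h1 := xi_pos ha ha1 (u + v)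
    have h2 := xi_pos ha ha1 (u - v)
    simp only [gammaDeriv, Matrix.cons_val]
    linarith

/-- The closed parameter rectangle of the timelike piece. -/
def closedRectangle : Set (ℝ × ℝ) := Set.Icc 0 (π / 4) ×ˢ Set.Icc 0 (π / 2)

theorem fMin_height_mem_Icc (ha : 0 < a) (ha1 : a < 1) {u : ℝ} (hu : u ∈ Set.Icc 0 (π / 4))
    (v : ℝ) : fMin a (u, v) 0 ∈ Set.Icc 0 (gamma a (π / 4) 0) := by
  have h := (strictMono_fMin_height ha ha1 v).monotone
  have h1 := h hu.1
  have h2 := h hu.2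
  simp only [(fMin_left_edge ha ha1 v).1, (fMin_right_edge ha ha1 v).1] at h1 h2
  exact ⟨h1, h2⟩

/-- The Jacobian of the height and of a combination of the horizontal coordinates. -/
theorem fMin_jacobian (ha : 0 < a) (ha1 : a < 1) (c d u v : ℝ) : ∃ L M : ℝ × ℝ →L[ℝ] ℝ,
    HasFDerivAt (fun p => fMin a p 0) L (u, v) ∧
    HasFDerivAt (fun p => c * fMin a p 1 + d * fMin a p 2) M (u, v) ∧ 0 < L (1, 0) ∧
    L (1, 0) * M (0, 1) - L (0, 1) * M (1, 0) =
      xi a (u + v) * xi a (u - v) * Real.sin v * (c * Real.sin u - d * Real.cos u) := by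
  refine ⟨_, _, hasFDerivAt_fMin_apply ha ha1 (u, v) 0,
    ((hasFDerivAt_fMin_apply ha ha1 (u, v) 1).const_mul c).add
      ((hasFDerivAt_fMin_apply ha ha1 (u, v) 2).const_mul d), ?_, ?_⟩
  · have h1 := xi_pos ha ha1 (u + v)
    have h2 := xi_pos ha ha1 (u - v)
    simp [gammaDeriv]
    linarith
  · simp [gammaDeriv, Real.cos_add, Real.cos_sub, Real.sin_add, Real.sin_sub]
    ring

/-- Along a level curve of the height, parametrized by `v`, the sign of `c sin u - d cos u` decides.
The pairs `(c, d)` used below are `(-1, 1)`, `(-1, 0)` and `(1, 1)`, one for each side of the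
triangle. -/
theorem fMin_le_of_height_eq (ha : 0 < a) (ha1 : a < 1) {c d u₁ u₂ v₁ v₂ : ℝ}
    (hcd : ∀ u ∈ Set.Icc 0 (π / 4), c * Real.sin u ≤ d * Real.cos u) (hv₁ : 0 ≤ v₁)
    (hv : v₁ < v₂) (hv₂ : v₂ ≤ π / 2) (hu₁ : u₁ ∈ Set.Icc 0 (π / 4))
    (hu₂ : u₂ ∈ Set.Icc 0 (π / 4)) (heq : fMin a (u₁, v₁) 0 = fMin a (u₂, v₂) 0) :
    c * fMin a (u₂, v₂) 1 + d * fMin a (u₂, v₂) 2 ≤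
      c * fMin a (u₁, v₁) 1 + d * fMin a (u₁, v₁) 2 := by
  have hcont := fun k => continuous_fMin_apply ha ha1 k
  refine le_of_level (g := fun p => fMin a p 0) (h := fun p => c * fMin a p 1 + d * fMin a p 2)
    hv (hcont 0).continuousOn (((hcont 1).const_mul c).add ((hcont 2).const_mul d)).continuousOn
    (fun v _ => (strictMono_fMin_height ha ha1 v).strictMonoOn _)
    (fun v _ => (fMin_left_edge ha ha1 v).1.trans_le (fMin_height_mem_Icc ha ha1 hu₁ v₁).1)
    (fun v _ => (fMin_height_mem_Icc ha ha1 hu₁ v₁).2.trans_eq (fMin_right_edge ha ha1 v).1.symm)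
    hu₁ hu₂ rfl heq.symm fun v hvv u hu _ => ?_
  obtain ⟨L, M, hL, hM, hL0, hdet⟩ := fMin_jacobian ha ha1 c d u v
  refine ⟨L, M, hL, hM, hL0, ?_⟩
  rw [hdet]
  have h1 := xi_pos ha ha1 (u + v)
  have h2 := xi_pos ha ha1 (u - v)
  have h3 : 0 ≤ Real.sin v := Real.sin_nonneg_of_nonneg_of_le_pi (by linarith [hvv.1])
    (by linarith [hvv.2, Real.pi_pos])
  exact mul_nonpos_of_nonneg_of_nonpos (by positivity) (sub_nonpos.2 (hcd u hu))

theorem fMin_two_lt (ha : 0 < a) (ha1 : a < 1) {u₁ u₂ v₁ v₂ : ℝ} (hv₁ : 0 ≤ v₁)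
    (hv : v₁ < v₂) (hv₂ : v₂ ≤ π / 2) (hu₁ : u₁ ∈ Set.Icc 0 (π / 4))
    (hu₂ : u₂ ∈ Set.Icc 0 (π / 4)) (heq : fMin a (u₁, v₁) 0 = fMin a (u₂, v₂) 0) :
    fMin a (u₂, v₂) 2 < fMin a (u₁, v₁) 2 := by
  have hcont := fun k => continuous_fMin_apply ha ha1 k
  have := lt_of_level (g := fun p => fMin a p 0) (h := fun p => 0 * fMin a p 1 + 1 * fMin a p 2)
    hv (hcont 0).continuousOn (((hcont 1).const_mul 0).add ((hcont 2).const_mul 1)).continuousOn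
    (fun v _ => (strictMono_fMin_height ha ha1 v).strictMonoOn _)
    (fun v _ => (fMin_left_edge ha ha1 v).1.trans_le (fMin_height_mem_Icc ha ha1 hu₁ v₁).1)
    (fun v _ => (fMin_height_mem_Icc ha ha1 hu₁ v₁).2.trans_eq (fMin_right_edge ha ha1 v).1.symm)
    hu₁ hu₂ rfl heq.symm fun v hvv u hu _ => ?_
  · simpa using this
  obtain ⟨L, M, hL, hM, hL0, hdet⟩ := fMin_jacobian ha ha1 0 1 u v
  refine ⟨L, M, hL, hM, hL0, ?_⟩
  rw [hdet]
  have h1 := xi_pos ha ha1 (u + v)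
  have h2 := xi_pos ha ha1 (u - v)
  have h3 : 0 < Real.sin v := Real.sin_pos_of_pos_of_lt_pi (by linarith [hvv.1])
    (by linarith [hvv.2, Real.pi_pos])
  have h4 := (sin_cos_pos hu.1 hu.2).2
  exact mul_neg_of_pos_of_neg (by positivity) (by linarith)

theorem injOn_fMin (ha : 0 < a) (ha1 : a < 1) : Set.InjOn (fMin a) closedRectangle := by
  rintro ⟨u₁, v₁⟩ h₁ ⟨u₂, v₂⟩ h₂ heq
  have hk : ∀ k, fMin a (u₁, v₁) k = fMin a (u₂, v₂) k := fun k =>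
    congrArg (fun x : R31 => x k) heq
  rcases lt_trichotomy v₁ v₂ with h | rfl | h
  · exact absurd (hk 2) (fMin_two_lt ha ha1 h₁.2.1 h h₂.2.2 h₁.1 h₂.1 (hk 0)).ne'
  · rw [(strictMono_fMin_height ha ha1 v₁).injective (hk 0)]
  · exact absurd (hk 2) (fMin_two_lt ha ha1 h₂.2.1 h h₁.2.2 h₂.1 h₁.1 (hk 0).symm).ne

/-- The timelike piece lies below the fold curve, in the direction of the last coordinate. -/
theorem min_le_fold (ha : 0 < a) (ha1 : a < 1) {p : ℝ × ℝ} (hp : p ∈ closedRectangle) {s : ℝ}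
    (hs : s ∈ Set.Icc 0 (π / 4)) (h : fMin a p 0 = gamma a s 0) :
    p = (s, 0) ∨ fMin a p 2 < gamma a s 2 := by
  obtain ⟨u, v⟩ := p
  rw [← fMin_zero_right] at h ⊢
  rcases hp.2.1.eq_or_lt with h0 | h0
  · left
    simp only at h0
    subst h0
    rw [(strictMono_fMin_height ha ha1 0).injective h]
  · right
    exact fMin_two_lt ha ha1 le_rfl h0 hp.2.2 hs hp.1 h.symm

/-- The two pieces meet along the fold curve only. -/
theorem fMax_eq_fMin (ha : 0 < a) (ha1 : a < 1) {z : ℂ} (hz : z ∈ closedSector) {p : ℝ × ℝ}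
    (hp : p ∈ closedRectangle) (h : fMax a z = fMin a p) :
    ∃ s ∈ Set.Icc 0 (π / 4), z = polar 1 s ∧ p = (s, 0) := by
  obtain ⟨s, hs, hsk⟩ := exists_fold_height ha ha1 (height_mem_Icc ha ha1 hz)
  refine ⟨s, hs, ?_⟩
  have h2 : fMin a p 0 = gamma a s 0 := by rw [← h, hsk]
  have h3 : fMax a z 2 = fMin a p 2 := by rw [h]
  rcases fold_le_max ha ha1 hz hs hsk.symm with hz' | hlt
  · rcases min_le_fold ha ha1 hp hs h2 with hp' | hlt'
    · exact ⟨hz', hp'⟩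
    · rw [← h3, hz', fMax_circle ha ha1 hs] at hlt'
      exact absurd hlt' (lt_irrefl _)
  · rcases min_le_fold ha ha1 hp hs h2 with hp' | hlt'
    · rw [h3, hp', fMin_zero_right] at hlt
      exact absurd hlt (lt_irrefl _)
    · linarith

/-- Move along a level curve of the height. `x₂ - x₁` is compared with the fold `v = 0`, where the
bound of the maximal piece applies; `x₁` and `x₁ + x₂` are compared with the vertical edge `v =
π/2`, where they are constant. -/
theorem fMin_bounds (ha : 0 < a) (ha1 : a < 1) {p : ℝ × ℝ} (hp : p ∈ closedRectangle) :
    fMin a p 1 ≤ 0 ∧ gamma a (π / 4) 1 + gamma a (π / 4) 2 ≤ fMin a p 1 + fMin a p 2 ∧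
      fMin a p 2 - fMin a p 1 ≤ fMax a 0 2 - fMax a 0 1 := by
  obtain ⟨u, v⟩ := p
  obtain ⟨hu, hv0, hv1⟩ := hp
  simp only at hu hv0 hv1
  obtain ⟨s, hs, hsk⟩ := exists_fold_height ha ha1 (fMin_height_mem_Icc ha ha1 hu v)
  obtain ⟨b0, b1, b2⟩ := fMin_bottom_edge ha ha1 s
  have hfold : fMin a (u, v) 2 - fMin a (u, v) 1 ≤ fMax a 0 2 - fMax a 0 1 := by
    have hpol := diff_le ha ha1 (polar_mem_closedSector zero_le_one le_rfl hs.1 hs.2)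
    rw [fMax_circle ha ha1 hs] at hpol
    rcases hv0.eq_or_lt with rfl | h
    · have := (strictMono_gamma_height ha ha1).injective (hsk.trans (by rw [fMin_zero_right]))
      rw [fMin_zero_right, ← this]
      exact hpol
    · have := fMin_le_of_height_eq ha ha1 (c := -1) (d := 1) (u₁ := s) (u₂ := u) (v₁ := 0)
        (v₂ := v) (fun u hu => by
          obtain ⟨h1, h2⟩ := sin_cos_pos hu.1 hu.2
          linarith) le_rfl h hv1 hs hu (by rw [fMin_zero_right, hsk])
      rw [fMin_zero_right] at this
      linarith
  refine ⟨?_, ?_, hfold⟩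
  · rcases hv1.eq_or_lt with rfl | h
    · exact (fMin_bottom_edge ha ha1 u).2.1.le
    · have := fMin_le_of_height_eq ha ha1 (c := -1) (d := 0) (u₁ := u) (u₂ := s) (v₁ := v)
        (v₂ := π / 2) (fun u hu => by
          obtain ⟨h1, h2⟩ := sin_cos_pos hu.1 hu.2
          linarith) hv0 h le_rfl hu hs (by rw [b0, hsk])
      linarith
  · rw [gamma_sum_corner ha ha1]
    rcases hv1.eq_or_lt with rfl | h
    · rw [(fMin_bottom_edge ha ha1 u).2.1, (fMin_bottom_edge ha ha1 u).2.2, zero_add]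
    · have := fMin_le_of_height_eq ha ha1 (c := 1) (d := 1) (u₁ := u) (u₂ := s) (v₁ := v)
        (v₂ := π / 2) (fun u hu => by
          have := sin_le_cos_of_le_pi_div_four hu.1 hu.2
          linarith) hv0 h le_rfl hu hs (by rw [b0, hsk])
      linarith

end Bounds

/-! ### Immersion of the two pieces -/

section Immersion

variable {a : ℝ}

/-! ### Derivatives of maps into space from their components -/

/-- The linear map into space with given coordinates. -/
def ofCoords {E : Type*} [NormedAddCommGroup E] [NormedSpace ℝ E] (L : Fin 3 → E →L[ℝ] ℝ) :
    E →L[ℝ] R31 :=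
  (PiLp.continuousLinearEquiv 2 ℝ fun _ : Fin 3 => ℝ).symm.toContinuousLinearMap ∘L
    ContinuousLinearMap.pi L

theorem ofCoords_apply {E : Type*} [NormedAddCommGroup E] [NormedSpace ℝ E]
    (L : Fin 3 → E →L[ℝ] ℝ) (x : E) (k : Fin 3) : ofCoords L x k = L k x := rfl

theorem hasFDerivWithinAt_ofCoords {E : Type*} [NormedAddCommGroup E] [NormedSpace ℝ E]
    {f : E → R31} {L : Fin 3 → E →L[ℝ] ℝ} {s : Set E} {x : E}
    (h : ∀ k, HasFDerivWithinAt (fun y => f y k) (L k) s x) :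
    HasFDerivWithinAt f (ofCoords L) s x :=
  hasFDerivWithinAt_euclidean.2 h

theorem hasFDerivAt_ofCoords {E : Type*} [NormedAddCommGroup E] [NormedSpace ℝ E]
    {f : E → R31} {L : Fin 3 → E →L[ℝ] ℝ} {x : E}
    (h : ∀ k, HasFDerivAt (fun y => f y k) (L k) x) : HasFDerivAt f (ofCoords L) x :=
  hasFDerivWithinAt_univ.1 (hasFDerivWithinAt_ofCoords fun k => (h k).hasFDerivWithinAt)

/-! ### The timelike piece -/

/-- In null directions the derivative is spanned by `(1, -cos, -sin)` at the angles `u + v` and `u -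
v`. These vectors are independent because `sin v > 0`. -/
theorem isImmersedMin (ha : 0 < a) (ha1 : a < 1) : IsImmersedMin a := by
  rintro ⟨u, v⟩ hp
  refine ⟨_, ?_, hasFDerivAt_ofCoords fun k => hasFDerivAt_fMin_apply ha ha1 (u, v) k⟩
  refine (injective_iff_map_eq_zero _).2 ?_
  rintro ⟨x, y⟩ h
  have hk := fun k => congrArg (fun x : R31 => x k) h
  have h0 := hk 0
  have h1 := hk 1
  have h2 := hk 2
  simp only [ofCoords_apply, gammaDeriv] at h0 h1 h2
  simp at h0 h1 h2
  have hp1 := xi_pos ha ha1 (u + v)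
  have hp2 := xi_pos ha ha1 (u - v)
  set α := xi a (u + v) * (x + y) with hα
  set β := xi a (u - v) * (x - y) with hβ
  have e0 : β = -α := by linarith
  have e1 : α * (Real.cos (u + v) - Real.cos (u - v)) = 0 := by
    have : α * Real.cos (u + v) + β * Real.cos (u - v) = 0 := by rw [hα, hβ]; linarith
    rw [e0] at this
    linarith
  have e2 : α * (Real.sin (u + v) - Real.sin (u - v)) = 0 := by
    have : α * Real.sin (u + v) + β * Real.sin (u - v) = 0 := by rw [hα, hβ]; linarith
    rw [e0] at this
    linarith
  have hs : 0 < Real.sin v := Real.sin_pos_of_pos_of_lt_pi hp.2.1 (by linarith [hp.2.2, Real.pi_pos])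
  have hα0 : α = 0 := by
    rw [Real.cos_add, Real.cos_sub] at e1
    rw [Real.sin_add, Real.sin_sub] at e2
    have : 2 * Real.sin v * α = 0 := by
      linear_combination (-Real.sin u) * e1 + Real.cos u * e2 -
        2 * α * Real.sin v * Real.sin_sq_add_cos_sq u
    rcases mul_eq_zero.1 this with h | h
    · linarith
    · exact h
  have hβ0 : β = 0 := by rw [e0, hα0, neg_zero]
  have i1 : x + y = 0 := (mul_eq_zero.1 (hα.symm.trans hα0)).resolve_left hp1.ne'
  have i2 : x - y = 0 := (mul_eq_zero.1 (hβ.symm.trans hβ0)).resolve_left hp2.ne'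
  simp only [Prod.mk_eq_zero]
  constructor <;> linarith

/-! ### The maximal piece -/

/-- The real linear form `w ↦ Re (c w)`. -/
def reMul (c : ℂ) : ℂ →L[ℝ] ℝ := Complex.reCLM ∘L (c • (1 : ℂ →L[ℝ] ℂ))

theorem reMul_apply (c w : ℂ) : reMul c w = (c * w).re := rfl

theorem hasFDerivAt_re {h : ℂ → ℂ} {c z : ℂ} (hd : HasDerivAt h c z) :
    HasFDerivAt (fun z => (h z).re) (reMul c) z :=
  Complex.reCLM.hasFDerivAt.comp z hd.complexToReal_fderiv

/-- The two horizontal coordinates alone give `z² η = -conj η`, and comparing norms leaves `η = 0`.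
The argument breaks down exactly at `|z| = 1`. -/
theorem eq_zero_of_re_weierstrassVec {z η : ℂ} (hz : ‖z‖ < 1)
    (h : ∀ k, (weierstrassVec z k * η).re = 0) : η = 0 := by
  have h1 : η.re = -(z ^ 2 * η).re := by
    have := h 1
    simp only [weierstrassVec, Matrix.cons_val, add_mul, Complex.add_re, one_mul] at this
    linarith
  have h2 : η.im = (z ^ 2 * η).im := by
    have := h 2
    simp only [weierstrassVec, Matrix.cons_val, mul_assoc, Complex.I_mul_re, sub_mul,
      Complex.sub_im, one_mul] at this
    linarith
  have h3 : z ^ 2 * η = -(starRingEnd ℂ) η := by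
    apply Complex.ext
    · rw [Complex.neg_re, Complex.conj_re]; linarith
    · rw [Complex.neg_im, Complex.conj_im]; linarith
  have h4 : ‖z‖ ^ 2 * ‖η‖ = ‖η‖ := by
    rw [← norm_pow, ← norm_mul, h3, norm_neg, RCLike.norm_conj]
  have h5 : (1 - ‖z‖ ^ 2) * ‖η‖ = 0 := by linarith
  have h6 : ‖z‖ ^ 2 < 1 := by nlinarith [norm_nonneg z]
  exact norm_eq_zero.1 ((mul_eq_zero.1 h5).resolve_left (by linarith))

theorem injective_reMul_weierstrassVec {z q : ℂ} (hz : ‖z‖ < 1) (hq : q ≠ 0) :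
    Function.Injective (ofCoords fun k => reMul (weierstrassVec z k * q)) := by
  refine (injective_iff_map_eq_zero _).2 fun w hw => ?_
  have : q * w = 0 := eq_zero_of_re_weierstrassVec hz fun k => by
    rw [← mul_assoc]
    exact congrArg (fun x : R31 => x k) hw
  exact (mul_eq_zero.1 this).resolve_left hq

theorem isLittleO_of_forall_apply {α F : Type*} [NormedAddCommGroup F] {f : α → R31} {g : α → F}
    {l : Filter α} (h : ∀ k, (fun x => f x k) =o[l] g) : f =o[l] g :=
  ((PiLp.continuousLinearEquiv 2 ℝ fun _ : Fin 3 => ℝ).symm.toContinuousLinearMap.isBigO_comp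
    (fun x k => f x k) l).trans_isLittleO (Asymptotics.isLittleO_pi.2 h)

theorem tendsto_rootCoord (ha : 0 < a) :
    Filter.Tendsto (rootCoord a) (nhds (branchPoint a)) (nhds 0) :=
  Metric.tendsto_nhds.2 fun _ hε => (branchPoint_mem_ball_of_near ha hε).mono fun _ h => h.1

theorem isLittleO_fMax_branchPoint (ha : 0 < a) (ha1 : a < 1) (k : Fin 3) :
    (fun z => fMax a z k - fMax a (branchPoint a) k - (rootData a k 0 * rootCoord a z).re)
      =o[nhdsWithin (branchPoint a) sector] rootCoord a := by
  obtain ⟨ε, hε, H, hH, hHs⟩ := exists_rootPrimitive ha ha1 k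
  have h0 : (0 : ℂ) ∈ Metric.ball (0 : ℂ) ε := Metric.mem_ball_self hε
  have hd := (hasDerivAt_iff_isLittleO.1 (hH 0 h0)).comp_tendsto
    ((tendsto_rootCoord ha).mono_left (nhdsWithin_le_nhds (s := sector)))
  have hb : holCurve a k (branchPoint a) = H 0 := by
    rw [← ofRootCoord_zero]
    exact (hHs 0 h0 le_rfl le_rfl).2
  refine (Asymptotics.IsLittleO.congr' (f₁ := fun z =>
    (H (rootCoord a z) - H 0 - (rootCoord a z - 0) • rootData a k 0).re) ?_ ?_
    (.of_forall fun z => sub_zero _))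
  · exact ((Complex.reCLM).isBigO_comp _ _).trans_isLittleO hd
  · filter_upwards [self_mem_nhdsWithin,
      (branchPoint_mem_ball_of_near ha hε).filter_mono nhdsWithin_le_nhds] with z hz hz2
    have hz' := sector_subset_closedSector hz
    have h3 := (hHs _ hz2.1 (rootCoord_re_nonneg a z) (rootCoord_im_nonneg hz')).2
    rw [ofRootCoord_rootCoord ha hz' hz2.2] at h3
    rw [fMax_apply hz', fMax_apply (branchPoint_mem_closedSector ha ha1), hb, h3, sub_zero,
      smul_eq_mul, mul_comm, Complex.sub_re, Complex.sub_re]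

theorem isImmersedMax (ha : 0 < a) (ha1 : a < 1) : IsImmersedMax a := by
  constructor
  · intro z hz hne
    have hz' := sector_subset_closedSector hz
    refine ⟨_, injective_reMul_weierstrassVec hz.1
      (q := Complex.I / wExt a z) ?_, hasFDerivWithinAt_ofCoords fun k => ?_⟩
    · exact div_ne_zero Complex.I_ne_zero
        (wExt_ne_zero (starExt_subset_domExt a (mem_starExt ha ha1 hz' hne)))
    · exact (hasFDerivAt_re (hasDerivAt_holCurve (mem_starExt ha ha1 hz' hne) k)
        ).hasFDerivWithinAt.congr (fun y hy => fMax_apply (sector_subset_closedSector hy) k)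
        (fMax_apply hz' k)
  · set κ : ℂ → ℂ := fun z => (z ^ 4 + ((a : ℂ)⁻¹) ^ 4) ^ (1 / 2 : ℂ) with hκ
    have hpos := add_inv_pow_four_re_pos ha ha1 (z := branchPoint a)
      (by rw [norm_branchPoint ha]; exact ha1.le)
    have hκ0 : κ (branchPoint a) ≠ 0 := by
      rw [hκ, Complex.cpow_ne_zero_iff_of_exponent_ne_zero (by norm_num)]
      intro h
      rw [h, Complex.zero_re] at hpos
      exact hpos.false
    have hκc : Filter.Tendsto κ (nhdsWithin (branchPoint a) sector) (nhds (κ (branchPoint a))) :=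
      ((continuousAt_id.pow 4).add continuousAt_const |>.cpow continuousAt_const
        (Or.inl hpos)).mono_left nhdsWithin_le_nhds
    have hb0 : branchPoint a ≠ 0 := by
      rw [← norm_ne_zero_iff, norm_branchPoint ha]; exact ha.ne'
    have hrd : ∀ k, rootData a k 0 = weierstrassVec (branchPoint a) k *
        (Complex.I / (2 * branchPoint a ^ 3 * κ (branchPoint a))) := fun k => by
      rw [rootData, ofRootCoord_zero]
    -- Since `w = κ · rootCoord` with `κ` nonzero at the branch point, the derivative in `w` is the
    -- one in `rootCoord` divided by that value. The error carries the factor `1 - κ z / κ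
    -- (branchPoint a)`, which tends to zero.
    refine ⟨_, injective_reMul_weierstrassVec (z := branchPoint a)
      (q := Complex.I / (2 * branchPoint a ^ 3 * κ (branchPoint a)) / κ (branchPoint a))
      (by rwa [norm_branchPoint ha]) ?_, ?_⟩
    · refine div_ne_zero (div_ne_zero Complex.I_ne_zero ?_) hκ0
      exact mul_ne_zero (mul_ne_zero two_ne_zero (pow_ne_zero 3 hb0)) hκ0
    · refine (isLittleO_of_forall_apply fun k => ?_).trans_isBigO
        (g := rootCoord a) ?_
      · have h2 : (fun z => (rootData a k 0 * rootCoord a z *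
            (1 - κ z / κ (branchPoint a))).re) =o[nhdsWithin (branchPoint a) sector]
            rootCoord a := by
          refine (Complex.reCLM.isBigO_comp (fun z => rootData a k 0 * rootCoord a z *
            (1 - κ z / κ (branchPoint a))) _).trans_isLittleO ?_
          have h3 : Filter.Tendsto (fun z => 1 - κ z / κ (branchPoint a))
              (nhdsWithin (branchPoint a) sector) (nhds 0) := by
            have := (hκc.div_const (κ (branchPoint a))).const_sub 1
            rwa [div_self hκ0, sub_self] at this
          have := (Asymptotics.isBigO_const_mul_self (rootData a k 0) (rootCoord a)
            (nhdsWithin (branchPoint a) sector)).mul_isLittleO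
            ((Asymptotics.isLittleO_one_iff ℂ).2 h3)
          simpa only [mul_one] using this
        refine ((isLittleO_fMax_branchPoint ha ha1 k).add h2).congr_left fun z => ?_
        have hw : wBranch a z = rootCoord a z * κ z := wBranch_eq_rootCoord a z
        simp only [PiLp.sub_apply, ofCoords_apply, reMul_apply, hrd, hw]
        rw [sub_add, ← Complex.sub_re]
        congr 2
        field_simp
        ring
      · refine Asymptotics.IsBigO.congr' (f₁ := fun z => wBranch a z * (κ z)⁻¹)
          (g₁ := fun z => wBranch a z * 1) ?_ ?_ (.of_forall fun z => mul_one _)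
        · exact (Asymptotics.isBigO_refl _ _).mul ((hκc.inv₀ hκ0).isBigO_one ℂ)
        · filter_upwards [hκc.eventually_ne hκ0] with z hz
          rw [wBranch_eq_rootCoord, mul_assoc, mul_inv_cancel₀ hz, mul_one]

end Immersion

section EvenPart

/-! ### The even part of a holomorphic function as a smooth function of the square -/

/-- On the circle `|ζ - p.1| > 3R/4`, while `|p.2| < (R/4)²`. -/
theorem evenPart_denominator_ne_zero {c R δ t : ℝ} (hR : 0 < R) (hδ : δ ≤ R / 4)
    (hδ' : δ ≤ (R / 4) ^ 2) {p : ℝ × ℝ} (hp : p ∈ Metric.ball ((c, 0) : ℝ × ℝ) δ) :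
    (circleMap c R t - p.1) ^ 2 - p.2 ≠ 0 := by
  rw [Metric.mem_ball, Prod.dist_eq, max_lt_iff, Real.dist_eq, Real.dist_eq, sub_zero] at hp
  intro h
  have h1 : ‖circleMap c R t - p.1‖ ^ 2 = |p.2| := by
    rw [← norm_pow, sub_eq_zero.1 h, Complex.norm_real, Real.norm_eq_abs]
  have h2 : R - |p.1 - c| ≤ ‖circleMap c R t - p.1‖ := by
    have h3 := norm_sub_norm_le (circleMap c R t - c) ((p.1 - c : ℝ) : ℂ)
    rw [circleMap_sub_center, norm_circleMap_zero, abs_of_pos hR, Complex.norm_real,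
      Real.norm_eq_abs, circleMap_zero] at h3
    refine h3.trans (le_of_eq ?_)
    congr 1
    rw [circleMap]
    push_cast
    ring
  nlinarith

/-- The kernel is the mean of the Cauchy kernels at `u + r` and `u - r`, and only `r²` occurs in it.
-/
theorem circleIntegral_evenPart {Γ : ℂ → ℂ} {c : ℂ} {R : ℝ} (hR : 0 < R)
    (hΓ : DifferentiableOn ℂ Γ (Metric.closedBall c R)) {u r : ℂ}
    (h1 : u + r ∈ Metric.ball c R) (h2 : u - r ∈ Metric.ball c R) :
    (2 * π * Complex.I : ℂ)⁻¹ * (∮ ζ in C(c, R), Γ ζ * ((ζ - u) / ((ζ - u) ^ 2 - r ^ 2))) =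
      (Γ (u + r) + Γ (u - r)) / 2 := by
  have hne : ∀ w ∈ Metric.ball c R, ∀ ζ ∈ Metric.sphere c R, ζ - w ≠ 0 := by
    intro w hw ζ hζ h
    rw [sub_eq_zero.1 h] at hζ
    exact (Metric.mem_ball.1 hw).ne (Metric.mem_sphere.1 hζ)
  have hint : ∀ w ∈ Metric.ball c R, CircleIntegrable (fun ζ => (ζ - w)⁻¹ • Γ ζ) c R := by
    intro w hw
    refine ContinuousOn.circleIntegrable hR.le (ContinuousOn.smul (ContinuousOn.inv₀ (by fun_prop)
      (hne w hw)) (hΓ.continuousOn.mono Metric.sphere_subset_closedBall))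
  have hcauchy : ∀ w ∈ Metric.ball c R,
      (∮ ζ in C(c, R), (ζ - w)⁻¹ • Γ ζ) = (2 * π * Complex.I : ℂ) • Γ w := fun w hw =>
    hΓ.circleIntegral_sub_inv_smul hw
  have hsum : (∮ ζ in C(c, R), Γ ζ * ((ζ - u) / ((ζ - u) ^ 2 - r ^ 2))) =
      ∮ ζ in C(c, R), (2⁻¹ : ℂ) • ((ζ - (u + r))⁻¹ • Γ ζ + (ζ - (u - r))⁻¹ • Γ ζ) := by
    refine circleIntegral.integral_congr hR.le fun ζ hζ => ?_
    have e1 := hne _ h1 ζ hζ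
    have e2 := hne _ h2 ζ hζ
    have e3 : (ζ - u) ^ 2 - r ^ 2 = (ζ - (u + r)) * (ζ - (u - r)) := by ring
    simp only [smul_eq_mul]
    rw [e3]
    field_simp
    ring
  rw [hsum, circleIntegral.integral_smul, circleIntegral.integral_add (hint _ h1) (hint _ h2),
    hcauchy _ h1, hcauchy _ h2]
  have : (2 * π * Complex.I : ℂ) ≠ 0 := Complex.two_pi_I_ne_zero
  simp only [smul_eq_mul]
  field_simp

/-- Since the kernel sees `r` only through `s = r²`, the Cauchy integral is smooth in `(u, s)`
across `s = 0`. The root `r` is complex so that negative `s` is covered; the bounds on `δ` keep `u ±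
r` in the disc. -/
theorem exists_smooth_evenPart {Γ : ℂ → ℂ} {c ρ R δ : ℝ} (hR : 0 < R) (hRρ : R < ρ)
    (hδ : δ ≤ R / 4) (hδ' : δ ≤ (R / 4) ^ 2)
    (hΓ : DifferentiableOn ℂ Γ (Metric.ball (c : ℂ) ρ)) :
    ∃ G : ℝ × ℝ → ℂ, ContDiffOn ℝ ∞ G (Metric.ball (c, 0) δ) ∧
      ∀ p ∈ Metric.ball ((c, 0) : ℝ × ℝ) δ, ∀ r : ℂ, r ^ 2 = p.2 →
        (p.1 : ℂ) + r ∈ Metric.ball (c : ℂ) ρ ∧ (p.1 : ℂ) - r ∈ Metric.ball (c : ℂ) ρ ∧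
          G p = (Γ (p.1 + r) + Γ (p.1 - r)) / 2 := by
  refine ⟨fun p => (2 * π * Complex.I : ℂ)⁻¹ *
    ∮ ζ in C((c : ℂ), R), Γ ζ * ((ζ - p.1) / ((ζ - p.1) ^ 2 - p.2)), ?_, ?_⟩
  · refine contDiffOn_const.mul ?_
    simp only [circleIntegral, smul_eq_mul]
    refine contDiffOn_intervalIntegral (F := ℂ) (E := ℝ × ℝ)
      (K := fun q => deriv (circleMap (c : ℂ) R) q.2 * (Γ (circleMap c R q.2) * ((circleMap c R q.2 - q.1.1) /
        ((circleMap c R q.2 - q.1.1) ^ 2 - q.1.2)))) Metric.isOpen_ball ?_ _ _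
    have hof : ∀ {f : (ℝ × ℝ) × ℝ → ℝ}, ContDiff ℝ ∞ f → ContDiff ℝ ∞ fun q => (f q : ℂ) :=
      fun hf => Complex.ofRealCLM.contDiff.comp hf
    have hcm : ContDiff ℝ ∞ fun q : (ℝ × ℝ) × ℝ => circleMap (c : ℂ) R q.2 :=
      (contDiff_circleMap (c : ℂ) R).comp contDiff_snd
    have hu : ContDiff ℝ ∞ fun q : (ℝ × ℝ) × ℝ => circleMap (c : ℂ) R q.2 - q.1.1 :=
      hcm.sub (hof (contDiff_fst.comp contDiff_fst))
    have hs : ContDiff ℝ ∞ fun q : (ℝ × ℝ) × ℝ =>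
        (circleMap (c : ℂ) R q.2 - q.1.1) ^ 2 - q.1.2 :=
      (hu.pow 2).sub (hof (contDiff_snd.comp contDiff_fst))
    refine ContDiffOn.mul ?_ (ContDiffOn.mul ?_ (hu.contDiffOn.mul (hs.contDiffOn.inv ?_)))
    · simp only [deriv_circleMap]
      exact ((((contDiff_circleMap (0 : ℂ) R).comp contDiff_snd)).mul contDiff_const).contDiffOn
    · have h1 : ContDiffOn ℝ ∞ Γ (Metric.ball (c : ℂ) ρ) :=
        (hΓ.contDiffOn Metric.isOpen_ball).restrict_scalars ℝ
      refine h1.comp hcm.contDiffOn fun q _ => ?_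
      exact Metric.sphere_subset_closedBall.trans (Metric.closedBall_subset_ball hRρ)
        (circleMap_mem_sphere (c : ℂ) hR.le q.2)
    · exact fun q hq => evenPart_denominator_ne_zero hR hδ hδ' hq.1
  · intro p hp r hr
    have hp' := hp
    rw [Metric.mem_ball, Prod.dist_eq, max_lt_iff, Real.dist_eq, Real.dist_eq, sub_zero] at hp'
    have hr2 : ‖r‖ < R / 4 := by
      refine lt_of_pow_lt_pow_left₀ 2 (by positivity) ?_
      rw [← norm_pow, hr, Complex.norm_real, Real.norm_eq_abs]
      exact hp'.2.trans_le hδ'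
    have hu : ‖(p.1 : ℂ) - c‖ < R / 4 := by
      rw [← Complex.ofReal_sub, Complex.norm_real, Real.norm_eq_abs]
      exact hp'.1.trans_le hδ
    have h1 : (p.1 : ℂ) + r ∈ Metric.ball (c : ℂ) R := by
      rw [mem_ball_iff_norm, add_sub_right_comm]
      exact (norm_add_le _ _).trans_lt (by linarith)
    have h2 : (p.1 : ℂ) - r ∈ Metric.ball (c : ℂ) R := by
      rw [mem_ball_iff_norm, sub_right_comm]
      exact (norm_sub_le _ _).trans_lt (by linarith)
    have hsub := Metric.ball_subset_ball (x := (c : ℂ)) hRρ.le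
    refine ⟨hsub h1, hsub h2, ?_⟩
    rw [← circleIntegral_evenPart hR (hΓ.mono (Metric.closedBall_subset_ball hRρ)) h1 h2, hr]

end EvenPart

section FoldPrimitive

variable {a : ℝ}

/-! ### Complexification of the fold curve -/

/-- The complexified radicand `2 cos 4τ + a ^ 4 + a ^ (-4)`. -/
def foldRadicand (a : ℝ) (τ : ℂ) : ℂ := 2 * Complex.cos (4 * τ) + (a : ℂ) ^ 4 + ((a : ℂ)⁻¹) ^ 4

/-- The complexified derivative of the fold curve. -/
def foldData (a : ℝ) (k : Fin 3) (τ : ℂ) : ℂ :=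
  2 / foldRadicand a τ ^ (1 / 2 : ℂ) * ![1, -Complex.cos τ, -Complex.sin τ] k

theorem foldRadicand_ofReal (a t : ℝ) :
    foldRadicand a t = ((2 * Real.cos (4 * t) + a ^ 4 + a⁻¹ ^ 4 : ℝ) : ℂ) := by
  simp [foldRadicand]

theorem foldData_ofReal (ha : 0 < a) (ha1 : a < 1) (t : ℝ) (k : Fin 3) :
    foldData a k t = (gammaDeriv a t k : ℝ) := by
  rw [foldData, foldRadicand_ofReal, cpow_half_ofReal (xi_radicand_pos ha ha1 t).le]
  fin_cases k <;> simp [gammaDeriv, xi]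

theorem foldRadicand_conj (a : ℝ) (τ : ℂ) :
    foldRadicand a ((starRingEnd ℂ) τ) = (starRingEnd ℂ) (foldRadicand a τ) := by
  have : 4 * (starRingEnd ℂ) τ = (starRingEnd ℂ) (4 * τ) := by
    rw [map_mul, map_ofNat]
  rw [foldRadicand, this, Complex.cos_conj]
  simp [foldRadicand, map_ofNat (starRingEnd ℂ) 2]

theorem foldData_conj (a : ℝ) (k : Fin 3) {τ : ℂ} (h : 0 < (foldRadicand a τ).re) :
    (starRingEnd ℂ) (foldData a k ((starRingEnd ℂ) τ)) = foldData a k τ := by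
  have hc : (foldRadicand a τ) ^ (1 / 2 : ℂ) =
      (starRingEnd ℂ) ((starRingEnd ℂ) (foldRadicand a τ) ^ (1 / 2 : ℂ)) := by
    have := Complex.cpow_conj (foldRadicand a τ) (1 / 2)
      (Complex.mem_slitPlane_iff_arg.1 (Or.inl h)).1
    rw [← this, map_div₀, map_one, map_ofNat]
  rw [foldData, foldData, map_mul, map_div₀, foldRadicand_conj, ← hc]
  congr 1
  · rw [map_ofNat]
  · fin_cases k <;> simp [Complex.cos_conj, Complex.sin_conj]

theorem differentiableAt_foldData (a : ℝ) (k : Fin 3) {τ : ℂ} (h : 0 < (foldRadicand a τ).re) :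
    DifferentiableAt ℂ (foldData a k) τ := by
  have h1 : DifferentiableAt ℂ (foldRadicand a) τ := by unfold foldRadicand; fun_prop
  refine ((differentiableAt_const _).div (h1.cpow (differentiableAt_const _) (Or.inl h)) ?_).mul ?_
  · rw [Complex.cpow_ne_zero_iff_of_exponent_ne_zero (by norm_num)]
    exact Complex.slitPlane_ne_zero (Or.inl h)
  · fin_cases k <;> simp

theorem polar_exp (τ : ℂ) : polar (Real.exp (-τ.im)) τ.re = Complex.exp (τ * Complex.I) := by
  rw [polar, Complex.ofReal_exp, ← Complex.exp_add]
  congr 1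
  apply Complex.ext <;> simp

theorem foldRadicand_eq (ha : 0 < a) {z τ : ℂ} (hz : z = Complex.exp (τ * Complex.I)) :
    foldRadicand a τ * z ^ 4 = wBranch a z ^ 2 := by
  have h1 : Complex.exp (4 * τ * Complex.I) = z ^ 4 := by
    rw [hz, ← Complex.exp_nat_mul]
    congr 1
    push_cast
    ring
  have h2 : Complex.exp (-(4 * τ) * Complex.I) * z ^ 4 = 1 := by
    rw [← h1, ← Complex.exp_add]
    simp
  rw [wBranch_sq ha.ne', foldRadicand, Complex.cos, h1]
  linear_combination h2

/-- `(2/D)² = w²/z⁴` is the radicand, and the known sign `Re D ≥ 0` selects the principal root.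
Equality is excluded because the square has positive real part. -/
theorem density_exp (ha : 0 < a) (ha1 : a < 1) {τ : ℂ} (h : 0 < (foldRadicand a τ).re)
    (hz : Complex.exp (τ * Complex.I) ∈ closedSector) :
    density a (Complex.exp (τ * Complex.I)) = 2 / foldRadicand a τ ^ (1 / 2 : ℂ) := by
  set z := Complex.exp (τ * Complex.I) with hzd
  have hz0 : z ≠ 0 := Complex.exp_ne_zero _
  have hr := foldRadicand_eq ha hzd
  have hne : foldRadicand a τ ≠ 0 := Complex.slitPlane_ne_zero (Or.inl h)
  have hw : wBranch a z ≠ 0 := fun hw => by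
    rw [hw, zero_pow two_ne_zero] at hr
    exact mul_ne_zero hne (pow_ne_zero 4 hz0) hr
  have hd : density a z ≠ 0 := div_ne_zero (mul_ne_zero two_ne_zero (pow_ne_zero 2 hz0)) hw
  have hsq : (2 / density a z) ^ 2 = foldRadicand a τ := by
    rw [density]
    field_simp
    linear_combination -hr
  have hre : 0 ≤ (2 / density a z).re := by
    have h2 : (2 : ℂ) / density a z = ((2 / Complex.normSq (density a z) : ℝ) : ℂ) *
        (starRingEnd ℂ) (density a z) := by
      rw [div_eq_mul_inv, Complex.inv_def]
      push_cast
      ring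
    rw [h2, Complex.re_ofReal_mul, Complex.conj_re]
    exact mul_nonneg (div_nonneg two_pos.le (Complex.normSq_nonneg _))
      (density_re_nonneg ha ha1 hz)
  have hpos : 0 < (2 / density a z).re := by
    refine hre.lt_of_ne fun h0 => ?_
    rw [← hsq, pow_two, Complex.mul_re, ← h0] at h
    nlinarith
  rw [← eq_cpow_half hsq hpos]
  field_simp

/-- With `z = e^{iτ}` and `dz = i z dτ`, the Weierstrass form becomes `(2z²/w)(1, -cos τ, -sin τ)
dτ`, the complexified derivative of the fold curve. -/
theorem hasDerivAt_holCurve_exp (ha : 0 < a) (ha1 : a < 1) (k : Fin 3) {τ : ℂ}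
    (h : 0 < (foldRadicand a τ).re) (hz : Complex.exp (τ * Complex.I) ∈ closedSector) :
    HasDerivAt (fun τ => holCurve a k (Complex.exp (τ * Complex.I))) (foldData a k τ) τ := by
  set z := Complex.exp (τ * Complex.I) with hzd
  have hz0 : z ≠ 0 := Complex.exp_ne_zero _
  have hr := foldRadicand_eq ha hzd
  have hne : foldRadicand a τ ≠ 0 := Complex.slitPlane_ne_zero (Or.inl h)
  have hw : wBranch a z ≠ 0 := fun hw => by
    rw [hw, zero_pow two_ne_zero] at hr
    exact mul_ne_zero hne (pow_ne_zero 4 hz0) hr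
  have hb : z ≠ branchPoint a := by
    intro hb
    apply hw
    have := rootCoord_sq a z
    rw [hb, branchPoint_pow_four, neg_add_cancel] at this
    rw [wBranch_eq_rootCoord, hb, pow_eq_zero_iff two_ne_zero |>.1 this, zero_mul]
  have he : HasDerivAt (fun τ => Complex.exp (τ * Complex.I)) (z * Complex.I) τ := by
    simpa using ((hasDerivAt_id τ).mul_const Complex.I).cexp
  refine ((hasDerivAt_holCurve (mem_starExt ha ha1 hz hb) k).comp τ he).congr_deriv ?_
  have hden : 2 / foldRadicand a τ ^ (1 / 2 : ℂ) = 2 * z ^ 2 / wBranch a z :=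
    (density_exp ha ha1 h hz).symm
  rw [PhiExt_eq hz, Phi_eq, foldData, hden]
  have hinv : Complex.exp (-τ * Complex.I) = z⁻¹ := by
    rw [hzd, ← Complex.exp_neg, neg_mul]
  have hI := Complex.I_sq
  have hcos : Complex.cos τ = (z + z⁻¹) / 2 := by rw [Complex.cos, hinv]
  have hsin : Complex.sin τ = (z⁻¹ - z) * Complex.I / 2 := by rw [Complex.sin, hinv]
  rw [hcos, hsin]
  clear_value z
  fin_cases k
  · simp [weierstrassVec]
    field_simp
    linear_combination (-1 : ℂ) * hI
  · simp [weierstrassVec]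
    field_simp
    linear_combination (1 + z ^ 2) * hI
  · simp [weierstrassVec]
    field_simp
    linear_combination (1 - z ^ 2) * hI

theorem exists_foldRadicand_ball (ha : 0 < a) (ha1 : a < 1) (u : ℝ) :
    ∃ ρ > 0, ∀ τ ∈ Metric.ball (u : ℂ) ρ, 0 < (foldRadicand a τ).re := by
  have hc : ContinuousAt (fun τ => (foldRadicand a τ).re) (u : ℂ) := by
    unfold foldRadicand
    fun_prop
  refine Metric.eventually_nhds_iff_ball.1 (hc.tendsto.eventually_const_lt ?_)
  rw [foldRadicand_ofReal, Complex.ofReal_re]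
  exact xi_radicand_pos ha ha1 u

/-- One holomorphic function carries both pieces: its real part is `γ` on the real axis and `fMax`
at `e^{iτ}` above it. The reflection `Γ (conj τ) = conj (Γ τ)` follows because both sides have the
same derivative and the same value at `u₀`. -/
theorem exists_foldPrimitive (ha : 0 < a) (ha1 : a < 1) {u₀ : ℝ} (hu₀ : u₀ ∈ Set.Icc 0 (π / 4))
    {ρ : ℝ} (hρ : 0 < ρ) (hrad : ∀ τ ∈ Metric.ball (u₀ : ℂ) ρ, 0 < (foldRadicand a τ).re)
    (k : Fin 3) :
    ∃ Γ : ℂ → ℂ, DifferentiableOn ℂ Γ (Metric.ball (u₀ : ℂ) ρ) ∧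
      (∀ τ ∈ Metric.ball (u₀ : ℂ) ρ, (Γ ((starRingEnd ℂ) τ)).re = (Γ τ).re) ∧
      (∀ t : ℝ, (t : ℂ) ∈ Metric.ball (u₀ : ℂ) ρ → (Γ t).re = gamma a t k) ∧
      ∀ τ ∈ Metric.ball (u₀ : ℂ) ρ, 0 ≤ τ.re → τ.re ≤ π / 4 → 0 ≤ τ.im →
        (Γ τ).re = fMax a (polar (Real.exp (-τ.im)) τ.re) k := by
  have hdiff : DifferentiableOn ℂ (foldData a k) (Metric.ball (u₀ : ℂ) ρ) := fun τ hτ =>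
    (differentiableAt_foldData a k (hrad τ hτ)).differentiableWithinAt
  obtain ⟨Γ, hΓ0, hΓ⟩ := hdiff.isExactOn_ball.with_val_at (u₀ : ℂ) (gamma a u₀ k : ℂ)
  have hmem : (u₀ : ℂ) ∈ Metric.ball (u₀ : ℂ) ρ := Metric.mem_ball_self hρ
  have hconj : ∀ τ ∈ Metric.ball (u₀ : ℂ) ρ, (starRingEnd ℂ) τ ∈ Metric.ball (u₀ : ℂ) ρ := by
    intro τ hτ
    rw [mem_ball_iff_norm] at hτ ⊢
    rwa [← RCLike.norm_conj, map_sub, Complex.conj_conj, Complex.conj_ofReal]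
  refine ⟨Γ, fun τ hτ => (hΓ τ hτ).differentiableAt.differentiableWithinAt, ?_, ?_, ?_⟩
  · obtain ⟨C, hC⟩ := exists_eqOn_add_const (f := (starRingEnd ℂ) ∘ Γ ∘ (starRingEnd ℂ)) (g := Γ)
      (d := foldData a k) (convex_ball (u₀ : ℂ) ρ) (fun τ hτ => by
        refine HasDerivAt.hasDerivWithinAt ?_
        have := (hΓ _ (hconj τ hτ)).conj_conj
        rw [Complex.conj_conj] at this
        exact this.congr_deriv (foldData_conj a k (hrad τ hτ)))
      (fun τ hτ => (hΓ τ hτ).hasDerivWithinAt)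
    have h0 := hC _ hmem
    simp only [Function.comp, Complex.conj_ofReal, hΓ0] at h0
    intro τ hτ
    have h1 := congrArg Complex.re (hC τ hτ)
    have h2 : C = 0 := by linear_combination -h0
    simpa [h2] using h1
  · intro t ht
    have hs : ∀ s ∈ Set.uIcc u₀ t, (s : ℂ) ∈ Metric.ball (u₀ : ℂ) ρ := by
      intro s hs
      rw [mem_ball_iff_norm, ← Complex.ofReal_sub, Complex.norm_real, Real.norm_eq_abs] at ht ⊢
      exact (Set.abs_sub_left_of_mem_uIcc hs).trans_lt ht
    have hd : ∀ s ∈ Set.uIcc u₀ t, HasDerivWithinAt (fun s : ℝ => (Γ s).re - gamma a s k) 0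
        (Set.uIcc u₀ t) s := by
      intro s hsm
      have h1 := (hΓ _ (hs s hsm)).real_of_complex
      rw [foldData_ofReal ha ha1, Complex.ofReal_re] at h1
      exact ((h1.sub (hasDerivAt_gamma_apply ha ha1 s k)).congr_deriv
        (sub_self _)).hasDerivWithinAt
    have h1 := (convex_uIcc u₀ t).norm_image_sub_le_of_norm_hasDerivWithin_le (C := 0) hd
      (fun _ _ => norm_zero.le) Set.left_mem_uIcc Set.right_mem_uIcc
    rw [zero_mul, norm_le_zero_iff, hΓ0, Complex.ofReal_re, sub_self, sub_zero] at h1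
    exact sub_eq_zero.1 h1
  · set Q : Set ℂ := Metric.ball (u₀ : ℂ) ρ ∩ {τ | 0 ≤ τ.re} ∩ {τ | τ.re ≤ π / 4} ∩ {τ | 0 ≤ τ.im}
      with hQ
    have hQc : Convex ℝ Q := (((convex_ball _ _).inter (convex_halfSpace_re_ge 0)).inter
      (convex_halfSpace_re_le _)).inter (convex_halfSpace_im_ge 0)
    have hz : ∀ τ ∈ Q, Complex.exp (τ * Complex.I) ∈ closedSector := by
      rintro τ ⟨⟨⟨-, h1⟩, h2⟩, h3⟩
      rw [← polar_exp]
      exact polar_mem_closedSector (Real.exp_pos _).le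
        (Real.exp_le_one_iff.2 (neg_nonpos.2 h3)) h1 h2
    obtain ⟨C, hC⟩ := exists_eqOn_add_const (f := fun τ => holCurve a k (Complex.exp (τ * Complex.I)))
      (g := Γ) (d := foldData a k) hQc (fun τ hτ => (hasDerivAt_holCurve_exp ha ha1 k
        (hrad τ hτ.1.1.1) (hz τ hτ)).hasDerivWithinAt)
      (fun τ hτ => (hΓ τ hτ.1.1.1).hasDerivWithinAt)
    have hu : (u₀ : ℂ) ∈ Q := ⟨⟨⟨hmem, hu₀.1⟩, hu₀.2⟩, (Complex.ofReal_im u₀).ge⟩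
    have h0 := congrArg Complex.re (hC _ hu)
    have e0 : Complex.exp (u₀ * Complex.I) = polar 1 u₀ := by simp [polar]
    rw [← fMax_apply (hz _ hu), e0, fMax_circle ha ha1 hu₀, Complex.add_re, hΓ0,
      Complex.ofReal_re] at h0
    intro τ hτ h1 h2 h3
    have hτQ : τ ∈ Q := ⟨⟨⟨hτ, h1⟩, h2⟩, h3⟩
    have h4 := congrArg Complex.re (hC _ hτQ)
    rw [← fMax_apply (hz _ hτQ), Complex.add_re] at h4
    rw [polar_exp]
    linarith

end FoldPrimitive

section FoldExtension

variable {a : ℝ}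

/-! ### The smooth surface across the fold curve -/

/-- The second derivative of the fold curve. -/
def gammaDeriv₂ (a s : ℝ) : Fin 3 → ℝ :=
  ![deriv (xi a) s, deriv (xi a) s * (-Real.cos s) + xi a s * Real.sin s,
    deriv (xi a) s * (-Real.sin s) + xi a s * (-Real.cos s)]

theorem differentiable_xi (ha : 0 < a) (ha1 : a < 1) : Differentiable ℝ (xi a) := by
  unfold xi
  refine (differentiable_const _).div (Differentiable.sqrt (by fun_prop) fun t => ?_) fun t => ?_
  · exact (xi_radicand_pos ha ha1 t).ne'
  · exact (Real.sqrt_pos.2 (xi_radicand_pos ha ha1 t)).ne'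

theorem hasDerivAt_gammaDeriv (ha : 0 < a) (ha1 : a < 1) (s : ℝ) (k : Fin 3) :
    HasDerivAt (fun s => gammaDeriv a s k) (gammaDeriv₂ a s k) s := by
  have hx := (differentiable_xi ha ha1 s).hasDerivAt
  fin_cases k
  · exact hx
  · exact (hx.mul (Real.hasDerivAt_cos s).neg).congr_deriv (by simp [gammaDeriv₂])
  · exact hx.mul (Real.hasDerivAt_sin s).neg

/-- The derivative in `s` at `s = 0` of a function that equals `f` at `r` when `s = r ^ 2`. -/
theorem deriv_snd_of_even {G : ℝ × ℝ → ℝ} {U : Set (ℝ × ℝ)} (hU : IsOpen U)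
    (hG : ContDiffOn ℝ ∞ G U) {u : ℝ} (hu : (u, 0) ∈ U) {f f' : ℝ → ℝ} {f'' : ℝ}
    (hf : ∀ r, HasDerivAt f (f' r) r) (hf' : HasDerivAt f' f'' 0) (h0 : f' 0 = 0)
    (hGf : ∀ r, (u, r ^ 2) ∈ U → G (u, r ^ 2) = f r) :
    fderiv ℝ G (u, 0) (0, 1) = f'' / 2 := by
  have hc : Continuous fun r : ℝ => (u, r ^ 2) := by fun_prop
  have hV : {r : ℝ | (u, r ^ 2) ∈ U} ∈ nhds (0 : ℝ) :=
    (hU.preimage hc).mem_nhds (by simpa using hu)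
  have hh : Filter.Tendsto (fun r : ℝ => fderiv ℝ G (u, r ^ 2) (0, 1)) (nhds 0)
      (nhds (fderiv ℝ G (u, 0) (0, 1))) := by
    have h1 : ContinuousAt (fderiv ℝ G) (u, (0 : ℝ) ^ 2) := by
      rw [zero_pow two_ne_zero]
      exact (hG.continuousOn_fderiv_of_isOpen hU (by simp)).continuousAt (hU.mem_nhds hu)
    have h2 := (h1.comp (f := fun r : ℝ => (u, r ^ 2)) hc.continuousAt).clm_apply
      (continuousAt_const (y := ((0 : ℝ), (1 : ℝ))))
    have h3 := h2.tendsto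
    simp only [Function.comp, zero_pow two_ne_zero] at h3
    exact h3
  have heq : ∀ᶠ r in nhds (0 : ℝ), f' r = 2 * r * fderiv ℝ G (u, r ^ 2) (0, 1) := by
    filter_upwards [eventually_mem_nhds_iff.2 hV] with r hr
    have hr0 : (u, r ^ 2) ∈ U :=
      mem_of_mem_nhds (s := {r : ℝ | (u, r ^ 2) ∈ U}) hr
    have h1 := ((hG.differentiableOn (by simp)).differentiableAt
      (hU.mem_nhds hr0)).hasFDerivAt
    have h2 : HasDerivAt (fun r : ℝ => (u, r ^ 2)) (0, 2 * r) r := by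
      simpa using (hasDerivAt_const r u).prodMk (hasDerivAt_pow 2 r)
    have h3 := h1.comp_hasDerivAt_of_eq r h2 rfl
    have h4 : HasDerivAt (G ∘ fun r : ℝ => (u, r ^ 2)) (f' r) r :=
      (hf r).congr_of_eventuallyEq (by filter_upwards [hr] with x hx using hGf x hx)
    rw [h4.unique h3]
    have : ((0 : ℝ), 2 * r) = (2 * r) • ((0 : ℝ), (1 : ℝ)) := by simp
    rw [this, map_smul, smul_eq_mul]
  have hs := hasDerivAt_iff_tendsto_slope_zero.1 hf'
  have hs2 : Filter.Tendsto (fun t : ℝ => 2 * fderiv ℝ G (u, t ^ 2) (0, 1))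
      (nhdsWithin 0 {0}ᶜ) (nhds f'') := by
    refine hs.congr' ?_
    filter_upwards [heq.filter_mono nhdsWithin_le_nhds, self_mem_nhdsWithin] with t ht ht0
    have : t ≠ 0 := ht0
    rw [zero_add, h0, sub_zero, ht, smul_eq_mul]
    field_simp
  -- From `f' r = 2 r ∂G/∂s (u, r²)` the slope of `f'` at `0` tends both to `f''` and to `2 ∂G/∂s
  -- (u, 0)`.
  have := tendsto_nhds_unique hs2 ((hh.const_mul 2).mono_left nhdsWithin_le_nhds)
  linarith

/-- The function is the real part of the even part of `Γ`. For `s = v²` it is the mean of `γ (u ±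
v)`. For `s = -v²` the two terms sit at conjugate points with equal real parts, and it reduces to
`fMax`. -/
theorem exists_foldExtension_apply (ha : 0 < a) (ha1 : a < 1) {u₀ : ℝ}
    (hu₀ : u₀ ∈ Set.Icc 0 (π / 4)) {ρ δ : ℝ} (hρ : 0 < ρ)
    (hrad : ∀ τ ∈ Metric.ball (u₀ : ℂ) ρ, 0 < (foldRadicand a τ).re) (hδ0 : 0 < δ)
    (hδ : δ ≤ ρ / 2 / 4) (hδ' : δ ≤ (ρ / 2 / 4) ^ 2) (k : Fin 3) :
    ∃ G : ℝ × ℝ → ℝ, ContDiffOn ℝ ∞ G (Metric.ball (u₀, 0) δ) ∧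
      (∀ p ∈ Metric.ball ((u₀, 0) : ℝ × ℝ) δ, ∀ v : ℝ, v ^ 2 = p.2 → G p = fMin a (p.1, v) k) ∧
      (∀ p ∈ Metric.ball ((u₀, 0) : ℝ × ℝ) δ, 0 ≤ p.1 → p.1 ≤ π / 4 → ∀ v : ℝ, 0 ≤ v →
        v ^ 2 = -p.2 → G p = fMax a (polar (Real.exp (-v)) p.1) k) ∧
      fderiv ℝ G (u₀, 0) (1, 0) = gammaDeriv a u₀ k ∧
      fderiv ℝ G (u₀, 0) (0, 1) = gammaDeriv₂ a u₀ k / 2 := by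
  obtain ⟨Γ, hΓ, hconj, hreal, hmax⟩ := exists_foldPrimitive ha ha1 hu₀ hρ hrad k
  obtain ⟨G, hG, hGe⟩ := exists_smooth_evenPart (R := ρ / 2) (by positivity) (by linarith) hδ hδ' hΓ
  have hGre : ContDiffOn ℝ ∞ (fun p => (G p).re) (Metric.ball (u₀, 0) δ) :=
    Complex.reCLM.contDiff.comp_contDiffOn hG
  have hmin : ∀ p ∈ Metric.ball ((u₀, 0) : ℝ × ℝ) δ, ∀ v : ℝ, v ^ 2 = p.2 →
      (G p).re = fMin a (p.1, v) k := by
    intro p hp v hv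
    obtain ⟨h1, h2, h3⟩ := hGe p hp v (by rw [← hv]; push_cast; rfl)
    rw [← Complex.ofReal_add] at h1 h3
    rw [← Complex.ofReal_sub] at h2 h3
    rw [h3, fMin_apply, ← hreal _ h1, ← hreal _ h2]
    simp
  have hmem : ((u₀, 0) : ℝ × ℝ) ∈ Metric.ball (u₀, 0) δ := Metric.mem_ball_self hδ0
  refine ⟨fun p => (G p).re, hGre, hmin, ?_, ?_, ?_⟩
  · intro p hp h0 h1 v hv hvp
    obtain ⟨h2, h3, h4⟩ := hGe p hp (v * Complex.I) (by
      rw [mul_pow, Complex.I_sq, ← Complex.ofReal_pow, hvp]; simp)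
    have h5 := hmax _ h2 (by simpa using h0) (by simpa using h1) (by simpa using hv)
    have h6 := hconj _ h2
    have h7 : (starRingEnd ℂ) ((p.1 : ℂ) + v * Complex.I) = p.1 - v * Complex.I := by
      simp [sub_eq_add_neg]
    rw [h7, h5] at h6
    have h8 : ((p.1 : ℂ) + v * Complex.I).im = v := by simp
    have h9 : ((p.1 : ℂ) + v * Complex.I).re = p.1 := by simp
    rw [h8, h9] at h5 h6
    have h10 : (G p).re = ((Γ (p.1 + v * Complex.I)).re + (Γ (p.1 - v * Complex.I)).re) / 2 := by
      rw [h4]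
      simp
    simp only [h10, h5, h6]
    ring
  · have h1 := ((hGre.differentiableOn (by simp)).differentiableAt
      (Metric.isOpen_ball.mem_nhds hmem)).hasFDerivAt
    have h2 := h1.comp_hasDerivAt_of_eq u₀
      ((hasDerivAt_id u₀).prodMk (hasDerivAt_const u₀ (0 : ℝ))) rfl
    refine h2.unique ((hasDerivAt_gamma_apply ha ha1 u₀ k).congr_of_eventuallyEq ?_)
    have hc : ContinuousAt (fun u : ℝ => (u, (0 : ℝ))) u₀ := by fun_prop
    filter_upwards [hc.preimage_mem_nhds (Metric.isOpen_ball.mem_nhds hmem)] with u hu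
    simp only [Function.comp, id]
    rw [hmin _ hu 0 (by simp), fMin_zero_right]
  · refine deriv_snd_of_even Metric.isOpen_ball hGre hmem (f := fun r => fMin a (u₀, r) k)
      (fun r => hasDerivAt_fMin_right ha ha1 u₀ r k) ?_ (by simp) fun r hr => hmin _ hr r rfl
    have h1 : HasDerivAt (fun r => gammaDeriv a (u₀ + r) k) (gammaDeriv₂ a u₀ k) 0 :=
      HasDerivAt.comp_const_add u₀ 0 (by simpa using hasDerivAt_gammaDeriv ha ha1 u₀ k)
    have h2 : HasDerivAt (fun r => gammaDeriv a (u₀ - r) k) (-gammaDeriv₂ a u₀ k) 0 :=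
      HasDerivAt.comp_const_sub u₀ 0 (by simpa using hasDerivAt_gammaDeriv ha ha1 u₀ k)
    exact ((h1.sub h2).div_const 2).congr_deriv (by ring)

/-- `fMin` has zero `v`-derivative on `v = 0`, but in the coordinate `s = v²` the derivatives are
`γ'` and `γ''/2`. They are independent because the horizontal direction of `γ'` rotates. -/
theorem exists_foldExtension (ha : 0 < a) (ha1 : a < 1) {u₀ : ℝ} (hu₀ : u₀ ∈ Set.Icc 0 (π / 4)) :
    ∃ δ > 0, ∃ F : ℝ × ℝ → R31, ∃ L : ℝ × ℝ →L[ℝ] R31,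
      ContDiffOn ℝ ∞ F (Metric.ball (u₀, 0) δ) ∧ HasFDerivAt F L (u₀, 0) ∧ Function.Injective L ∧
      (∀ p ∈ Metric.ball ((u₀, 0) : ℝ × ℝ) δ, ∀ v : ℝ, v ^ 2 = p.2 → F p = fMin a (p.1, v)) ∧
      (∀ p ∈ Metric.ball ((u₀, 0) : ℝ × ℝ) δ, 0 ≤ p.1 → p.1 ≤ π / 4 → ∀ v : ℝ, 0 ≤ v →
        v ^ 2 = -p.2 → F p = fMax a (polar (Real.exp (-v)) p.1)) := by
  obtain ⟨ρ, hρ, hrad⟩ := exists_foldRadicand_ball ha ha1 u₀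
  set δ := min (ρ / 2 / 4) ((ρ / 2 / 4) ^ 2) with hδd
  have hδ : 0 < δ := by positivity
  choose G hG hmin hmax hx hy using fun k => exists_foldExtension_apply ha ha1 hu₀ hρ hrad hδ
    (min_le_left _ _) (min_le_right _ _) k
  have hmem : ((u₀, 0) : ℝ × ℝ) ∈ Metric.ball (u₀, 0) δ := Metric.mem_ball_self hδ
  refine ⟨δ, hδ, fun p => WithLp.toLp 2 fun k => G k p, ofCoords fun k => fderiv ℝ (G k) (u₀, 0),
    ?_, ?_, ?_, ?_, ?_⟩
  · exact contDiffOn_euclidean.2 fun k => hG k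
  · exact hasFDerivAt_ofCoords fun k => (((hG k).differentiableOn (by simp)).differentiableAt
      (Metric.isOpen_ball.mem_nhds hmem)).hasFDerivAt
  · refine (injective_iff_map_eq_zero _).2 ?_
    rintro ⟨x, y⟩ h
    have hk : ∀ k, x * gammaDeriv a u₀ k + y * (gammaDeriv₂ a u₀ k / 2) = 0 := by
      intro k
      have h1 := congrArg (fun x : R31 => x k) h
      simp only [ofCoords_apply, PiLp.zero_apply] at h1
      have h2 : (x, y) = x • ((1 : ℝ), (0 : ℝ)) + y • ((0 : ℝ), (1 : ℝ)) := by simp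
      rwa [h2, map_add, map_smul, map_smul, hx, hy] at h1
    have e0 := hk 0
    have e1 := hk 1
    have e2 := hk 2
    simp only [gammaDeriv, gammaDeriv₂, Matrix.cons_val] at e0 e1 e2
    have hxi := xi_pos ha ha1 u₀
    -- The horizontal normal `(sin u₀, -cos u₀)` kills `γ'` and the `ξ'` terms, leaving only the
    -- rotation term of `γ''`.
    have hyx : y * xi a u₀ = 0 := by
      linear_combination 2 * Real.sin u₀ * e1 - 2 * Real.cos u₀ * e2 -
        y * xi a u₀ * Real.sin_sq_add_cos_sq u₀
    have hy0 : y = 0 := (mul_eq_zero.1 hyx).resolve_right hxi.ne'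
    rw [hy0, zero_mul, add_zero] at e0
    have hx0 : x = 0 := (mul_eq_zero.1 e0).resolve_right hxi.ne'
    rw [hx0, hy0, Prod.mk_zero_zero]
  · intro p hp v hv
    ext k
    exact hmin k p hp v hv
  · intro p hp h0 h1 v hv hvp
    ext k
    exact hmax k p hp h0 h1 v hv hvp

end FoldExtension

/-! ### Compact parameter domains and local charts -/

section Embedding

variable {a : ℝ}

/-! ### The fundamental piece as the union of two compact pieces -/

theorem polar_one_mem_closedSector {s : ℝ} (hs : s ∈ Set.Icc 0 (π / 4)) :
    polar 1 s ∈ closedSector :=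
  polar_mem_closedSector zero_le_one le_rfl hs.1 hs.2

theorem mem_closedRectangle_of_mem_rectangle {p : ℝ × ℝ} (hp : p ∈ rectangle) :
    p ∈ closedRectangle :=
  ⟨hp.1, hp.2.1.le, hp.2.2⟩

theorem mk_zero_mem_closedRectangle {s : ℝ} (hs : s ∈ Set.Icc 0 (π / 4)) :
    (s, (0 : ℝ)) ∈ closedRectangle :=
  ⟨hs, le_rfl, by positivity⟩

theorem closedSector_cases {z : ℂ} (hz : z ∈ closedSector) :
    z ∈ sector ∨ ∃ s ∈ Set.Icc 0 (π / 4), z = polar 1 s := by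
  rcases hz.1.lt_or_eq with h | h
  · exact Or.inl (mem_sector_of_mem_closedSector hz h)
  · obtain ⟨r, θ, hr, -, h0, h1, rfl⟩ := exists_polar hz
    rw [norm_polar hr] at h
    exact Or.inr ⟨θ, ⟨h0, h1⟩, by rw [h]⟩

theorem Omega1_eq (ha : 0 < a) (ha1 : a < 1) :
    Omega1 a = fMax a '' closedSector ∪ fMin a '' closedRectangle := by
  refine Set.Subset.antisymm ?_ ?_
  · rintro x ((⟨z, hz, rfl⟩ | ⟨s, hs, rfl⟩) | ⟨p, hp, rfl⟩)
    · exact Or.inl ⟨z, sector_subset_closedSector hz, rfl⟩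
    · exact Or.inl ⟨_, polar_one_mem_closedSector hs, fMax_circle ha ha1 hs⟩
    · exact Or.inr ⟨p, mem_closedRectangle_of_mem_rectangle hp, rfl⟩
  · rintro x (⟨z, hz, rfl⟩ | ⟨⟨u, v⟩, ⟨hu, hv⟩, rfl⟩)
    · rcases closedSector_cases hz with h | ⟨s, hs, rfl⟩
      · exact Or.inl (Or.inl ⟨z, h, rfl⟩)
      · exact Or.inl (Or.inr ⟨s, hs, (fMax_circle ha ha1 hs).symm⟩)
    · rcases hv.1.lt_or_eq with h | h
      · exact Or.inr ⟨(u, v), ⟨hu, h, hv.2⟩, rfl⟩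
      · refine Or.inl (Or.inr ⟨u, hu, ?_⟩)
        change 0 = v at h
        rw [← h, fMin_zero_right]

theorem isCompact_closedRectangle : IsCompact closedRectangle := isCompact_Icc.prod isCompact_Icc

/-- Points of the fundamental piece near `x` have parameters near those of `x`. -/
theorem exists_open_of_preimage (ha : 0 < a) (ha1 : a < 1) {x : R31} {W₁ : Set ℂ}
    {W₂ : Set (ℝ × ℝ)} (h₁ : ∀ z ∈ closedSector, fMax a z = x → W₁ ∈ nhds z)
    (h₂ : ∀ p ∈ closedRectangle, fMin a p = x → W₂ ∈ nhds p) :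
    ∃ N, IsOpen N ∧ x ∈ N ∧ ∀ y ∈ N, y ∈ Omega1 a →
      (∃ z ∈ W₁, z ∈ closedSector ∧ fMax a z = y) ∨
      ∃ p ∈ W₂, p ∈ closedRectangle ∧ fMin a p = y := by
  -- The parameters away from the preimages of `x` form compact sets, so their images are closed and
  -- miss `x`.
  have hc1 : IsCompact (fMax a '' (closedSector \ interior W₁)) :=
    (isCompact_closedSector.diff isOpen_interior).image_of_continuousOn
      ((continuousOn_fMax ha ha1).mono Set.sdiff_subset)
  have hc2 : IsCompact (fMin a '' (closedRectangle \ interior W₂)) :=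
    (isCompact_closedRectangle.diff isOpen_interior).image (continuous_fMin ha ha1)
  refine ⟨(fMax a '' (closedSector \ interior W₁) ∪ fMin a '' (closedRectangle \ interior W₂))ᶜ,
    (hc1.isClosed.union hc2.isClosed).isOpen_compl, ?_, ?_⟩
  · rintro (⟨z, hz, rfl⟩ | ⟨p, hp, rfl⟩)
    · exact hz.2 (mem_interior_iff_mem_nhds.2 (h₁ z hz.1 rfl))
    · exact hp.2 (mem_interior_iff_mem_nhds.2 (h₂ p hp.1 rfl))
  · intro y hy hyO
    rw [Omega1_eq ha ha1] at hyO
    rcases hyO with ⟨z, hz, rfl⟩ | ⟨p, hp, rfl⟩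
    · refine Or.inl ⟨z, ?_, hz, rfl⟩
      by_contra h
      exact hy (Or.inl ⟨z, ⟨hz, fun h' => h (interior_subset h')⟩, rfl⟩)
    · refine Or.inr ⟨p, ?_, hp, rfl⟩
      by_contra h
      exact hy (Or.inr ⟨p, ⟨hp, fun h' => h (interior_subset h')⟩, rfl⟩)

/-- `exists_chart` for a parametrization by any plane with affine coordinates `e x + c`. -/
theorem exists_chart_of_coords {X : Type*} [NormedAddCommGroup X] [NormedSpace ℝ X]
    (e : X ≃L[ℝ] ℝ × ℝ) (c : ℝ × ℝ) {S : Set R31} {F : X → R31} {U : Set X} (hU : IsOpen U)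
    (hF : ContDiffOn ℝ ∞ F U) {q : X} (hq : q ∈ U) {L : X →L[ℝ] R31}
    (hL : HasFDerivAt F L q) (hinj : Function.Injective L)
    (hsub : ∀ x ∈ U, 0 ≤ (e x + c).1 → 0 ≤ (e x + c).2 → F x ∈ S)
    (hloc : ∀ V, IsOpen V → q ∈ V → V ⊆ U → ∃ N, IsOpen N ∧ F q ∈ N ∧
      ∀ y ∈ N, y ∈ S → ∃ x ∈ V, 0 ≤ (e x + c).1 ∧ 0 ≤ (e x + c).2 ∧ F x = y) :
    ∃ φ : OpenPartialHomeomorph R31 R31, F q ∈ φ.source ∧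
      ContDiffOn ℝ ∞ φ φ.source ∧ ContDiffOn ℝ ∞ φ.symm φ.target ∧
      ∀ x ∈ φ.source, x ∈ S ↔ 0 ≤ φ x 0 ∧ 0 ≤ φ x 1 ∧ φ x 2 = 0 := by
  set g : ℝ × ℝ → X := fun y => e.symm (y - c) with hg
  have hgx : ∀ x, g (e x + c) = x := fun x => by simp [hg]
  have hxg : ∀ y, e (g y) + c = y := fun y => by simp [hg]
  have hgd : ContDiff ℝ ∞ g := e.symm.contDiff.comp (contDiff_id.sub contDiff_const)
  have hgf : HasFDerivAt g (e.symm : ℝ × ℝ →L[ℝ] X) (e q + c) :=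
    e.symm.hasFDerivAt.comp (e q + c) ((hasFDerivAt_id _).sub_const c)
  have key := exists_chart (S := S) (F := F ∘ g) (U := g ⁻¹' U) (q := e q + c)
    (L := L.comp (e.symm : ℝ × ℝ →L[ℝ] X)) (hU.preimage hgd.continuous)
    (hF.comp hgd.contDiffOn fun _ h => h) (by rwa [Set.mem_preimage, hgx])
    (HasFDerivAt.comp _ (by rwa [hgx]) hgf) (hinj.comp e.symm.injective)
    (fun y hy h0 h1 => hsub (g y) hy (by rwa [hxg]) (by rwa [hxg])) (fun V hV hqV => by
      obtain ⟨N, hN, hqN, hNS⟩ := hloc ((fun x => e x + c) ⁻¹' V ∩ U)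
        ((hV.preimage (by fun_prop)).inter hU) ⟨hqV, hq⟩ Set.inter_subset_right
      refine ⟨N, hN, by rwa [Function.comp, hgx], fun x hx hxS => ?_⟩
      obtain ⟨x', h1, h2, h3, h4⟩ := hNS x hx hxS
      exact ⟨e x' + c, h1.1, h2, h3, by rw [Function.comp, hgx, h4]⟩)
  rwa [Function.comp, hgx] at key

/-! ### Charts on the maximal piece -/

/-- The coordinates `(Im z, Re z - Im z)`, in which the sector is a piece of the quadrant. -/
def sectorCoords : ℂ ≃L[ℝ] ℝ × ℝ where
  toFun z := (z.im, z.re - z.im)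
  invFun y := ⟨y.1 + y.2, y.1⟩
  map_add' z w := by
    simp only [Complex.add_im, Complex.add_re, Prod.mk_add_mk]
    ring_nf
  map_smul' c z := by
    simp only [Complex.real_smul, Complex.re_ofReal_mul, Complex.im_ofReal_mul, RingHom.id_apply,
      Prod.smul_mk, smul_eq_mul, mul_sub]
  left_inv z := by apply Complex.ext <;> simp
  right_inv y := by simp
  continuous_toFun := by fun_prop
  continuous_invFun := by
    have : (fun y : ℝ × ℝ => (⟨y.1 + y.2, y.1⟩ : ℂ)) =
        fun y => ((y.1 + y.2 : ℝ) : ℂ) + (y.1 : ℂ) * Complex.I := by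
      funext y
      apply Complex.ext <;> simp
    change Continuous fun y : ℝ × ℝ => (⟨y.1 + y.2, y.1⟩ : ℂ)
    rw [this]
    fun_prop

theorem sectorCoords_apply (z : ℂ) : sectorCoords z = (z.im, z.re - z.im) := rfl

theorem fMax_ne_fMin (ha : 0 < a) (ha1 : a < 1) {z : ℂ} (hz : z ∈ closedSector) (hz1 : ‖z‖ < 1)
    {p : ℝ × ℝ} (hp : p ∈ closedRectangle) : fMax a z ≠ fMin a p := by
  intro h
  obtain ⟨s, -, rfl, -⟩ := fMax_eq_fMin ha ha1 hz hp h
  rw [norm_polar zero_le_one] at hz1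
  exact hz1.false

theorem contDiffOn_re_of_hasDerivAt {U : Set ℂ} (hU : IsOpen U) {H : Fin 3 → ℂ → ℂ}
    {d : Fin 3 → ℂ → ℂ} (hH : ∀ k, ∀ z ∈ U, HasDerivAt (H k) (d k z) z) :
    ContDiffOn ℝ ∞ (fun z => (WithLp.toLp 2 fun k => (H k z).re : R31)) U := by
  refine contDiffOn_euclidean.2 fun k => ?_
  have h1 : DifferentiableOn ℂ (H k) U := fun z hz =>
    (hH k z hz).differentiableAt.differentiableWithinAt
  have h2 : ContDiffOn ℝ ∞ (H k) U := (h1.contDiffOn hU).restrict_scalars ℝ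
  exact Complex.reCLM.contDiff.comp_contDiffOn h2

/-- The real part of `holCurve` parametrizes a surface extending past the bounding rays. In
`sectorCoords` these rays are the edges of the quadrant and `z = 0` is its corner. -/
theorem exists_chart_max (ha : 0 < a) (ha1 : a < 1) {z : ℂ} (hz : z ∈ sector)
    (hne : z ≠ branchPoint a) :
    ∃ φ : OpenPartialHomeomorph R31 R31, fMax a z ∈ φ.source ∧
      ContDiffOn ℝ ∞ φ φ.source ∧ ContDiffOn ℝ ∞ φ.symm φ.target ∧
      ∀ x ∈ φ.source, x ∈ Omega1 a ↔ 0 ≤ φ x 0 ∧ 0 ≤ φ x 1 ∧ φ x 2 = 0 := by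
  have hz' := sector_subset_closedSector hz
  have hstar := mem_starExt ha ha1 hz' hne
  have hU : IsOpen (starExt a ∩ Metric.ball 0 1) := (isOpen_starExt a).inter Metric.isOpen_ball
  set F : ℂ → R31 := fun z => WithLp.toLp 2 fun k => (holCurve a k z).re with hF
  have hFeq : ∀ z ∈ closedSector, F z = fMax a z := fun z hz => by
    ext k
    exact (fMax_apply hz k).symm
  have hq : z ∈ starExt a ∩ Metric.ball 0 1 := ⟨hstar, mem_ball_zero_iff.2 hz.1⟩
  rw [← hFeq z hz']
  refine exists_chart_of_coords sectorCoords 0 (F := F) hU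
    (contDiffOn_re_of_hasDerivAt hU fun k z hz => hasDerivAt_holCurve hz.1 k) hq
    (hasFDerivAt_ofCoords fun k => hasFDerivAt_re (hasDerivAt_holCurve hstar k))
    (injective_reMul_weierstrassVec hz.1 (div_ne_zero Complex.I_ne_zero
        (wExt_ne_zero (starExt_subset_domExt a hstar)))) ?_ ?_
  · intro w hw h0 h1
    simp only [add_zero, sectorCoords_apply, sub_nonneg] at h0 h1
    have hw1 : ‖w‖ < 1 := mem_ball_zero_iff.1 hw.2
    have hw' : w ∈ closedSector := ⟨hw1.le, h0, h1⟩
    rw [hFeq w hw']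
    exact Or.inl (Or.inl ⟨w, mem_sector_of_mem_closedSector hw' hw1, rfl⟩)
  · intro V hV hzV hVU
    obtain ⟨N, hN, hxN, hNS⟩ := exists_open_of_preimage ha ha1 (x := F z) (W₁ := V) (W₂ := ∅)
      (fun w hw h => by
        rw [hFeq z hz'] at h
        rw [injOn_fMax ha ha1 hw hz' h]
        exact hV.mem_nhds hzV)
      (fun p hp h => by
        rw [hFeq z hz'] at h
        exact absurd h.symm (fMax_ne_fMin ha ha1 hz' hz.1 hp))
    refine ⟨N, hN, hxN, fun y hy hyO => ?_⟩
    rcases hNS y hy hyO with ⟨w, hwV, hw, hwy⟩ | ⟨p, hp, -⟩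
    · refine ⟨w, hwV, ?_, ?_, (hFeq w hw).trans hwy⟩
      · simpa [sectorCoords_apply] using hw.2.1
      · simpa [sectorCoords_apply] using hw.2.2
    · exact absurd hp (Set.notMem_empty p)

theorem rootData_zero (ha : 0 < a) (ha1 : a < 1) :
    ∃ q ≠ 0, ∀ k, rootData a k 0 = weierstrassVec (branchPoint a) k * q := by
  have hpos := add_inv_pow_four_re_pos ha ha1 (z := branchPoint a)
    (by rw [norm_branchPoint ha]; exact ha1.le)
  have hb0 : branchPoint a ≠ 0 := by
    rw [← norm_ne_zero_iff, norm_branchPoint ha]; exact ha.ne'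
  refine ⟨Complex.I / (2 * branchPoint a ^ 3 *
    (branchPoint a ^ 4 + ((a : ℂ)⁻¹) ^ 4) ^ (1 / 2 : ℂ)), ?_, fun k => by
      rw [rootData, ofRootCoord_zero]⟩
  refine div_ne_zero Complex.I_ne_zero
    (mul_ne_zero (mul_ne_zero two_ne_zero (pow_ne_zero 3 hb0)) ?_)
  rw [Complex.cpow_ne_zero_iff_of_exponent_ne_zero (by norm_num)]
  exact Complex.slitPlane_ne_zero (Or.inl hpos)

/-- In the sector a neighbourhood of the branch point is a half disc; `rootCoord` halves the angle,
so the surface has a right-angled corner there. -/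
theorem exists_chart_branchPoint (ha : 0 < a) (ha1 : a < 1) :
    ∃ φ : OpenPartialHomeomorph R31 R31, fMax a (branchPoint a) ∈ φ.source ∧
      ContDiffOn ℝ ∞ φ φ.source ∧ ContDiffOn ℝ ∞ φ.symm φ.target ∧
      ∀ x ∈ φ.source, x ∈ Omega1 a ↔ 0 ≤ φ x 0 ∧ 0 ≤ φ x 1 ∧ φ x 2 = 0 := by
  have hb := branchPoint_mem_closedSector ha ha1
  have hb1 : ‖branchPoint a‖ < 1 := by rwa [norm_branchPoint ha]
  choose r hr H hH hHs using fun k => exists_rootPrimitive ha ha1 k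
  set ε := min (r 0) (min (r 1) (r 2)) with hε
  have hε0 : 0 < ε := lt_min (hr 0) (lt_min (hr 1) (hr 2))
  have hball : ∀ k, Metric.ball (0 : ℂ) ε ⊆ Metric.ball 0 (r k) := fun k => by
    refine Metric.ball_subset_ball ?_
    fin_cases k
    · exact min_le_left _ _
    · exact (min_le_right _ _).trans (min_le_left _ _)
    · exact (min_le_right _ _).trans (min_le_right _ _)
  have h0 : (0 : ℂ) ∈ Metric.ball (0 : ℂ) ε := Metric.mem_ball_self hε0
  set F : ℂ → R31 := fun ϖ => WithLp.toLp 2 fun k => (H k ϖ).re with hF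
  have hFeq : ∀ ϖ ∈ Metric.ball (0 : ℂ) ε, 0 ≤ ϖ.re → 0 ≤ ϖ.im →
      F ϖ = fMax a (ofRootCoord a ϖ) := fun ϖ hϖ h1 h2 => by
    ext k
    obtain ⟨h3, h4⟩ := hHs k ϖ (hball k hϖ) h1 h2
    rw [fMax_apply (sector_subset_closedSector h3), h4]
  have hF0 : F 0 = fMax a (branchPoint a) := by
    rw [hFeq 0 h0 le_rfl le_rfl, ofRootCoord_zero]
  obtain ⟨q, hq, hqk⟩ := rootData_zero ha ha1
  have hinj := injective_reMul_weierstrassVec hb1 hq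
  simp only [← hqk] at hinj
  rw [← hF0]
  refine exists_chart_of_coords Complex.equivRealProdCLM 0 (F := F) Metric.isOpen_ball
    (contDiffOn_re_of_hasDerivAt Metric.isOpen_ball fun k z hz => hH k z (hball k hz)) h0
    (hasFDerivAt_ofCoords fun k => hasFDerivAt_re (hH k 0 (hball k h0))) hinj ?_ ?_
  · intro ϖ hϖ h1 h2
    simp only [add_zero, Complex.equivRealProdCLM_apply] at h1 h2
    rw [hFeq ϖ hϖ h1 h2]
    exact Or.inl (Or.inl ⟨_, (hHs 0 ϖ (hball 0 hϖ) h1 h2).1, rfl⟩)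
  · intro V hV h0V hVU
    obtain ⟨η, hη, hηV⟩ := Metric.isOpen_iff.1 hV 0 h0V
    obtain ⟨N, hN, hxN, hNS⟩ := exists_open_of_preimage ha ha1 (x := F 0)
      (W₁ := {z | rootCoord a z ∈ Metric.ball 0 η ∧ 0 < z.im}) (W₂ := ∅)
      (fun w hw h => by
        rw [hF0] at h
        rw [injOn_fMax ha ha1 hw hb h]
        exact branchPoint_mem_ball_of_near ha hη)
      (fun p hp h => by
        rw [hF0] at h
        exact absurd h.symm (fMax_ne_fMin ha ha1 hb hb1 hp))
    refine ⟨N, hN, hxN, fun y hy hyO => ?_⟩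
    rcases hNS y hy hyO with ⟨w, hwV, hw, hwy⟩ | ⟨p, hp, -⟩
    · have h1 := rootCoord_re_nonneg a w
      have h2 := rootCoord_im_nonneg (a := a) hw
      refine ⟨rootCoord a w, hηV hwV.1, ?_, ?_, ?_⟩
      · simpa using h1
      · simpa using h2
      · rw [hFeq _ (hVU (hηV hwV.1)) h1 h2, ofRootCoord_rootCoord ha hw hwV.2, hwy]
    · exact absurd hp (Set.notMem_empty p)

end Embedding

section EmbeddedPiece

variable {a : ℝ}

/-! ### Charts on the fold curve and on the timelike piece -/

/-- An affine coordinate near a point of an interval in which the interval is the half line. -/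
theorem exists_edge_coordinate {b : ℝ} (hb : 0 < b) (u₀ : ℝ) :
    ∃ (e : ℝ ≃L[ℝ] ℝ) (c η : ℝ), 0 < η ∧ ∀ u, |u - u₀| < η → (0 ≤ e u + c ↔ u ∈ Set.Icc 0 b) := by
  rcases le_or_gt u₀ (b / 2) with h | h
  · refine ⟨ContinuousLinearEquiv.refl ℝ ℝ, 0, b / 2, by positivity, fun u hu => ?_⟩
    rw [abs_lt] at hu
    rw [ContinuousLinearEquiv.coe_refl', id, add_zero, Set.mem_Icc]
    exact ⟨fun h0 => ⟨h0, by linarith⟩, fun h0 => h0.1⟩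
  · refine ⟨ContinuousLinearEquiv.neg ℝ, b, b / 2, by positivity, fun u hu => ?_⟩
    rw [abs_lt] at hu
    rw [ContinuousLinearEquiv.coe_neg, Pi.neg_apply, id, Set.mem_Icc]
    exact ⟨fun h0 => ⟨by linarith, by linarith⟩, fun h0 => by linarith [h0.2]⟩

theorem isOpen_abs_sub_lt (u₀ η : ℝ) : IsOpen {p : ℝ × ℝ | |p.1 - u₀| < η} :=
  isOpen_lt (by fun_prop) continuous_const

theorem contDiff_gammaDeriv (ha : 0 < a) (ha1 : a < 1) (k : Fin 3) :
    ContDiff ℝ ∞ fun s => gammaDeriv a s k := by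
  have hx : ContDiff ℝ ∞ (xi a) := by
    unfold xi
    refine contDiff_const.div (ContDiff.sqrt (by fun_prop) fun t => ?_) fun t => ?_
    · exact (xi_radicand_pos ha ha1 t).ne'
    · exact (Real.sqrt_pos.2 (xi_radicand_pos ha ha1 t)).ne'
  fin_cases k
  · exact hx
  · exact hx.mul Real.contDiff_cos.neg
  · exact hx.mul Real.contDiff_sin.neg

theorem contDiff_gamma_apply (ha : 0 < a) (ha1 : a < 1) (k : Fin 3) :
    ContDiff ℝ ∞ fun s => gamma a s k := by
  refine contDiff_infty_iff_deriv.2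
    ⟨fun s => (hasDerivAt_gamma_apply ha ha1 s k).differentiableAt, ?_⟩
  rw [funext fun s => (hasDerivAt_gamma_apply ha ha1 s k).deriv]
  exact contDiff_gammaDeriv ha ha1 k

theorem contDiff_fMin (ha : 0 < a) (ha1 : a < 1) : ContDiff ℝ ∞ (fMin a) := by
  refine contDiff_euclidean.2 fun k => ?_
  simp only [fMin_apply]
  exact (((contDiff_gamma_apply ha ha1 k).comp (contDiff_fst.add contDiff_snd)).add
    ((contDiff_gamma_apply ha ha1 k).comp (contDiff_fst.sub contDiff_snd))).div_const 2

theorem exists_chart_min (ha : 0 < a) (ha1 : a < 1) {p : ℝ × ℝ} (hp : p ∈ rectangle) :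
    ∃ φ : OpenPartialHomeomorph R31 R31, fMin a p ∈ φ.source ∧
      ContDiffOn ℝ ∞ φ φ.source ∧ ContDiffOn ℝ ∞ φ.symm φ.target ∧
      ∀ x ∈ φ.source, x ∈ Omega1 a ↔ 0 ≤ φ x 0 ∧ 0 ≤ φ x 1 ∧ φ x 2 = 0 := by
  obtain ⟨L, hinj, hL⟩ := isImmersedMin ha ha1 p hp
  have hp' := mem_closedRectangle_of_mem_rectangle hp
  obtain ⟨e, c, η, hη, he⟩ := exists_edge_coordinate (b := π / 4) (by positivity) p.1
  -- The second quadrant coordinate is `π/2 - v`. The side `v = 0` is no edge of the surface and is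
  -- left out by the open condition `0 < v`.
  have hcoord : ∀ x : ℝ × ℝ, (e.prodCongr (ContinuousLinearEquiv.neg ℝ)) x + (c, π / 2) =
      (e x.1 + c, -x.2 + π / 2) := fun x => rfl
  have hU : IsOpen ({x : ℝ × ℝ | |x.1 - p.1| < η} ∩ {x | 0 < x.2}) :=
    (isOpen_abs_sub_lt _ _).inter (isOpen_lt continuous_const continuous_snd)
  refine exists_chart_of_coords (e.prodCongr (ContinuousLinearEquiv.neg ℝ)) (c, π / 2) hU
    (contDiff_fMin ha ha1).contDiffOn ⟨by simpa using hη, hp.2.1⟩ hL hinj ?_ ?_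
  · intro x hx h0 h1
    rw [hcoord] at h0 h1
    exact Or.inr ⟨x, ⟨(he _ hx.1).1 h0, hx.2, by simp only at h1; linarith⟩, rfl⟩
  · intro V hV hpV hVU
    obtain ⟨N, hN, hxN, hNS⟩ := exists_open_of_preimage ha ha1 (x := fMin a p) (W₁ := ∅) (W₂ := V)
      (fun z hz h => by
        obtain ⟨s, -, -, rfl⟩ := fMax_eq_fMin ha ha1 hz hp' h
        exact absurd hp.2.1 (lt_irrefl _))
      (fun x hx h => by
        rw [injOn_fMin ha ha1 hx hp' h]
        exact hV.mem_nhds hpV)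
    refine ⟨N, hN, hxN, fun y hy hyO => ?_⟩
    rcases hNS y hy hyO with ⟨z, hz, -⟩ | ⟨x, hxV, hx, hxy⟩
    · exact absurd hz (Set.notMem_empty z)
    · refine ⟨x, hxV, ?_, ?_, hxy⟩
      · rw [hcoord]
        exact (he _ (hVU hxV).1).2 hx.1
      · rw [hcoord]
        have := hx.2.2
        simp only
        linarith

theorem exists_chart_fold (ha : 0 < a) (ha1 : a < 1) {u₀ : ℝ} (hu₀ : u₀ ∈ Set.Icc 0 (π / 4)) :
    ∃ φ : OpenPartialHomeomorph R31 R31, gamma a u₀ ∈ φ.source ∧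
      ContDiffOn ℝ ∞ φ φ.source ∧ ContDiffOn ℝ ∞ φ.symm φ.target ∧
      ∀ x ∈ φ.source, x ∈ Omega1 a ↔ 0 ≤ φ x 0 ∧ 0 ≤ φ x 1 ∧ φ x 2 = 0 := by
  obtain ⟨δ, hδ, F, L, hF, hL, hinj, hmin, hmax⟩ := exists_foldExtension ha ha1 hu₀
  obtain ⟨e, c, η, hη, he⟩ := exists_edge_coordinate (b := π / 4) (by positivity) u₀
  -- The fold `s = 0` is not an edge, so the second coordinate is `s + 1`, which stays positive for
  -- `|s| < 1`.
  have hcoord : ∀ x : ℝ × ℝ, (e.prodCongr (ContinuousLinearEquiv.refl ℝ ℝ)) x + (c, 1) =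
      (e x.1 + c, x.2 + 1) := fun x => rfl
  have hball : ((u₀, 0) : ℝ × ℝ) ∈ Metric.ball ((u₀, 0) : ℝ × ℝ) δ := Metric.mem_ball_self hδ
  have hF0 : F (u₀, 0) = gamma a u₀ := by
    rw [hmin _ hball 0 (by simp), fMin_zero_right]
  set U : Set (ℝ × ℝ) := Metric.ball (u₀, 0) δ ∩ {x : ℝ × ℝ | |x.1 - u₀| < η} ∩
    {x : ℝ × ℝ | |x.2| < 1} with hUd
  have hU : IsOpen U :=
    (Metric.isOpen_ball.inter (isOpen_abs_sub_lt _ _)).inter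
      (isOpen_lt (by fun_prop) continuous_const)
  have hqU : ((u₀, 0) : ℝ × ℝ) ∈ U := ⟨⟨hball, by simpa using hη⟩, by simp⟩
  rw [← hF0]
  refine exists_chart_of_coords (e.prodCongr (ContinuousLinearEquiv.refl ℝ ℝ)) (c, 1) hU
    (hF.mono (Set.inter_subset_left.trans Set.inter_subset_left)) hqU hL hinj ?_ ?_
  · rintro ⟨u, s⟩ ⟨⟨hx, hxu⟩, hxs⟩ h0 -
    rw [hcoord] at h0
    have hu : u ∈ Set.Icc 0 (π / 4) := (he u hxu).1 h0
    rw [Omega1_eq ha ha1]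
    rcases le_total 0 s with hs | hs
    · right
      have hs1 : √s ≤ 1 := Real.sqrt_le_one.2 ((le_abs_self s).trans hxs.le)
      exact ⟨(u, √s), ⟨hu, Real.sqrt_nonneg s, by linarith [Real.pi_gt_three]⟩,
        (hmin (u, s) hx _ (Real.sq_sqrt hs)).symm⟩
    · left
      have hv := Real.sqrt_nonneg (-s)
      exact ⟨polar (Real.exp (-√(-s))) u, polar_mem_closedSector (Real.exp_pos _).le
        (Real.exp_le_one_iff.2 (by linarith)) hu.1 hu.2,
        (hmax (u, s) hx hu.1 hu.2 _ hv (Real.sq_sqrt (by linarith))).symm⟩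
  · intro V hV hqV hVU
    obtain ⟨N, hN, hxN, hNS⟩ := exists_open_of_preimage ha ha1 (x := gamma a u₀)
      -- The unfolded coordinate is `s = -(log r)²` on the maximal side and `s = v²` on the timelike
      -- side. The condition `z ≠ 0` is needed because `Real.log 0 = 0`.
      (W₁ := {z | (z.arg, -(Real.log ‖z‖) ^ 2) ∈ V ∧ z ≠ 0}) (W₂ := {x | (x.1, x.2 ^ 2) ∈ V})
      (fun z hz h => by
        rw [← fMax_circle ha ha1 hu₀] at h
        rw [injOn_fMax ha ha1 hz (polar_one_mem_closedSector hu₀) h]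
        have hre : 0 < (polar 1 u₀).re := by
          rw [polar_re, one_mul]
          exact Real.cos_pos_of_mem_Ioo ⟨by linarith [hu₀.1, Real.pi_pos],
            by linarith [hu₀.2, Real.pi_pos]⟩
        have hz0 : polar 1 u₀ ≠ 0 := Complex.slitPlane_ne_zero (Or.inl hre)
        have hc : ContinuousAt (fun z : ℂ => (z.arg, -(Real.log ‖z‖) ^ 2)) (polar 1 u₀) := by
          refine (Complex.continuousAt_arg (Or.inl hre)).prodMk
            ((continuousAt_id.norm.log (norm_ne_zero_iff.2 hz0)).pow 2).neg
        refine Filter.inter_mem (hc.preimage_mem_nhds (hV.mem_nhds ?_))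
          (isOpen_ne.mem_nhds hz0)
        rw [arg_polar one_pos hu₀.1 hu₀.2, norm_polar zero_le_one]
        simpa using hqV)
      (fun x hx h => by
        rw [← fMin_zero_right] at h
        rw [injOn_fMin ha ha1 hx (mk_zero_mem_closedRectangle hu₀) h]
        have hc : Continuous fun x : ℝ × ℝ => (x.1, x.2 ^ 2) := by fun_prop
        exact (hV.preimage hc).mem_nhds (by simpa using hqV))
    refine ⟨N, hN, by rwa [hF0], fun y hy hyO => ?_⟩
    have key : ∀ x ∈ V, x.1 ∈ Set.Icc 0 (π / 4) → F x = y →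
        ∃ x ∈ V, 0 ≤ ((e.prodCongr (ContinuousLinearEquiv.refl ℝ ℝ)) x + (c, 1)).1 ∧
          0 ≤ ((e.prodCongr (ContinuousLinearEquiv.refl ℝ ℝ)) x + (c, 1)).2 ∧ F x = y := by
      intro x hx hx1 hxy
      refine ⟨x, hx, ?_, ?_, hxy⟩
      · rw [hcoord]
        exact (he _ (hVU hx).1.2).2 hx1
      · rw [hcoord]
        have h3 : |x.2| < 1 := (hVU hx).2
        have := (abs_lt.1 h3).1
        simp only
        linarith
    rcases hNS y hy hyO with ⟨z, ⟨hzV, hz0⟩, hz, hzy⟩ | ⟨x, hxV, hx, hxy⟩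
    · obtain ⟨r, θ, hr0, hr1, h0, h1, rfl⟩ := exists_polar hz
      have hr : 0 < r := by
        refine hr0.lt_of_ne fun h => hz0 ?_
        simp [polar, ← h]
      rw [arg_polar hr h0 h1, norm_polar hr0] at hzV
      refine key _ hzV ⟨h0, h1⟩ ?_
      rw [hmax _ (hVU hzV).1.1 h0 h1 (-Real.log r) (by linarith [Real.log_nonpos hr0 hr1])
        (by simp), neg_neg, Real.exp_log hr, hzy]
    · refine key _ hxV hx.1 ?_
      rw [hmin _ (hVU hxV).1.1 x.2 rfl, hxy]

theorem isEmbeddedSurface_Omega1 (ha : 0 < a) (ha1 : a < 1) : IsEmbeddedSurface (Omega1 a) := by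
  rintro x ((⟨z, hz, rfl⟩ | ⟨s, hs, rfl⟩) | ⟨p, hp, rfl⟩)
  · rcases eq_or_ne z (branchPoint a) with rfl | hne
    · exact exists_chart_branchPoint ha ha1
    · exact exists_chart_max ha ha1 hz hne
  · exact exists_chart_fold ha ha1 hs
  · exact exists_chart_min ha ha1 hp

theorem isEmbeddedPiece (ha : 0 < a) (ha1 : a < 1) : IsEmbeddedPiece a where
  injOn_max := (injOn_fMax ha ha1).mono sector_subset_closedSector
  injOn_fold := fun s _ t _ h =>
    (strictMono_gamma_height ha ha1).injective (congrArg (fun x : R31 => x 0) h)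
  injOn_min := (injOn_fMin ha ha1).mono fun _ => mem_closedRectangle_of_mem_rectangle
  disjoint_max_fold := by
    refine Set.disjoint_left.2 ?_
    rintro _ ⟨z, hz, rfl⟩ ⟨s, hs, h⟩
    rw [← fMin_zero_right] at h
    exact fMax_ne_fMin ha ha1 (sector_subset_closedSector hz) hz.1
      (mk_zero_mem_closedRectangle hs) h.symm
  disjoint_max_min := by
    refine Set.disjoint_left.2 ?_
    rintro _ ⟨z, hz, rfl⟩ ⟨p, hp, h⟩
    exact fMax_ne_fMin ha ha1 (sector_subset_closedSector hz) hz.1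
      (mem_closedRectangle_of_mem_rectangle hp) h.symm
  disjoint_fold_min := by
    refine Set.disjoint_left.2 ?_
    rintro _ ⟨s, hs, rfl⟩ ⟨p, hp, h⟩
    rw [← fMin_zero_right] at h
    have := injOn_fMin ha ha1 (mem_closedRectangle_of_mem_rectangle hp)
      (mk_zero_mem_closedRectangle hs) h
    have hp2 := hp.2.1
    rw [this] at hp2
    exact lt_irrefl _ hp2
  immersed_max := isImmersedMax ha ha1
  immersed_min := isImmersedMin ha ha1
  embedded := isEmbeddedSurface_Omega1 ha ha1

end EmbeddedPiece

section Triangle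

/-! ### The isosceles right triangle with vertical hypotenuse from `(0, d)` to `(0, c)` -/

/-- The vertex of the right angle. -/
def apex (c d : ℝ) : Plane := !₂[(d - c) / 2, (c + d) / 2]

theorem mem_segment_iff_of_lt {A B : Plane} {i : Fin 2} (h : A i < B i) (y : Plane) :
    y ∈ segment ℝ A B ↔
      (y 0 - A 0) * (B 1 - A 1) = (y 1 - A 1) * (B 0 - A 0) ∧ A i ≤ y i ∧ y i ≤ B i := by
  rw [segment_eq_image_lineMap]
  constructor
  · rintro ⟨t, ⟨h0, h1⟩, rfl⟩
    simp only [AffineMap.lineMap_apply, vsub_eq_sub, vadd_eq_add, PiLp.add_apply, PiLp.smul_apply,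
      PiLp.sub_apply, smul_eq_mul]
    exact ⟨by ring, by nlinarith, by nlinarith⟩
  · rintro ⟨hc, h1, h2⟩
    have hne : B i - A i ≠ 0 := by linarith
    refine ⟨(y i - A i) / (B i - A i), ⟨div_nonneg (by linarith) (by linarith),
      div_le_one_of_le₀ (by linarith) (by linarith)⟩, ?_⟩
    ext k
    simp only [AffineMap.lineMap_apply, vsub_eq_sub, vadd_eq_add, PiLp.add_apply, PiLp.smul_apply,
      PiLp.sub_apply, smul_eq_mul]
    have : (y i - A i) * (B k - A k) = (y k - A k) * (B i - A i) := by
      fin_cases i <;> fin_cases k <;> simp only [Fin.zero_eta, Fin.mk_one] <;> linarith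
    rw [div_mul_eq_mul_div, this, mul_div_cancel_right₀ _ hne]
    ring

theorem mem_hypotenuse {c d : ℝ} (h : d < c) (y : Plane) :
    y ∈ segment ℝ (!₂[0, d] : Plane) !₂[0, c] ↔ y 0 = 0 ∧ d ≤ y 1 ∧ y 1 ≤ c := by
  rw [mem_segment_iff_of_lt (i := 1) (by simpa using h)]
  simp [sub_eq_zero, h.ne']

theorem mem_upper_leg {c d : ℝ} (h : d < c) (y : Plane) :
    y ∈ segment ℝ (apex c d) !₂[0, c] ↔ y 1 - y 0 = c ∧ (d - c) / 2 ≤ y 0 ∧ y 0 ≤ 0 := by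
  rw [mem_segment_iff_of_lt (i := 0) (by simp [apex]; linarith)]
  simp only [apex, PiLp.toLp_apply, Matrix.cons_val_zero, Matrix.cons_val_one]
  refine and_congr_left fun _ => ⟨fun h1 => ?_, fun h1 => ?_⟩
  · have h2 : (c - d) * (y 1 - y 0 - c) = 0 := by linear_combination -2 * h1
    linarith [(mul_eq_zero.1 h2).resolve_left (by linarith)]
  · linear_combination (-(c - d) / 2) * h1

theorem mem_lower_leg {c d : ℝ} (h : d < c) (y : Plane) :
    y ∈ segment ℝ (apex c d) !₂[0, d] ↔ y 0 + y 1 = d ∧ (d - c) / 2 ≤ y 0 ∧ y 0 ≤ 0 := by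
  rw [mem_segment_iff_of_lt (i := 0) (by simp [apex]; linarith)]
  simp only [apex, PiLp.toLp_apply, Matrix.cons_val_zero, Matrix.cons_val_one]
  refine and_congr_left fun _ => ⟨fun h1 => ?_, fun h1 => ?_⟩
  · have h2 : (c - d) * (y 0 + y 1 - d) = 0 := by linear_combination -2 * h1
    linarith [(mul_eq_zero.1 h2).resolve_left (by linarith)]
  · linear_combination (-(c - d) / 2) * h1

theorem isIsoscelesRightTriangle_of_eq {c d : ℝ} (h : d < c) {T : Set Plane}
    (hT : T = segment ℝ (apex c d) !₂[0, c] ∪ segment ℝ (apex c d) !₂[0, d] ∪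
      segment ℝ !₂[0, d] !₂[0, c]) : IsIsoscelesRightTriangle T := by
  refine ⟨!₂[0, c], apex c d, !₂[0, d], ?_, ?_, ?_, ?_⟩
  · intro h1
    have := congrArg (fun x : Plane => x 0) h1
    simp [apex] at this
    linarith
  · simp only [EuclideanSpace.dist_eq, Fin.sum_univ_two, Real.dist_eq, sq_abs, apex,
      Matrix.cons_val_zero, Matrix.cons_val_one]
    congr 1
    ring
  · rw [EuclideanGeometry.angle, ← InnerProductGeometry.inner_eq_zero_iff_angle_eq_pi_div_two]
    simp only [PiLp.inner_apply, Fin.sum_univ_two, apex, vsub_eq_sub, PiLp.sub_apply,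
      Matrix.cons_val_zero, Matrix.cons_val_one, RCLike.inner_apply,
      conj_trivial]
    ring
  · rw [hT, segment_symm ℝ (!₂[0, c] : Plane) (apex c d)]

theorem mem_convexHull_triangle {c d : ℝ} (h : d < c) {T : Set Plane} (hP : !₂[0, c] ∈ T)
    (hQ : !₂[0, d] ∈ T) (hB : apex c d ∈ T) {y : Plane} (h0 : y 0 ≤ 0) (h1 : d ≤ y 0 + y 1)
    (h2 : y 1 - y 0 ≤ c) : y ∈ convexHull ℝ T := by
  have hcd : 0 < c - d := by linarith
  have hsub := subset_convexHull ℝ T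
  have key := (convex_convexHull ℝ T).sum_mem (t := Finset.univ (α := Fin 3))
    -- Barycentric coordinates: each numerator is nonnegative by one of the three inequalities of
    -- the sides.
    (w := ![(y 0 + y 1 - d) / (c - d), (c - y 1 + y 0) / (c - d), -2 * y 0 / (c - d)])
    (z := ![!₂[0, c], !₂[0, d], apex c d]) (by
      intro i _
      fin_cases i
      · exact div_nonneg (by linarith) hcd.le
      · exact div_nonneg (by linarith) hcd.le
      · exact div_nonneg (by linarith) hcd.le) (by
      simp [Fin.sum_univ_three]
      field_simp
      ring) (by
      intro i _
      fin_cases i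
      · exact hsub hP
      · exact hsub hQ
      · exact hsub hB)
  convert key using 1
  ext k
  fin_cases k
  · simp [Fin.sum_univ_three, apex]
    field_simp
    ring
  · simp [Fin.sum_univ_three, apex]
    field_simp
    ring

end Triangle

section Boundary

variable {a : ℝ}

/-! ### The projection of the boundary -/

theorem proj_zero (x : R31) : proj x 0 = x 1 := rfl

theorem proj_one (x : R31) : proj x 1 = x 2 := rfl

theorem axis_mem (r : ℝ) (hr : 0 ≤ r) : (polar r 0).arg = 0 := by
  rw [polar_zero]
  exact Complex.arg_ofReal_of_nonneg hr

theorem polar_mem_sector {r θ : ℝ} (hr0 : 0 ≤ r) (hr1 : r < 1) (hθ : θ ∈ Set.Icc 0 (π / 4)) :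
    polar r θ ∈ sector :=
  mem_sector_of_mem_closedSector (polar_mem_closedSector hr0 hr1.le hθ.1 hθ.2)
    (by rwa [norm_polar hr0])

/-- Zero lies between: `x₂` falls strictly to zero along the axis, and `γ₁ + γ₂` starts at zero and
decreases. So the triangle is nondegenerate. -/
theorem bottom_lt_top (ha : 0 < a) (ha1 : a < 1) : gamma a (π / 2) 2 < fMax a 0 2 := by
  have h1 := strictAntiOn_axis ha ha1 (Set.left_mem_Icc.2 zero_le_one)
    (Set.right_mem_Icc.2 zero_le_one) zero_lt_one
  simp only [polarMax_zero_right, polarMax_zero_one] at h1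
  have h2 := antitoneOn_gamma_sum ha ha1 (Set.left_mem_Icc.2 pi_div_four_mem.1) pi_div_four_mem
    pi_div_four_mem.1
  simp only [gamma_zero, gamma_sum_corner ha ha1] at h2
  linarith

/-- The projection of the fundamental piece lies in the triangle. -/
theorem proj_bounds (ha : 0 < a) (ha1 : a < 1) {x : R31} (hx : x ∈ Omega1 a) :
    x 1 ≤ 0 ∧ gamma a (π / 2) 2 ≤ x 1 + x 2 ∧ x 2 - x 1 ≤ fMax a 0 2 := by
  rw [Omega1_eq ha ha1] at hx
  rw [← gamma_sum_corner ha ha1, ← sub_zero (fMax a 0 2), ← (fMax_zero ha ha1).2]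
  rcases hx with ⟨z, hz, rfl⟩ | ⟨p, hp, rfl⟩
  · exact ⟨(fMax_one_nonpos ha ha1 hz).trans_eq (fMax_zero ha ha1).2.symm, sum_ge ha ha1 hz,
      diff_le ha ha1 hz⟩
  · obtain ⟨h1, h2, h3⟩ := fMin_bounds ha ha1 hp
    exact ⟨h1.trans_eq (fMax_zero ha ha1).2.symm, h2, h3⟩

theorem boundary_subset : boundary a ⊆ Omega1 a := by
  have hu : (0 : ℝ) ∈ Set.Icc 0 (π / 4) := Set.left_mem_Icc.2 pi_div_four_mem.1
  rintro x (((((⟨z, hz, rfl⟩ | rfl) | ⟨v, hv, rfl⟩) | ((⟨z, hz, rfl⟩ | rfl) | ⟨v, hv, rfl⟩)) |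
    ⟨z, hz, rfl⟩) | ⟨u, hu', rfl⟩)
  · exact Or.inl (Or.inl ⟨z, hz.1, rfl⟩)
  · exact Or.inl (Or.inr ⟨0, hu, rfl⟩)
  · exact Or.inr ⟨_, ⟨hu, hv⟩, rfl⟩
  · exact Or.inl (Or.inl ⟨z, hz.1, rfl⟩)
  · exact Or.inl (Or.inr ⟨_, pi_div_four_mem, rfl⟩)
  · exact Or.inr ⟨_, ⟨pi_div_four_mem, hv⟩, rfl⟩
  · exact Or.inl (Or.inl ⟨z, hz.1, rfl⟩)
  · exact Or.inr ⟨_, ⟨hu', by positivity, le_rfl⟩, rfl⟩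

theorem proj_LA (ha : 0 < a) (ha1 : a < 1) :
    proj '' (LAmax a ∪ {gamma a 0} ∪ LAmin a) =
      segment ℝ !₂[0, gamma a (π / 2) 2] !₂[0, fMax a 0 2] := by
  have hcd := bottom_lt_top ha ha1
  have hu : (0 : ℝ) ∈ Set.Icc 0 (π / 4) := Set.left_mem_Icc.2 pi_div_four_mem.1
  refine Set.Subset.antisymm ?_ ?_
  · rintro _ ⟨x, hx, rfl⟩
    rw [mem_hypotenuse hcd, proj_zero, proj_one]
    obtain ⟨-, h2, h3⟩ := proj_bounds ha ha1 (boundary_subset (Or.inl (Or.inl (Or.inl hx))))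
    suffices h : x 1 = 0 by
      rw [h] at h2 h3
      exact ⟨h, by linarith, by linarith⟩
    rcases hx with (⟨z, ⟨hz, harg⟩, rfl⟩ | rfl) | ⟨v, -, rfl⟩
    · have := (polarMax_axis ha ha1 ⟨norm_nonneg z, hz.1.le⟩).2
      have hz0 : polar ‖z‖ 0 = z := by rw [← harg, polar_norm_arg]
      rwa [polarMax, hz0] at this
    · exact gamma_zero 1
    · exact (fMin_left_edge ha ha1 v).2.1
  · intro y hy
    rw [mem_hypotenuse hcd] at hy
    obtain ⟨h0, h1, h2⟩ := hy
    rcases le_total 0 (y 1) with h | h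
    · obtain ⟨r, hr, hry⟩ := intermediate_value_Icc' zero_le_one
        (continuousOn_polarMax_right ha ha1 2 hu)
        (show y 1 ∈ _ by rw [polarMax_zero_one, polarMax_zero_right]; exact ⟨h, h2⟩)
      rcases hr.2.lt_or_eq with hr1 | rfl
      · refine ⟨_, Or.inl (Or.inl ⟨polar r 0, ⟨polar_mem_sector hr.1 hr1 hu, axis_mem r hr.1⟩,
          rfl⟩), ?_⟩
        ext k
        fin_cases k
        · exact (polarMax_axis ha ha1 hr).2.trans h0.symm
        · exact hry
      · refine ⟨_, Or.inl (Or.inr rfl), ?_⟩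
        simp only [polarMax_zero_one] at hry
        ext k
        fin_cases k
        · exact (gamma_zero 1).trans h0.symm
        · exact (gamma_zero 2).trans hry
    · obtain ⟨v, hv, hvy⟩ := intermediate_value_Icc' (by positivity : (0 : ℝ) ≤ π / 2)
        (continuous_gamma_apply ha ha1 2).continuousOn
        (show y 1 ∈ _ by rw [gamma_zero]; exact ⟨h1, h⟩)
      rcases hv.1.lt_or_eq with hv0 | rfl
      · refine ⟨_, Or.inr ⟨v, ⟨hv0, hv.2⟩, rfl⟩, ?_⟩
        obtain ⟨-, h3, h4⟩ := fMin_left_edge ha ha1 v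
        ext k
        fin_cases k
        · exact h3.trans h0.symm
        · exact h4.trans hvy
      · refine ⟨_, Or.inl (Or.inr rfl), ?_⟩
        ext k
        fin_cases k
        · exact (gamma_zero 1).trans h0.symm
        · exact hvy

theorem apex_le_of_bounds {c d x y : ℝ} (h1 : d ≤ x + y) (h2 : y - x ≤ c) : (d - c) / 2 ≤ x := by
  linarith

theorem norm_eq_of_diag {z : ℂ} (h : z = 0 ∨ z.arg = π / 4) : z = polar ‖z‖ (π / 4) := by
  rcases h with rfl | h
  · simp [polar]
  · rw [← h, polar_norm_arg]

/-- At radius `a` both diagonal relations hold, so the branch point projects to the right-angled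
vertex. -/
theorem diag_corner (ha : 0 < a) (ha1 : a < 1) :
    polarMax a 1 (π / 4, a) = (gamma a (π / 2) 2 - fMax a 0 2) / 2 := by
  have h1 := diff_diag_inner ha ha1 ⟨ha.le, le_rfl⟩
  have h2 := sum_diag_outer ha ha1 ⟨le_rfl, ha1.le⟩
  rw [(fMax_zero ha ha1).2] at h1
  rw [polarMax_circle ha ha1 pi_div_four_mem, polarMax_circle ha ha1 pi_div_four_mem,
    gamma_sum_corner ha ha1] at h2
  linarith

theorem proj_LB (ha : 0 < a) (ha1 : a < 1) :
    proj '' (LBmax a ∪ {gamma a (π / 4)} ∪ LBmin a) =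
      segment ℝ (apex (fMax a 0 2) (gamma a (π / 2) 2)) !₂[0, gamma a (π / 2) 2] := by
  have hcd := bottom_lt_top ha ha1
  have hsum : ∀ r ∈ Set.Icc a 1, polarMax a 1 (π / 4, r) + polarMax a 2 (π / 4, r) =
      gamma a (π / 2) 2 := fun r hr => by
    rw [sum_diag_outer ha ha1 hr, polarMax_circle ha ha1 pi_div_four_mem,
      polarMax_circle ha ha1 pi_div_four_mem, gamma_sum_corner ha ha1]
  refine Set.Subset.antisymm ?_ ?_
  · rintro _ ⟨x, hx, rfl⟩
    rw [mem_lower_leg hcd, proj_zero, proj_one]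
    obtain ⟨h1, h2, h3⟩ := proj_bounds ha ha1 (boundary_subset (Or.inl (Or.inl (Or.inr hx))))
    refine ⟨?_, apex_le_of_bounds h2 h3, h1⟩
    rcases hx with (⟨z, ⟨hz, hza, harg⟩, rfl⟩ | rfl) | ⟨v, -, rfl⟩
    · have := hsum ‖z‖ ⟨hza, hz.1.le⟩
      rwa [polarMax, polarMax, ← harg, polar_norm_arg] at this
    · exact gamma_sum_corner ha ha1
    · exact (fMin_right_edge ha ha1 v).2.trans (gamma_sum_corner ha ha1)
  · intro y hy
    rw [mem_lower_leg hcd] at hy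
    obtain ⟨h0, h1, h2⟩ := hy
    have hg : polarMax a 1 (π / 4, 1) = gamma a (π / 4) 1 :=
      polarMax_circle ha ha1 pi_div_four_mem 1
    have hfold : y 0 = gamma a (π / 4) 1 →
        y ∈ proj '' (LBmax a ∪ {gamma a (π / 4)} ∪ LBmin a) := fun h => by
      refine ⟨_, Or.inl (Or.inr rfl), ?_⟩
      have := gamma_sum_corner ha ha1
      ext k
      fin_cases k
      · exact h.symm
      · change gamma a (π / 4) 2 = y 1
        linarith
    rcases le_total (y 0) (gamma a (π / 4) 1) with h | h
    · obtain ⟨r, hr, hry⟩ := intermediate_value_Icc ha1.le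
        (continuousOn_polarMax_diag ha ha1 1 ha.le le_rfl)
        (show y 0 ∈ _ by rw [diag_corner ha ha1, hg]; exact ⟨h1, h⟩)
      rcases hr.2.lt_or_eq with hr1 | rfl
      · have hr0 : 0 < r := ha.trans_le hr.1
        refine ⟨_, Or.inl (Or.inl ⟨polar r (π / 4), ⟨polar_mem_sector hr0.le hr1 pi_div_four_mem,
          by rw [norm_polar hr0.le]; exact hr.1, arg_polar hr0 pi_div_four_mem.1 le_rfl⟩,
          rfl⟩), ?_⟩
        have := hsum r hr
        ext k
        fin_cases k
        · exact hry
        · change polarMax a 2 (π / 4, r) = y 1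
          simp only at hry
          linarith
      · exact hfold (hry.symm.trans hg)
    · obtain ⟨v, hv, hvy⟩ := intermediate_value_Icc (by positivity : (0 : ℝ) ≤ π / 2)
        ((continuous_fMin_apply ha ha1 1).comp (Continuous.prodMk_right (π / 4))).continuousOn
        (show y 0 ∈ _ by
          simp only [Function.comp, fMin_zero_right, (fMin_bottom_edge ha ha1 _).2.1]
          exact ⟨h, h2⟩)
      simp only [Function.comp] at hvy
      rcases hv.1.lt_or_eq with hv0 | rfl
      · refine ⟨_, Or.inr ⟨v, ⟨hv0, hv.2⟩, rfl⟩, ?_⟩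
        have h3 := (fMin_right_edge ha ha1 v).2
        rw [gamma_sum_corner ha ha1] at h3
        ext k
        fin_cases k
        · exact hvy
        · change fMin a (π / 4, v) 2 = y 1
          linarith
      · rw [fMin_zero_right] at hvy
        exact hfold hvy.symm

theorem proj_LCmax (ha : 0 < a) (ha1 : a < 1) :
    proj '' LCmax a =
      segment ℝ (apex (fMax a 0 2) (gamma a (π / 2) 2)) !₂[0, fMax a 0 2] := by
  have hcd := bottom_lt_top ha ha1
  have hdiff : ∀ r ∈ Set.Icc 0 a, polarMax a 2 (π / 4, r) - polarMax a 1 (π / 4, r) =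
      fMax a 0 2 := fun r hr => by
    rw [diff_diag_inner ha ha1 hr, (fMax_zero ha ha1).2, sub_zero]
  refine Set.Subset.antisymm ?_ ?_
  · rintro _ ⟨x, hx, rfl⟩
    rw [mem_upper_leg hcd, proj_zero, proj_one]
    obtain ⟨h1, h2, h3⟩ := proj_bounds ha ha1 (boundary_subset (Or.inl (Or.inr hx)))
    refine ⟨?_, apex_le_of_bounds h2 h3, h1⟩
    obtain ⟨z, ⟨-, hza, harg⟩, rfl⟩ := hx
    have := hdiff ‖z‖ ⟨norm_nonneg z, hza⟩
    rwa [polarMax, polarMax, ← norm_eq_of_diag harg] at this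
  · intro y hy
    rw [mem_upper_leg hcd] at hy
    obtain ⟨h0, h1, h2⟩ := hy
    obtain ⟨r, hr, hry⟩ := intermediate_value_Icc' ha.le
      (continuousOn_polarMax_diag ha ha1 1 le_rfl ha1.le)
      (show y 0 ∈ _ by
        rw [diag_corner ha ha1, polarMax_zero_right, (fMax_zero ha ha1).2]; exact ⟨h1, h2⟩)
    refine ⟨_, ⟨polar r (π / 4), ⟨polar_mem_sector hr.1 (hr.2.trans_lt ha1) pi_div_four_mem,
      by rw [norm_polar hr.1]; exact hr.2, ?_⟩, rfl⟩, ?_⟩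
    · rcases hr.1.lt_or_eq with h | h
      · exact Or.inr (arg_polar h pi_div_four_mem.1 le_rfl)
      · left
        simp [polar, ← h]
    · have := hdiff r hr
      ext k
      fin_cases k
      · exact hry
      · change polarMax a 2 (π / 4, r) = y 1
        simp only at hry
        linarith

theorem proj_LCmin_subset (ha : 0 < a) (ha1 : a < 1) :
    proj '' LCmin a ⊆ {!₂[0, gamma a (π / 2) 2]} := by
  rintro _ ⟨_, ⟨u, -, rfl⟩, rfl⟩
  obtain ⟨-, h1, h2⟩ := fMin_bottom_edge ha ha1 u
  ext k
  fin_cases k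
  · exact h1
  · exact h2

theorem proj_boundary (ha : 0 < a) (ha1 : a < 1) :
    proj '' boundary a =
      segment ℝ (apex (fMax a 0 2) (gamma a (π / 2) 2)) !₂[0, fMax a 0 2] ∪
      segment ℝ (apex (fMax a 0 2) (gamma a (π / 2) 2)) !₂[0, gamma a (π / 2) 2] ∪
      segment ℝ !₂[0, gamma a (π / 2) 2] !₂[0, fMax a 0 2] := by
  have h : proj '' LCmin a ⊆ segment ℝ !₂[0, gamma a (π / 2) 2] !₂[0, fMax a 0 2] :=
    (proj_LCmin_subset ha ha1).trans (Set.singleton_subset_iff.2 (left_mem_segment ℝ _ _))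
  rw [boundary, Set.image_union, Set.image_union, Set.image_union, proj_LA ha ha1, proj_LB ha ha1,
    proj_LCmax ha ha1]
  ext y
  have := @h y
  simp only [Set.mem_union]
  tauto

/-- The end points of the vertical edge already differ in height by this amount, which is the bound
for the height on both pieces. -/
theorem le_lengthLCmin (ha : 0 < a) (ha1 : a < 1) : gamma a (π / 4) 0 ≤ lengthLCmin a := by
  have hc : IsCompact (LCmin a) := isCompact_Icc.image
    ((continuous_fMin ha ha1).comp (Continuous.prodMk_left (π / 2)))
  have h1 := Metric.dist_le_diam_of_mem hc.isBounded
    (Set.mem_image_of_mem (fun u => fMin a (u, π / 2)) pi_div_four_mem)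
    (Set.mem_image_of_mem (fun u => fMin a (u, π / 2)) (Set.left_mem_Icc.2 pi_div_four_mem.1))
  rw [dist_eq_norm] at h1
  have h2 := PiLp.norm_apply_le (fMin a (π / 4, π / 2) - fMin a (0, π / 2)) 0
  rw [PiLp.sub_apply, (fMin_bottom_edge ha ha1 _).1, (fMin_bottom_edge ha ha1 _).1, gamma_zero,
    sub_zero] at h2
  exact (le_abs_self _).trans (h2.trans h1)

theorem Omega1_subset_prism (ha : 0 < a) (ha1 : a < 1) : Omega1 a ⊆ prism a := by
  intro x hx
  obtain ⟨h1, h2, h3⟩ := proj_bounds ha ha1 hx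
  have hT := proj_boundary ha ha1
  refine ⟨mem_convexHull_triangle (bottom_lt_top ha ha1) ?_ ?_ ?_ h1 h2 h3, ?_⟩
  · rw [hT]
    exact Or.inr (right_mem_segment ℝ _ _)
  · rw [hT]
    exact Or.inr (left_mem_segment ℝ _ _)
  · rw [hT]
    exact Or.inl (Or.inl (left_mem_segment ℝ _ _))
  · have hlen := le_lengthLCmin ha ha1
    rw [Omega1_eq ha ha1] at hx
    rcases hx with ⟨z, hz, rfl⟩ | ⟨p, hp, rfl⟩
    · exact ⟨(height_mem_Icc ha ha1 hz).1, (height_mem_Icc ha ha1 hz).2.trans hlen⟩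
    · have := fMin_height_mem_Icc ha ha1 hp.1 p.2
      exact ⟨this.1, this.2.trans hlen⟩

end Boundary

end SchwarzD

end


theorem mainTheorem2 (a : ℝ) (ha0 : 0 < a) (ha1 : a < 1) :
    SchwarzD.IsEmbeddedPiece a ∧
    SchwarzD.IsIsoscelesRightTriangle (SchwarzD.proj '' SchwarzD.boundary a) ∧
    SchwarzD.Omega1 a ⊆ closure (SchwarzD.prism a) :=
  ⟨SchwarzD.isEmbeddedPiece ha0 ha1,
    SchwarzD.isIsoscelesRightTriangle_of_eq (SchwarzD.bottom_lt_top ha0 ha1)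
      (SchwarzD.proj_boundary ha0 ha1),
    (SchwarzD.Omega1_subset_prism ha0 ha1).trans subset_closure⟩
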